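/- **Theorem 2.** The generalised Bernoulli polynomials $B_n^{(\mu)}(z)$ are defined by $\bigl(\frac{t}{e^t-1}\bigr)^{\mu}e^{zt}=\sum_{n\ge0}B_n^{(\mu)}(z)\frac{t^n}{n!}$ $(|t|<2\pi)$. Let $0<x<1$ be fixed, let $$h=\frac{x}{1-x},\qquad L=\sqrt{\log^2h+\pi^2},\qquad \log h\pm\pi i=L\,e^{\pm i\omega}\ \ (0<\omega<\pi),\qquad \Theta(x)=\pi nx-\omega+\tfrac12\pi,$$ and let $(\tfrac12)_k$ be the Pochhammer symbol. The points $\log h\pm\pi i$ are saddle points of $\psi(s)=\log(e^s-1)-xs$. Put $\lambda=\log h-\pi i$. (i) There is an analytic function $s=s(w)$ near $w=0$ with $s(0)=\lambda$, $s'(0)\ne0$ and $\psi(s(w))-\psi(\lambda)=\tfrac12w^2$ (with the branch of the logarithm continuous near $\lambda$), and the numbers $A_k=A_k(-h,\lambda)$ $(k\ge0)$ such that the even part of $\frac{1}{s}\frac{ds}{dw}$ equals $\frac{s'(0)}{\lambda}\bigl\{1+A_1w^2+A_2w^4+\cdots\bigr\}$, $A_0=1$, do not depend on the choice of $s(w)$.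 The first of them are the values at $(-h,\lambda)$ of $$A_1(h,\lambda)=\frac{1}{12h}\Bigl\{-(1-h+h^2)+\frac{6(h^2-1)}{\lambda}-\frac{12(h-1)^2}{\lambda^2}\Bigr\},$$ $$A_2(h,\lambda)=\frac{1}{864h^2}\Bigl\{(1-h+h^2)^2-\frac{12}{\lambda}(h^2-1)(3-5h+3h^2)+\frac{120}{\lambda^2}(h-1)^2(2+h+2h^2)-\frac{720}{\lambda^3}(h+1)(h-1)^3+\frac{864}{\lambda^4}(h-1)^4\Bigr\},$$ $$\begin{aligned}A_3(h,\lambda)=\frac{1}{777600h^3}\Bigl\{&139-417h+402h^2-109h^3+402h^4-417h^5+139h^6+\frac{90}{\lambda}(h^2-1)(1-h+h^2)(5-9h+5h^2)\\&-\frac{1260}{\lambda^2}(h-1)^2(13-8h-3h^2-8h^3+13h^4)+\frac{15120}{\lambda^3}(h-1)^3(h+1)(8-5h+8h^2)\\&-\frac{453600}{\lambda^4}(h-1)^4(1+h+h^2)+\frac{907200}{\lambda^5}(h-1)^5(h+1)-\frac{777600}{\lambda^6}(h-1)^6\Bigr\}.\end{aligned}$$ (ii) As $n\to\infty$ through the positive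 integers, $$B_n^{(n)}(nx)\sim\frac{2(-1)^n n!}{\sqrt{2\pi n}}\,\frac{(1-x)^{n-1}}{\sqrt{\log^2h+\pi^2}}\Bigl(\frac{x}{1-x}\Bigr)^{nx-1/2}\Bigl\{\cos\Theta(x)\sum_{k=0}^\infty\frac{2^k(\frac12)_k}{n^k}\,\mathrm{Re}\,A_k+\sin\Theta(x)\sum_{k=1}^\infty\frac{2^k(\frac12)_k}{n^k}\,\mathrm{Im}\,A_k\Bigr\},$$ in the sense that, for every integer $K\ge0$, if both sums are restricted to $k<K$ then the expression in braces has to be corrected by an error $O(n^{-K})$ (the implied constant depends on $x$ and $K$ only). (iii) If $x=\tfrac12$, then $\mathrm{Im}\,A_k=0$ for all $k$, $B_n^{(n)}(\tfrac12n)=0$ for odd $n$, and, with $C_k=(-1)^k\,\mathrm{Re}\,A_k$ (here $h=1$, $\lambda=-\pi i$), $$B_n^{(n)}(\tfrac12n)\sim\frac{2^{2-n}n!}{\sqrt{2\pi n}}\,\frac{\cos\frac12\pi n}{\pi}\sum_{k=0}^\infty\frac{(-2)^k(\frac12)_k}{n^k}\,C_k\qquad(n\to\infty)$$ in the same sense (for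 every $K$, the terms $k<K$ leave an error $O\bigl(\frac{2^{2-n}n!}{\pi\sqrt{2\pi n}}\,n^{-K}\bigr)$), where $$C_0=1,\quad C_1=\frac{16-\pi^2}{4\pi^2},\quad C_2=\frac{1536-160\pi^2+\pi^4}{96\pi^4},\quad C_3=\frac{368640-53760\pi^2+1456\pi^4+15\pi^6}{5760\pi^6},$$ $$C_4=\frac{165150720-30965760\pi^2+1483776\pi^4-3904\pi^6-63\pi^8}{645120\pi^8},$$ $$C_5=\frac{39636172800-9083289600\pi^2+624476160\pi^4-10081280\pi^6-92048\pi^8-1995\pi^{10}}{38707200\pi^{10}}.$$ -/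

import Mathlib

open Filter Topology Asymptotics

/-- The generalised Bernoulli (Nörlund) polynomial `B_n^{(μ)}(z)` of order `μ ∈ ℕ`, given by the
generating function `(t / (e^t - 1))^μ e^{zt} = ∑ B_n^{(μ)}(z) t^n / n!`; the power series
`bernoulliPowerSeries ℝ` is `t / (e^t - 1)`, and `rescale z (exp ℝ)` is `e^{zt}`. -/
noncomputable def genBernoulli (μ n : ℕ) (z : ℝ) : ℝ :=
  (n.factorial : ℝ) * PowerSeries.coeff n
    (bernoulliPowerSeries ℝ ^ μ * PowerSeries.rescale z (PowerSeries.exp ℝ))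

/-- The difference `ψ(s) - ψ(s₀)` for `ψ(s) = log (e^s - 1) - s z`, with the branch of the
logarithm that is continuous for `s` near `s₀` (so that the difference vanishes at `s₀`). -/
noncomputable def psiDiff (z s₀ s : ℂ) : ℂ :=
  Complex.log ((Complex.exp s - 1) / (Complex.exp s₀ - 1)) - (s - s₀) * z

/-- `w ↦ s w` is an analytic local inversion of `ψ(s) - ψ(s₀) = w² / 2` near the saddle `s₀`. -/
structure IsSaddleInversion (z s₀ : ℂ) (s : ℂ → ℂ) : Prop where
  analyticAt : AnalyticAt ℂ s 0
  map_zero : s 0 = s₀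
  deriv_ne_zero : deriv s 0 ≠ 0
  eventually_eq : ∀ᶠ w in 𝓝 (0 : ℂ), psiDiff z s₀ (s w) = w ^ 2 / 2

/-- The coefficient of `w^(2k)` in the Taylor expansion at `0` of `(1/s) ds/dw`, divided by the
value of this function at `w = 0`. -/
noncomputable def saddleCoeff (s : ℂ → ℂ) (k : ℕ) : ℂ :=
  iteratedDeriv (2 * k) (fun w => deriv s w / s w) 0 / ((2 * k).factorial : ℂ) /
    (deriv s 0 / s 0)

/-- The closed form `A₁(h, l)`. -/
noncomputable def coeffA1 (h l : ℂ) : ℂ :=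
  1 / (12 * h) * (-(1 - h + h ^ 2) + 6 * (h ^ 2 - 1) / l - 12 * (h - 1) ^ 2 / l ^ 2)

/-- The closed form `A₂(h, l)`. -/
noncomputable def coeffA2 (h l : ℂ) : ℂ :=
  1 / (864 * h ^ 2) * ((1 - h + h ^ 2) ^ 2 - 12 / l * (h ^ 2 - 1) * (3 - 5 * h + 3 * h ^ 2)
    + 120 / l ^ 2 * (h - 1) ^ 2 * (2 + h + 2 * h ^ 2)
    - 720 / l ^ 3 * (h + 1) * (h - 1) ^ 3 + 864 / l ^ 4 * (h - 1) ^ 4)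

/-- The closed form `A₃(h, l)`. -/
noncomputable def coeffA3 (h l : ℂ) : ℂ :=
  1 / (777600 * h ^ 3) *
    ((139 - 417 * h + 402 * h ^ 2 - 109 * h ^ 3 + 402 * h ^ 4 - 417 * h ^ 5 + 139 * h ^ 6)
    + 90 / l * (h ^ 2 - 1) * (1 - h + h ^ 2) * (5 - 9 * h + 5 * h ^ 2)
    - 1260 / l ^ 2 * (h - 1) ^ 2 * (13 - 8 * h - 3 * h ^ 2 - 8 * h ^ 3 + 13 * h ^ 4)
    + 15120 / l ^ 3 * (h - 1) ^ 3 * (h + 1) * (8 - 5 * h + 8 * h ^ 2)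
    - 453600 / l ^ 4 * (h - 1) ^ 4 * (1 + h + h ^ 2)
    + 907200 / l ^ 5 * (h - 1) ^ 5 * (h + 1) - 777600 / l ^ 6 * (h - 1) ^ 6)

/-- `h = x / (1 - x)`. -/
noncomputable def saddleH (x : ℝ) : ℝ := x / (1 - x)

/-- The upper saddle `log h + π i`. -/
noncomputable def upperSaddle (x : ℝ) : ℂ := (Real.log (saddleH x) : ℂ) + Real.pi * Complex.I

/-- The lower saddle `log h - π i = L e^{-iω}`. -/
noncomputable def lowerSaddle (x : ℝ) : ℂ := (Real.log (saddleH x) : ℂ) - Real.pi * Complex.I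

/-- `Θ(x) = π n x - ω + π / 2`, where `ω ∈ (0, π)` is the argument of `log h + π i`
(the value of `arctan (π / log h)` in `(0, π)`). -/
noncomputable def phaseTheta (x : ℝ) (n : ℕ) : ℝ :=
  Real.pi * n * x - Complex.arg (upperSaddle x) + Real.pi / 2

/-- The prefactor `2 (-1)^n n! / √(2πn) · (1-x)^(n-1) / √(log² h + π²) · h^(nx - 1/2)`. -/
noncomputable def oscPrefactor (x : ℝ) (n : ℕ) : ℝ :=
  2 * (-1) ^ n * (n.factorial : ℝ) / √(2 * Real.pi * n)
    * ((1 - x) ^ ((n : ℤ) - 1) / √(Real.log (saddleH x) ^ 2 + Real.pi ^ 2))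
    * saddleH x ^ ((n : ℝ) * x - 1 / 2)

/-- The prefactor `2^(2-n) n! / √(2πn) / π` for `x = 1/2`. -/
noncomputable def midPrefactor (n : ℕ) : ℝ :=
  2 ^ (2 - (n : ℤ)) * (n.factorial : ℝ) / √(2 * Real.pi * n) / Real.pi

/-- The Pochhammer symbol `(1/2)_k`. -/
noncomputable def pochHalf (k : ℕ) : ℝ := (ascPochhammer ℝ k).eval (1 / 2)

/-! By Cauchy's formula `B_n^{(n)}(nx) / n!` is `1/(2πi)` times the integral of `(e^{xt}/(e^t-1))^n
/ t = e^{-nψ(t)}/t` around 0. The only singularity in `|Im t| < 2π` is 0, so the contour may be the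
rectangle `[-T,T] × [-π,π]`. As `0 < x < 1`, the vertical sides vanish for `T → ∞`; the horizontal
sides are conjugate, and what remains is `1/π` times the imaginary part of one line integral
(`genBernoulli_eq_im_integral`).

On `Im t = -π` the number `e^t` is negative, so `e^{xt}/(e^t-1)` has constant phase and modulus
`e^{xu}/(1+e^u)`, with a single peak at `u = log h`: the line is a steepest descent path through the
lower saddle `λ`. The local inversion `V` with `ψ(V(w)) - ψ(λ) = w²/2` (`exists_saddleInversion`)
maps small real `w` into this line (`saddleInversion_conj`) and turns the central part into a
Gaussian integral of the analytic function `V'/V`. Watson's lemma (`norm_integral_gaussian_sub_le`)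
gives the expansion; odd moments vanish and even ones produce `2^k (1/2)_k / n^k`. The leading
coefficient `V'(0)/λ` supplies the amplitude and, with the phase of the line, the angle `Θ`.

The coefficients come from `η = ψ'(V(w))`. Since `ψ'' = (ψ'+x)(1-x-ψ')` and `η V' = w`, it satisfies
`η η' = w (η+x)(1-x-η)`, which determines all Taylor coefficients recursively. At `x = 1/2` the
equation for `η²` involves only even powers of `w`; hence `η` is odd, and reflection symmetry makes
every `A_k` real. -/

/-! ### Taylor coefficients at 0 as formal power series -/

/-- The Taylor series at `0` of a complex function, as a formal power series. -/
noncomputable def taylorSeries (f : ℂ → ℂ) : PowerSeries ℂ :=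
  PowerSeries.mk fun k => iteratedDeriv k f 0 / (k.factorial : ℂ)

theorem coeff_taylorSeries (f : ℂ → ℂ) (k : ℕ) :
    PowerSeries.coeff k (taylorSeries f) = iteratedDeriv k f 0 / (k.factorial : ℂ) := by
  simp [taylorSeries]

theorem coeff_zero_taylorSeries (f : ℂ → ℂ) :
    PowerSeries.coeff 0 (taylorSeries f) = f 0 := by
  simp [taylorSeries]

theorem taylorSeries_congr {f g : ℂ → ℂ} (h : f =ᶠ[𝓝 0] g) : taylorSeries f = taylorSeries g := by
  ext k
  simp only [coeff_taylorSeries]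
  rw [(h.iteratedDeriv_eq k)]

theorem taylorSeries_mul {f g : ℂ → ℂ} (hf : AnalyticAt ℂ f 0) (hg : AnalyticAt ℂ g 0) :
    taylorSeries (fun w => f w * g w) = taylorSeries f * taylorSeries g := by
  ext k
  rw [PowerSeries.coeff_mul, Finset.Nat.sum_antidiagonal_eq_sum_range_succ_mk]
  simp only [coeff_taylorSeries]
  rw [iteratedDeriv_fun_mul (hf.contDiffAt) (hg.contDiffAt), Finset.sum_div]
  refine Finset.sum_congr rfl fun i hi => ?_
  have hi' : i ≤ k := Nat.lt_succ_iff.mp (Finset.mem_range.mp hi)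
  have h1 : (i.factorial : ℂ) ≠ 0 := by exact_mod_cast i.factorial_ne_zero
  have h2 : ((k - i).factorial : ℂ) ≠ 0 := by exact_mod_cast (k - i).factorial_ne_zero
  have h3 : (k.factorial : ℂ) ≠ 0 := by exact_mod_cast k.factorial_ne_zero
  rw [Nat.cast_choose ℂ hi']
  field_simp

theorem taylorSeries_add {f g : ℂ → ℂ} (hf : AnalyticAt ℂ f 0) (hg : AnalyticAt ℂ g 0) :
    taylorSeries (fun w => f w + g w) = taylorSeries f + taylorSeries g := by
  ext k
  simp only [map_add, coeff_taylorSeries]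
  rw [iteratedDeriv_fun_add hf.contDiffAt hg.contDiffAt, add_div]

theorem taylorSeries_const_mul (c : ℂ) (f : ℂ → ℂ) :
    taylorSeries (fun w => c * f w) = PowerSeries.C c * taylorSeries f := by
  ext k
  rw [PowerSeries.coeff_C_mul, coeff_taylorSeries, coeff_taylorSeries,
    iteratedDeriv_const_mul_field, mul_div_assoc]

theorem taylorSeries_const (c : ℂ) : taylorSeries (fun _ => c) = PowerSeries.C c := by
  ext k
  rw [coeff_taylorSeries, iteratedDeriv_const, PowerSeries.coeff_C]
  split_ifs with h <;> simp [h]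

theorem taylorSeries_id : taylorSeries (fun w => w) = PowerSeries.X := by
  ext k
  rw [coeff_taylorSeries, iteratedDeriv_fun_id_zero, PowerSeries.coeff_X]
  split_ifs with h <;> simp [h]

theorem taylorSeries_pow {f : ℂ → ℂ} (hf : AnalyticAt ℂ f 0) (n : ℕ) :
    taylorSeries (fun w => f w ^ n) = taylorSeries f ^ n := by
  induction n with
  | zero => simpa using taylorSeries_const 1
  | succ n ih =>
    simp only [pow_succ]
    rw [← ih]
    exact taylorSeries_mul (hf.pow n) hf

theorem taylorSeries_comp_neg (f : ℂ → ℂ) :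
    taylorSeries (fun w => f (-w)) = PowerSeries.rescale (-1) (taylorSeries f) := by
  ext k
  rw [coeff_taylorSeries, PowerSeries.coeff_rescale, coeff_taylorSeries, iteratedDeriv_comp_neg]
  simp [mul_div_assoc]

theorem iteratedDeriv_conj_conj (f : ℂ → ℂ) (k : ℕ) :
    iteratedDeriv k (fun w => starRingEnd ℂ (f (starRingEnd ℂ w)))
      = fun w => starRingEnd ℂ (iteratedDeriv k f (starRingEnd ℂ w)) := by
  induction k with
  | zero => simp
  | succ k ih =>
    rw [iteratedDeriv_succ, ih, iteratedDeriv_succ]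
    funext w
    have := congrFun (deriv_conj_conj (f := iteratedDeriv k f)) w
    simpa [Function.comp_def] using this

/-- Schwarz reflection on coefficients. It serves to show that `V` has real Taylor coefficients
beyond the constant term. -/
theorem coeff_taylorSeries_conj_conj (f : ℂ → ℂ) (k : ℕ) :
    PowerSeries.coeff k (taylorSeries fun w => starRingEnd ℂ (f (starRingEnd ℂ w)))
      = starRingEnd ℂ (PowerSeries.coeff k (taylorSeries f)) := by
  rw [coeff_taylorSeries, iteratedDeriv_conj_conj, coeff_taylorSeries]
  simp

theorem taylorSeries_exp_mul (c : ℂ) :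
    taylorSeries (fun w => Complex.exp (c * w)) = PowerSeries.rescale c (PowerSeries.exp ℂ) := by
  ext k
  rw [coeff_taylorSeries, PowerSeries.coeff_rescale, PowerSeries.coeff_exp,
    iteratedDeriv_cexp_const_mul]
  simp [div_eq_mul_inv]

theorem taylorSeries_deriv (f : ℂ → ℂ) (k : ℕ) :
    PowerSeries.coeff k (taylorSeries (deriv f))
      = (k + 1) * PowerSeries.coeff (k + 1) (taylorSeries f) := by
  rw [coeff_taylorSeries, coeff_taylorSeries, iteratedDeriv_succ', Nat.factorial_succ]
  have h1 : (k.factorial : ℂ) ≠ 0 := by exact_mod_cast k.factorial_ne_zero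
  have h2 : (k + 1 : ℂ) ≠ 0 := by exact_mod_cast k.succ_ne_zero
  push_cast
  field_simp

theorem taylorSeries_isBigO {f : ℂ → ℂ} (hf : AnalyticAt ℂ f 0) (N : ℕ) :
    (fun w => f w - ∑ j ∈ Finset.range N, PowerSeries.coeff j (taylorSeries f) * w ^ j)
      =O[𝓝 0] fun w => ‖w‖ ^ N := by
  have h := hf.hasFPowerSeriesAt.isBigO_sub_partialSum_pow N
  simp only [zero_add] at h
  refine h.congr_left fun w => ?_
  congr 1
  refine Finset.sum_congr rfl fun j _ => ?_
  rw [coeff_taylorSeries]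
  simp [FormalMultilinearSeries.ofScalars, mul_comm]

/-! ### The generating function as an analytic function -/

/-- The entire function `(e^t - 1) / t`. -/
noncomputable def expQuot (t : ℂ) : ℂ := dslope Complex.exp 0 t

theorem expQuot_zero : expQuot 0 = 1 := by simp [expQuot]

theorem mul_expQuot (t : ℂ) : t * expQuot t = Complex.exp t - 1 := by
  have := sub_smul_dslope Complex.exp 0 t
  simpa [expQuot] using this

theorem differentiable_expQuot : Differentiable ℂ expQuot := by
  have := (Complex.differentiableOn_dslope (f := Complex.exp) (c := 0) (s := Set.univ)
    Filter.univ_mem).mpr Complex.differentiable_exp.differentiableOn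
  exact differentiableOn_univ.mp this

/-- Both factors are tied to `e^X - 1`: `X` times the first equals it, and the second times it
equals `X`. Cancelling `X` links the analytic quotient to the formal series. -/
theorem taylorSeries_expQuot_mul_bernoulli :
    taylorSeries expQuot * bernoulliPowerSeries ℂ = 1 := by
  have hE : AnalyticAt ℂ expQuot 0 := differentiable_expQuot.analyticAt 0
  have h1 : PowerSeries.X * taylorSeries expQuot = PowerSeries.exp ℂ - 1 := by
    rw [← taylorSeries_id, ← taylorSeries_mul (f := fun w => w) analyticAt_id hE]
    have : (fun w : ℂ => w * expQuot w) = fun w => Complex.exp (1 * w) + (-1 : ℂ) := by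
      funext w; rw [mul_expQuot, one_mul, sub_eq_add_neg]
    rw [this, taylorSeries_add (by fun_prop) analyticAt_const, taylorSeries_exp_mul,
      taylorSeries_const]
    simp [sub_eq_add_neg]
  have h2 := bernoulliPowerSeries_mul_exp_sub_one ℂ
  rw [← h1] at h2
  have hX : (PowerSeries.X : PowerSeries ℂ) ≠ 0 := PowerSeries.X_ne_zero
  apply mul_left_cancel₀ hX
  linear_combination h2

/-- The generating function of the generalised Bernoulli polynomials, as a function. -/
noncomputable def bernoulliGen (m : ℕ) (z : ℂ) (t : ℂ) : ℂ :=
  (expQuot t)⁻¹ ^ m * Complex.exp (z * t)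

theorem coeff_taylorSeries_bernoulliGen (m n : ℕ) (z : ℝ) :
    PowerSeries.coeff n (taylorSeries (bernoulliGen m z))
      = ((genBernoulli m n z / n.factorial : ℝ) : ℂ) := by
  have hE : AnalyticAt ℂ expQuot 0 := differentiable_expQuot.analyticAt 0
  have hEi : AnalyticAt ℂ (fun t => (expQuot t)⁻¹) 0 := hE.inv (by simp [expQuot_zero])
  have hinv : taylorSeries (fun t => (expQuot t)⁻¹) = bernoulliPowerSeries ℂ := by
    have h1 : taylorSeries (fun t => (expQuot t)⁻¹) * taylorSeries expQuot = 1 := by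
      rw [← taylorSeries_mul hEi hE]
      have : (fun w => (expQuot w)⁻¹ * expQuot w) =ᶠ[𝓝 0] fun _ => (1 : ℂ) := by
        filter_upwards [hE.continuousAt.eventually_ne (by simp [expQuot_zero] : expQuot 0 ≠ 0)]
          with w hw
        exact inv_mul_cancel₀ hw
      rw [taylorSeries_congr this, taylorSeries_const, map_one]
    calc taylorSeries (fun t => (expQuot t)⁻¹)
        = taylorSeries (fun t => (expQuot t)⁻¹) *
          (taylorSeries expQuot * bernoulliPowerSeries ℂ) := by
          rw [taylorSeries_expQuot_mul_bernoulli, mul_one]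
      _ = bernoulliPowerSeries ℂ := by rw [← mul_assoc, h1, one_mul]
  have hmap : taylorSeries (bernoulliGen m z) = PowerSeries.map Complex.ofRealHom
      (bernoulliPowerSeries ℝ ^ m * PowerSeries.rescale z (PowerSeries.exp ℝ)) := by
    have hb : PowerSeries.map Complex.ofRealHom (bernoulliPowerSeries ℝ)
        = bernoulliPowerSeries ℂ := by
      ext k; simp [bernoulliPowerSeries]
    have he : PowerSeries.map Complex.ofRealHom (PowerSeries.rescale z (PowerSeries.exp ℝ))
        = PowerSeries.rescale (z : ℂ) (PowerSeries.exp ℂ) := by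
      ext k; simp [PowerSeries.coeff_rescale, PowerSeries.coeff_exp]
    rw [map_mul, map_pow, hb, he, ← hinv, ← taylorSeries_pow hEi, ← taylorSeries_exp_mul]
    exact taylorSeries_mul (hEi.pow m) (by fun_prop)
  have hf : (n.factorial : ℝ) ≠ 0 := by exact_mod_cast n.factorial_ne_zero
  rw [hmap, PowerSeries.coeff_map, genBernoulli, mul_div_cancel_left₀ _ hf]
  rfl

/-! ### Cauchy's coefficient formula on a rectangle -/

/-- The integral over the boundary of the rectangle `[-T, T] × [-π, π]`. -/
noncomputable def rectIntegral (T : ℝ) (H : ℂ → ℂ) : ℂ :=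
  (∫ u : ℝ in -T..T, H (u + (-Real.pi : ℝ) * Complex.I))
    - (∫ u : ℝ in -T..T, H (u + Real.pi * Complex.I))
    + Complex.I • (∫ y : ℝ in -Real.pi..Real.pi, H (T + y * Complex.I))
    - Complex.I • (∫ y : ℝ in -Real.pi..Real.pi, H ((-T : ℝ) + y * Complex.I))

theorem horizontal_ne_zero {c : ℝ} (hc : c ≠ 0) (u : ℝ) : (u + c * Complex.I : ℂ) ≠ 0 := by
  intro h; apply hc; simpa using congrArg Complex.im h

theorem vertical_ne_zero {c : ℝ} (hc : c ≠ 0) (u : ℝ) : (c + u * Complex.I : ℂ) ≠ 0 := by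
  intro h; apply hc; simpa using congrArg Complex.re h

/-- The strip `|Im t| < 2π`. -/
def bernoulliStrip : Set ℂ := {t | |t.im| < 2 * Real.pi}

theorem isOpen_bernoulliStrip : IsOpen bernoulliStrip :=
  isOpen_lt (by fun_prop) continuous_const

theorem horizontal_mem_strip {c : ℝ} (hc : |c| ≤ Real.pi) (u : ℝ) :
    (u + c * Complex.I : ℂ) ∈ bernoulliStrip := by
  have := Real.pi_pos
  simp only [bernoulliStrip, Set.mem_ofPred_eq]
  simp; linarith

theorem continuous_horizontal {H : ℂ → ℂ} (hH : ContinuousOn H (bernoulliStrip \ {0})) {c : ℝ}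
    (hc : |c| ≤ Real.pi) (hc0 : c ≠ 0) : Continuous fun u : ℝ => H (u + c * Complex.I) :=
  hH.comp_continuous (by fun_prop) fun u =>
    ⟨horizontal_mem_strip hc u, horizontal_ne_zero hc0 u⟩

theorem continuousOn_vertical {H : ℂ → ℂ} (hH : ContinuousOn H (bernoulliStrip \ {0})) {c : ℝ}
    (hc0 : c ≠ 0) :
    ContinuousOn (fun y : ℝ => H (c + y * Complex.I)) (Set.uIcc (-Real.pi) Real.pi) := by
  refine hH.comp (by fun_prop) fun y hy => ⟨?_, vertical_ne_zero hc0 y⟩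
  rw [Set.uIcc_of_le (by linarith [Real.pi_pos])] at hy
  exact horizontal_mem_strip (abs_le.mpr hy) c

theorem rectIntegral_add {H K : ℂ → ℂ} (hH : ContinuousOn H (bernoulliStrip \ {0}))
    (hK : ContinuousOn K (bernoulliStrip \ {0})) {T : ℝ} (hT : 0 < T) :
    rectIntegral T (fun t => H t + K t) = rectIntegral T H + rectIntegral T K := by
  have hpi := Real.pi_pos
  have h1 : |-Real.pi| ≤ Real.pi := by rw [abs_neg, abs_of_pos hpi]
  have h2 : |Real.pi| ≤ Real.pi := by rw [abs_of_pos hpi]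
  unfold rectIntegral
  rw [intervalIntegral.integral_add
      ((continuous_horizontal hH h1 (neg_ne_zero.mpr hpi.ne')).intervalIntegrable _ _)
      ((continuous_horizontal hK h1 (neg_ne_zero.mpr hpi.ne')).intervalIntegrable _ _),
    intervalIntegral.integral_add
      ((continuous_horizontal hH h2 hpi.ne').intervalIntegrable _ _)
      ((continuous_horizontal hK h2 hpi.ne').intervalIntegrable _ _),
    intervalIntegral.integral_add
      (continuousOn_vertical hH hT.ne').intervalIntegrable
      (continuousOn_vertical hK hT.ne').intervalIntegrable,
    intervalIntegral.integral_add
      (continuousOn_vertical hH (neg_ne_zero.mpr hT.ne')).intervalIntegrable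
      (continuousOn_vertical hK (neg_ne_zero.mpr hT.ne')).intervalIntegrable]
  simp only [smul_add]
  ring

theorem rectIntegral_const_mul (c : ℂ) (H : ℂ → ℂ) (T : ℝ) :
    rectIntegral T (fun t => c * H t) = c * rectIntegral T H := by
  simp only [rectIntegral, intervalIntegral.integral_const_mul, smul_eq_mul]
  ring

theorem rectIntegral_congr {H K : ℂ → ℂ} (h : ∀ t ∈ bernoulliStrip, t ≠ 0 → H t = K t) {T : ℝ}
    (hT : 0 < T) : rectIntegral T H = rectIntegral T K := by
  have hpi := Real.pi_pos
  have h1 : |-Real.pi| ≤ Real.pi := by rw [abs_neg, abs_of_pos hpi]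
  have h2 : |Real.pi| ≤ Real.pi := by rw [abs_of_pos hpi]
  have hv : ∀ c : ℝ, c ≠ 0 → ∫ y : ℝ in -Real.pi..Real.pi, H (c + y * Complex.I)
      = ∫ y : ℝ in -Real.pi..Real.pi, K (c + y * Complex.I) := by
    intro c hc
    refine intervalIntegral.integral_congr fun y hy => ?_
    rw [Set.uIcc_of_le (by linarith)] at hy
    exact h _ (horizontal_mem_strip (abs_le.mpr hy) c) (vertical_ne_zero hc y)
  unfold rectIntegral
  rw [hv T hT.ne', hv (-T) (neg_ne_zero.mpr hT.ne')]
  have e1 : ∀ u : ℝ, H (u + (-Real.pi : ℝ) * Complex.I) = K (u + (-Real.pi : ℝ) * Complex.I) :=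
    fun u => h _ (horizontal_mem_strip h1 u) (horizontal_ne_zero (neg_ne_zero.mpr hpi.ne') u)
  have e2 : ∀ u : ℝ, H (u + Real.pi * Complex.I) = K (u + Real.pi * Complex.I) :=
    fun u => h _ (horizontal_mem_strip h2 u) (horizontal_ne_zero hpi.ne' u)
  simp only [e1, e2]

theorem rectIntegral_eq_zero_of_differentiableOn {H : ℂ → ℂ}
    (hH : DifferentiableOn ℂ H bernoulliStrip) (T : ℝ) : rectIntegral T H = 0 := by
  have := Complex.integral_boundary_rect_eq_zero_of_differentiableOn H
    ⟨-T, -Real.pi⟩ ⟨T, Real.pi⟩ (hH.mono ?_)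
  · exact this
  · intro t ht
    have h2 := ht.2
    simp only [Set.mem_preimage] at h2
    rw [Set.uIcc_of_le (by linarith [Real.pi_pos])] at h2
    have := abs_le.mpr h2
    simp only [bernoulliStrip, Set.mem_ofPred_eq]
    linarith [Real.pi_pos]

/-- The values of the primitive at the four corners cancel. The primitive may be singular at 0,
which no side meets. -/
theorem rectIntegral_eq_zero_of_hasDerivAt {P p : ℂ → ℂ}
    (hP : ∀ t, t ≠ 0 → HasDerivAt P (p t) t) (hp : ContinuousOn p (bernoulliStrip \ {0}))
    {T : ℝ} (hT : 0 < T) : rectIntegral T p = 0 := by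
  have hpi := Real.pi_pos
  have h1 : |-Real.pi| ≤ Real.pi := by rw [abs_neg, abs_of_pos hpi]
  have h2 : |Real.pi| ≤ Real.pi := by rw [abs_of_pos hpi]
  have hh : ∀ c : ℝ, |c| ≤ Real.pi → c ≠ 0 → ∫ u : ℝ in -T..T, p (u + c * Complex.I)
      = P (T + c * Complex.I) - P ((-T : ℝ) + c * Complex.I) := by
    intro c hc hc0
    refine intervalIntegral.integral_eq_sub_of_hasDerivAt
      (f := fun u : ℝ => P (u + c * Complex.I)) (fun u _ => ?_)
      ((continuous_horizontal hp hc hc0).intervalIntegrable _ _)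
    have hd : HasDerivAt (fun z : ℂ => P (z + c * Complex.I)) (p (u + c * Complex.I)) (u : ℂ) :=
      (hP _ (horizontal_ne_zero hc0 u)).comp_add_const _ _
    exact hd.comp_ofReal
  have hv : ∀ c : ℝ, c ≠ 0 → Complex.I • ∫ y : ℝ in -Real.pi..Real.pi, p (c + y * Complex.I)
      = P (c + Real.pi * Complex.I) - P (c + (-Real.pi : ℝ) * Complex.I) := by
    intro c hc
    rw [smul_eq_mul, ← intervalIntegral.integral_const_mul]
    refine intervalIntegral.integral_eq_sub_of_hasDerivAt
      (f := fun u : ℝ => P (c + u * Complex.I)) (fun u _ => ?_)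
      ((continuousOn_vertical hp hc).intervalIntegrable.const_mul _)
    have hd : HasDerivAt (fun z : ℂ => P (c + z * Complex.I))
        (Complex.I * p (c + u * Complex.I)) (u : ℂ) := by
      have := (hP _ (vertical_ne_zero hc u)).comp (u : ℂ)
        (((hasDerivAt_id (u : ℂ)).mul_const Complex.I).const_add (c : ℂ))
      simpa [Function.comp_def, mul_comm] using this
    exact hd.comp_ofReal
  unfold rectIntegral
  rw [hh _ h1 (neg_ne_zero.mpr hpi.ne'), hh _ h2 hpi.ne', hv T hT.ne',
    hv (-T) (neg_ne_zero.mpr hT.ne')]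
  ring

theorem integral_two_mul_div_sq_add_sq {c : ℝ} (hc : 0 < c) (a : ℝ) :
    ∫ u : ℝ in -a..a, ((2 * c / (u ^ 2 + c ^ 2) : ℝ) : ℂ) = 4 * Real.arctan (a / c) := by
  have hd : ∀ u : ℝ, HasDerivAt (fun u : ℝ => 2 * Real.arctan (u / c)) (2 * c / (u ^ 2 + c ^ 2)) u := by
    intro u
    have := ((hasDerivAt_id u).div_const c).arctan.const_mul 2
    refine this.congr_deriv ?_
    have : u ^ 2 + c ^ 2 ≠ 0 := by positivity
    simp only [id]
    field_simp
    ring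
  rw [intervalIntegral.integral_ofReal, intervalIntegral.integral_eq_sub_of_hasDerivAt
    (fun u _ => hd u)]
  · rw [neg_div, Real.arctan_neg]; push_cast; ring
  · apply Continuous.intervalIntegrable
    refine Continuous.div (by fun_prop) (by fun_prop) fun u => ?_
    positivity

theorem continuousOn_inv_pow (m : ℕ) :
    ContinuousOn (fun t : ℂ => (t ^ m)⁻¹) (bernoulliStrip \ {0}) := by
  refine ContinuousOn.inv₀ (by fun_prop) fun t ht => pow_ne_zero _ ht.2

/-- Pairing opposite sides gives `4i (arctan (T/π) + arctan (π/T))`, and two arctangents at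
reciprocal positive arguments add up to `π/2`. -/
theorem rectIntegral_inv {T : ℝ} (hT : 0 < T) :
    rectIntegral T (fun t => t⁻¹) = 2 * Real.pi * Complex.I := by
  have hpi := Real.pi_pos
  have hc : ContinuousOn (fun t : ℂ => t⁻¹) (bernoulliStrip \ {0}) := by
    simpa using continuousOn_inv_pow 1
  have h1 : |-Real.pi| ≤ Real.pi := by rw [abs_neg, abs_of_pos hpi]
  have h2 : |Real.pi| ≤ Real.pi := by rw [abs_of_pos hpi]
  unfold rectIntegral
  rw [← intervalIntegral.integral_sub
    ((continuous_horizontal hc h1 (neg_ne_zero.mpr hpi.ne')).intervalIntegrable _ _)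
    ((continuous_horizontal hc h2 hpi.ne').intervalIntegrable _ _), add_sub_assoc, ← smul_sub,
    ← intervalIntegral.integral_sub
    (continuousOn_vertical hc hT.ne').intervalIntegrable
    (continuousOn_vertical hc (neg_ne_zero.mpr hT.ne')).intervalIntegrable]
  have e1 : ∀ u : ℝ, ((u + (-Real.pi : ℝ) * Complex.I : ℂ))⁻¹ - (u + Real.pi * Complex.I : ℂ)⁻¹
      = Complex.I * ((2 * Real.pi / (u ^ 2 + Real.pi ^ 2) : ℝ) : ℂ) := by
    intro u
    have a1 := horizontal_ne_zero (neg_ne_zero.mpr hpi.ne') u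
    have a2 := horizontal_ne_zero hpi.ne' u
    have a3 : ((u : ℂ) ^ 2 + (Real.pi : ℂ) ^ 2) ≠ 0 := by
      have : (0 : ℝ) < u ^ 2 + Real.pi ^ 2 := by positivity
      exact_mod_cast this.ne'
    push_cast at a1 ⊢
    rw [inv_sub_inv a1 a2, mul_div_assoc', div_eq_div_iff (mul_ne_zero a1 a2) a3]
    linear_combination (2 * Complex.I * Real.pi * Real.pi ^ 2) * Complex.I_sq
  have e2 : ∀ y : ℝ, ((T + y * Complex.I : ℂ))⁻¹ - ((-T : ℝ) + y * Complex.I : ℂ)⁻¹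
      = ((2 * T / (y ^ 2 + T ^ 2) : ℝ) : ℂ) := by
    intro u
    have a1 := vertical_ne_zero hT.ne' u
    have a2 := vertical_ne_zero (neg_ne_zero.mpr hT.ne') u
    have a3 : ((u : ℂ) ^ 2 + (T : ℂ) ^ 2) ≠ 0 := by
      have : (0 : ℝ) < u ^ 2 + T ^ 2 := by positivity
      exact_mod_cast this.ne'
    push_cast at a2 ⊢
    rw [inv_sub_inv a1 a2, div_eq_div_iff (mul_ne_zero a1 a2) a3]
    linear_combination (-2 * T * u ^ 2) * Complex.I_sq
  simp only [e1, e2]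
  rw [intervalIntegral.integral_const_mul, integral_two_mul_div_sq_add_sq hpi, integral_two_mul_div_sq_add_sq hT]
  have h3 : Real.arctan (Real.pi / T) = Real.pi / 2 - Real.arctan (T / Real.pi) := by
    rw [← Real.arctan_inv_of_pos (by positivity), inv_div]
  rw [h3, smul_eq_mul]
  push_cast
  ring

theorem rectIntegral_inv_pow (n : ℕ) {T : ℝ} (hT : 0 < T) :
    rectIntegral T (fun t => (t ^ (n + 2))⁻¹) = 0 := by
  refine rectIntegral_eq_zero_of_hasDerivAt (P := fun t => -((n : ℂ) + 1)⁻¹ * (t ^ (n + 1))⁻¹)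
    (fun t ht => ?_) (continuousOn_inv_pow _) hT
  have := ((hasDerivAt_pow (n + 1) t).inv (pow_ne_zero _ ht)).const_mul (-((n : ℂ) + 1)⁻¹)
  refine this.congr_deriv ?_
  have h1 : (n + 1 : ℂ) ≠ 0 := by exact_mod_cast n.succ_ne_zero
  push_cast
  field_simp
  ring

/-- Induction on `n`, peeling off the constant term: `F = F(0) + t · dslope F 0 t`. For `n ≥ 1` the
first part has a primitive and integrates to 0, while the second lowers the pole order and shifts
the Taylor coefficients by one. At `n = 0` the first part gives `2πi F(0)` and the second is
holomorphic. -/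
theorem rectIntegral_div_pow (n : ℕ) {F : ℂ → ℂ} (hF : DifferentiableOn ℂ F bernoulliStrip)
    {T : ℝ} (hT : 0 < T) :
    rectIntegral T (fun t => F t * (t ^ (n + 1))⁻¹)
      = 2 * Real.pi * Complex.I * PowerSeries.coeff n (taylorSeries F) := by
  have h0 : bernoulliStrip ∈ 𝓝 (0 : ℂ) :=
    isOpen_bernoulliStrip.mem_nhds (by simp [bernoulliStrip, Real.pi_pos])
  have key : ∀ F : ℂ → ℂ, DifferentiableOn ℂ F bernoulliStrip →
      DifferentiableOn ℂ (dslope F 0) bernoulliStrip ∧ ∀ t, F t = F 0 + t * dslope F 0 t := by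
    intro F hF
    refine ⟨(Complex.differentiableOn_dslope h0).mpr hF, fun t => ?_⟩
    have := sub_smul_dslope F 0 t
    simp only [sub_zero, smul_eq_mul] at this
    rw [this]; ring
  induction n generalizing F with
  | zero =>
    obtain ⟨hd, he⟩ := key F hF
    rw [coeff_zero_taylorSeries, rectIntegral_congr
      (K := fun t => F 0 * (t ^ 1)⁻¹ + dslope F 0 t) (fun t _ ht => ?_) hT,
      rectIntegral_add (H := fun t => F 0 * (t ^ 1)⁻¹) (K := dslope F 0)
        (continuousOn_const.mul (continuousOn_inv_pow 1))
        (hd.continuousOn.mono Set.sdiff_subset) hT, rectIntegral_const_mul,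
      rectIntegral_eq_zero_of_differentiableOn hd]
    · simp only [pow_one]
      rw [rectIntegral_inv hT]; ring
    · rw [he t]; field_simp; ring
  | succ n ih =>
    obtain ⟨hd, he⟩ := key F hF
    rw [rectIntegral_congr
      (K := fun t => F 0 * (t ^ (n + 2))⁻¹ + dslope F 0 t * (t ^ (n + 1))⁻¹) (fun t _ ht => ?_) hT,
      rectIntegral_add (H := fun t => F 0 * (t ^ (n + 2))⁻¹)
        (K := fun t => dslope F 0 t * (t ^ (n + 1))⁻¹)
        (continuousOn_const.mul (continuousOn_inv_pow _))
        ((hd.continuousOn.mono Set.sdiff_subset).mul (continuousOn_inv_pow _)) hT,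
      rectIntegral_const_mul, rectIntegral_inv_pow n hT, ih hd]
    · have hda : AnalyticAt ℂ (dslope F 0) 0 := hd.analyticAt h0
      have : taylorSeries F = PowerSeries.C (F 0) + PowerSeries.X * taylorSeries (dslope F 0) := by
        rw [← taylorSeries_const, ← taylorSeries_id, ← taylorSeries_mul (f := fun w => w)
          analyticAt_id hda, ← taylorSeries_add (g := fun w => w * dslope F 0 w)
          analyticAt_const (analyticAt_id.mul hda)]
        congr 1
        funext t; exact he t
      rw [this, map_add, PowerSeries.coeff_C, PowerSeries.coeff_succ_X_mul]
      simp
    · nth_rw 1 [he t]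
      field_simp
      ring

/-! ### The integral along the line `Im t = -π` -/

open MeasureTheory

/-- The modulus `e^{xu} / (1 + e^u)` of `e^{xt} / (e^t - 1)` on the lines `Im t = ± π`. -/
noncomputable def lineKernel (x u : ℝ) : ℝ := Real.exp (x * u) / (1 + Real.exp u)

theorem lineKernel_pos (x u : ℝ) : 0 < lineKernel x u := by unfold lineKernel; positivity

theorem continuous_lineKernel (x : ℝ) : Continuous (lineKernel x) := by
  unfold lineKernel
  refine Continuous.div (by fun_prop) (by fun_prop) fun u => by positivity

/-- Useful for `u → -∞`; `lineKernel_le_exp_neg` serves `u → +∞`. Both bounds decay on their side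
exactly because `0 < x < 1`. -/
theorem lineKernel_le_exp (x u : ℝ) : lineKernel x u ≤ Real.exp (x * u) := by
  unfold lineKernel
  exact div_le_self (Real.exp_pos _).le (by linarith [Real.exp_pos u])

theorem lineKernel_le_exp_neg (x u : ℝ) : lineKernel x u ≤ Real.exp (-(1 - x) * u) := by
  unfold lineKernel
  rw [div_le_iff₀ (by positivity), mul_add, ← Real.exp_add]
  have : -(1 - x) * u + u = x * u := by ring
  rw [this]
  linarith [Real.exp_pos (-(1 - x) * u)]

theorem lineKernel_le_one {x : ℝ} (hx0 : 0 < x) (hx1 : x < 1) (u : ℝ) : lineKernel x u ≤ 1 := by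
  rcases le_total u 0 with h | h
  · exact (lineKernel_le_exp x u).trans (Real.exp_le_one_iff.mpr (by nlinarith))
  · exact (lineKernel_le_exp_neg x u).trans (Real.exp_le_one_iff.mpr (by nlinarith))

theorem integrable_lineKernel {x : ℝ} (hx0 : 0 < x) (hx1 : x < 1) : Integrable (lineKernel x) := by
  have hm : ∀ s : Set ℝ, AEStronglyMeasurable (lineKernel x) (volume.restrict s) := fun s =>
    (continuous_lineKernel x).aestronglyMeasurable
  rw [← integrableOn_univ, ← Set.Iic_union_Ioi (a := (0 : ℝ))]
  refine IntegrableOn.union ?_ ?_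
  · refine Integrable.mono' (integrableOn_exp_mul_Iic hx0 0) (hm _) (ae_of_all _ fun u => ?_)
    rw [Real.norm_of_nonneg (lineKernel_pos x u).le]
    exact lineKernel_le_exp x u
  · refine Integrable.mono' (exp_neg_integrableOn_Ioi 0 (b := 1 - x) (by linarith)) (hm _)
      (ae_of_all _ fun u => ?_)
    rw [Real.norm_of_nonneg (lineKernel_pos x u).le]
    exact lineKernel_le_exp_neg x u

/-- The integrand of the integral along the line `Im t = -π`, up to a constant phase. -/
noncomputable def lineIntegrand (x : ℝ) (n : ℕ) (u : ℝ) : ℂ :=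
  (lineKernel x u : ℂ) ^ n * (u - Real.pi * Complex.I)⁻¹

theorem sub_pi_mul_I_ne_zero (u : ℝ) : (u - Real.pi * Complex.I : ℂ) ≠ 0 := by
  intro h; have := congrArg Complex.im h; simp [Real.pi_ne_zero] at this

theorem norm_inv_sub_pi_mul_I_le (u : ℝ) : ‖(u - Real.pi * Complex.I : ℂ)⁻¹‖ ≤ Real.pi⁻¹ := by
  rw [norm_inv]
  refine inv_anti₀ Real.pi_pos ?_
  have := Complex.abs_im_le_norm (u - Real.pi * Complex.I : ℂ)
  simpa [abs_of_pos Real.pi_pos] using this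

theorem continuous_lineIntegrand (x : ℝ) (n : ℕ) : Continuous (lineIntegrand x n) := by
  unfold lineIntegrand
  refine Continuous.mul ?_ (Continuous.inv₀ (by fun_prop) sub_pi_mul_I_ne_zero)
  exact (Complex.continuous_ofReal.comp (continuous_lineKernel x)).pow n

theorem norm_lineIntegrand_le (x : ℝ) (n : ℕ) (u : ℝ) :
    ‖lineIntegrand x n u‖ ≤ lineKernel x u ^ n * Real.pi⁻¹ := by
  unfold lineIntegrand
  rw [norm_mul, norm_pow, Complex.norm_real, Real.norm_of_nonneg (lineKernel_pos x u).le]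
  exact mul_le_mul_of_nonneg_left (norm_inv_sub_pi_mul_I_le u) (pow_nonneg (lineKernel_pos x u).le n)

theorem integrable_lineIntegrand {x : ℝ} (hx0 : 0 < x) (hx1 : x < 1) {n : ℕ} (hn : 1 ≤ n) :
    Integrable (lineIntegrand x n) := by
  refine Integrable.mono' ((integrable_lineKernel hx0 hx1).mul_const Real.pi⁻¹)
    (continuous_lineIntegrand x n).aestronglyMeasurable (ae_of_all _ fun u => ?_)
  refine (norm_lineIntegrand_le x n u).trans ?_
  refine mul_le_mul_of_nonneg_right ?_ (by positivity)
  calc lineKernel x u ^ n ≤ lineKernel x u ^ 1 :=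
        pow_le_pow_of_le_one (lineKernel_pos x u).le (lineKernel_le_one hx0 hx1 u) hn
    _ = _ := pow_one _

/-- The zeros of `e^t - 1` are the multiples of `2πi`; the open strip contains only 0, where the
quotient is 1. -/
theorem expQuot_ne_zero {t : ℂ} (ht : t ∈ bernoulliStrip) : expQuot t ≠ 0 := by
  by_cases h0 : t = 0
  · simp [h0, expQuot_zero]
  intro h
  have h1 := mul_expQuot t
  rw [h, mul_zero] at h1
  obtain ⟨k, hk⟩ := Complex.exp_eq_one_iff.mp (sub_eq_zero.mp h1.symm)
  have him : t.im = k * (2 * Real.pi) := by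
    rw [hk]; simp
  simp only [bernoulliStrip, Set.mem_ofPred_eq] at ht
  have hpi := Real.pi_pos
  rw [him, abs_mul, abs_of_pos (by positivity : 0 < 2 * Real.pi)] at ht
  have hk1 : |(k : ℝ)| < 1 := by nlinarith
  have hk0 : k = 0 := by
    have : |k| < 1 := by exact_mod_cast hk1
    exact Int.abs_lt_one_iff.mp this
  apply h0
  rw [hk, hk0]; simp

theorem differentiableOn_bernoulliGen (m : ℕ) (z : ℂ) :
    DifferentiableOn ℂ (bernoulliGen m z) bernoulliStrip := by
  unfold bernoulliGen
  refine DifferentiableOn.mul (DifferentiableOn.pow (DifferentiableOn.inv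
    differentiable_expQuot.differentiableOn fun t ht => expQuot_ne_zero ht) m) ?_
  fun_prop

/-- The integrand of the Cauchy integral for the coefficient of the generating function. -/
noncomputable def cauchyIntegrand (x : ℝ) (n : ℕ) (t : ℂ) : ℂ :=
  (Complex.exp (x * t) / (Complex.exp t - 1)) ^ n * t⁻¹

/-- Because the order equals the degree, the factor `t^n` cancels and an exact `n`-th power times
`1/t` is left: an integrand of Laplace type. -/
theorem bernoulliGen_mul_inv_pow (x : ℝ) (n : ℕ) {t : ℂ} (ht : t ∈ bernoulliStrip) (h0 : t ≠ 0) :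
    bernoulliGen n ((n * x : ℝ) : ℂ) t * (t ^ (n + 1))⁻¹ = cauchyIntegrand x n t := by
  have h1 := expQuot_ne_zero ht
  unfold cauchyIntegrand bernoulliGen
  rw [← mul_expQuot, show (((n * x : ℝ) : ℂ) * t) = n * (x * t) by push_cast; ring,
    Complex.exp_nat_mul, div_pow, mul_pow, inv_pow]
  field_simp
  ring

theorem rectIntegral_cauchyIntegrand (x : ℝ) (n : ℕ) {T : ℝ} (hT : 0 < T) :
    rectIntegral T (cauchyIntegrand x n)
      = 2 * Real.pi * Complex.I * ((genBernoulli n n (n * x) / n.factorial : ℝ) : ℂ) := by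
  rw [← coeff_taylorSeries_bernoulliGen, ← rectIntegral_div_pow n
    (differentiableOn_bernoulliGen _ _) hT]
  exact rectIntegral_congr (fun t ht h0 => (bernoulliGen_mul_inv_pow x n ht h0).symm) hT

/-- On this line `e^t = -e^u`, so the quotient inside the power is a positive kernel times the
constant phase `-e^{-iπx}`; the `n`-th power does not oscillate along the line. -/
theorem cauchyIntegrand_lower (x : ℝ) (n : ℕ) (u : ℝ) :
    cauchyIntegrand x n (u + (-Real.pi : ℝ) * Complex.I)
      = (-1) ^ n * Complex.exp (-(Real.pi * n * x : ℝ) * Complex.I) * lineIntegrand x n u := by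
  have h1 : Complex.exp (u + (-Real.pi : ℝ) * Complex.I) = -Complex.exp u := by
    rw [Complex.exp_add]
    push_cast
    rw [neg_mul, Complex.exp_neg, Complex.exp_pi_mul_I]
    norm_num
  have h2 : Complex.exp (x * (u + (-Real.pi : ℝ) * Complex.I))
      = Complex.exp (-(Real.pi * x : ℝ) * Complex.I) * Complex.exp (x * u) := by
    rw [← Complex.exp_add]; congr 1; push_cast; ring
  have h3 : (1 + Complex.exp u : ℂ) ≠ 0 := by
    have : (0 : ℝ) < 1 + Real.exp u := by positivity
    exact_mod_cast this.ne'
  have h4 : Complex.exp (-(Real.pi * n * x : ℝ) * Complex.I)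
      = Complex.exp (-(Real.pi * x : ℝ) * Complex.I) ^ n := by
    rw [← Complex.exp_nat_mul]; congr 1; push_cast; ring
  have h5 : Complex.exp (x * (u + (-Real.pi : ℝ) * Complex.I)) /
      (Complex.exp (u + (-Real.pi : ℝ) * Complex.I) - 1)
      = -1 * Complex.exp (-(Real.pi * x : ℝ) * Complex.I) * (lineKernel x u : ℂ) := by
    rw [h1, h2, lineKernel]
    push_cast
    rw [show -Complex.exp (u : ℂ) - 1 = -(1 + Complex.exp u) by ring]
    field_simp
  unfold cauchyIntegrand lineIntegrand
  rw [h5, h4, mul_pow, mul_pow]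
  push_cast
  rw [show (u + -(Real.pi : ℂ) * Complex.I) = u - Real.pi * Complex.I by ring]
  ring

theorem cauchyIntegrand_conj (x : ℝ) (n : ℕ) (t : ℂ) :
    cauchyIntegrand x n (starRingEnd ℂ t) = starRingEnd ℂ (cauchyIntegrand x n t) := by
  simp [cauchyIntegrand, ← Complex.exp_conj]

theorem norm_cauchyIntegrand_vertical {x : ℝ} (hx0 : 0 < x) (hx1 : x < 1) (n : ℕ) {T : ℝ}
    (hT : 1 ≤ |T|) (y : ℝ) : ‖cauchyIntegrand x n (T + y * Complex.I)‖ ≤ 2 ^ n * |T|⁻¹ := by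
  have h1 : ‖Complex.exp (x * (T + y * Complex.I))‖ = Real.exp (x * T) := by
    rw [Complex.norm_exp]; simp
  have h2 : |Real.exp T - 1| ≤ ‖Complex.exp (T + y * Complex.I) - 1‖ := by
    have := abs_norm_sub_norm_le (Complex.exp (T + y * Complex.I)) 1
    rw [Complex.norm_exp] at this
    simpa using this
  have he : (2 : ℝ) ≤ Real.exp 1 := by linarith [Real.add_one_le_exp (1 : ℝ)]
  -- For `T ≥ 1` this is `e^{xT} ≤ e^T ≤ 2(e^T - 1)`, for `T ≤ -1` it is `e^{xT} ≤ 1 ≤ 2(1 - e^T)`;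
  -- both rest on `e ≥ 2`.
  have h3 : Real.exp (x * T) ≤ 2 * |Real.exp T - 1| := by
    rcases le_total 0 T with h | h
    · rw [abs_of_nonneg h] at hT
      have e1 : Real.exp 1 ≤ Real.exp T := Real.exp_le_exp.mpr hT
      have e2 : Real.exp (x * T) ≤ Real.exp T := Real.exp_le_exp.mpr (by nlinarith)
      rw [abs_of_nonneg (by linarith)]
      linarith
    · rw [abs_of_nonpos h] at hT
      have e1 : Real.exp T ≤ Real.exp (-1) := Real.exp_le_exp.mpr (by linarith)
      have e2 : Real.exp (x * T) ≤ 1 := Real.exp_le_one_iff.mpr (by nlinarith)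
      have e3 : Real.exp (-1) ≤ 1 / 2 := by
        rw [Real.exp_neg, one_div]; exact inv_anti₀ (by norm_num) he
      rw [abs_of_nonpos (by linarith)]
      linarith
  have h4 : |T| ≤ ‖(T + y * Complex.I : ℂ)‖ := by
    have := Complex.abs_re_le_norm (T + y * Complex.I : ℂ)
    simpa using this
  unfold cauchyIntegrand
  rw [norm_mul, norm_pow, norm_div, h1, norm_inv]
  have h5 : 0 < |Real.exp T - 1| := by nlinarith [Real.exp_pos (x * T)]
  refine mul_le_mul (pow_le_pow_left₀ (by positivity) ?_ n) (inv_anti₀ (by linarith) h4)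
    (by positivity) (by positivity)
  rw [div_le_iff₀ (lt_of_lt_of_le h5 h2)]
  linarith

/-- The function `c` allows both `T` and `-T`, so that one statement covers the two vertical sides.
-/
theorem tendsto_vertical_integral {x : ℝ} (hx0 : 0 < x) (hx1 : x < 1) (n : ℕ) {c : ℝ → ℝ}
    (hc : ∀ T, |c T| = |T|) :
    Tendsto (fun T : ℝ => ∫ y : ℝ in -Real.pi..Real.pi, cauchyIntegrand x n (c T + y * Complex.I))
      atTop (𝓝 0) := by
  have hlim : Tendsto (fun T : ℝ => 2 ^ n * T⁻¹ * |Real.pi - -Real.pi|) atTop (𝓝 0) := by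
    have := (tendsto_inv_atTop_zero (𝕜 := ℝ)).const_mul ((2 : ℝ) ^ n)
    simpa using this.mul_const |Real.pi - -Real.pi|
  refine squeeze_zero_norm' ?_ hlim
  filter_upwards [eventually_ge_atTop (1 : ℝ)] with T hT
  refine intervalIntegral.norm_integral_le_of_norm_le_const fun y _ => ?_
  have hT' : |T| = T := abs_of_nonneg (by linarith)
  have := norm_cauchyIntegrand_vertical hx0 hx1 n (T := c T) (by rw [hc, hT']; exact hT) y
  rwa [hc, hT'] at this

/-- The generalised Bernoulli polynomial as an integral along the line `Im t = -π`. -/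
theorem genBernoulli_eq_im_integral {x : ℝ} (hx0 : 0 < x) (hx1 : x < 1) {n : ℕ} (hn : 1 ≤ n) :
    genBernoulli n n (n * x) = n.factorial / Real.pi *
      ((-1) ^ n * Complex.exp (-(Real.pi * n * x : ℝ) * Complex.I) *
        ∫ u, lineIntegrand x n u).im := by
  set J : ℂ := (-1) ^ n * Complex.exp (-(Real.pi * n * x : ℝ) * Complex.I) *
        ∫ u, lineIntegrand x n u with hJ
  have hint := integrable_lineIntegrand hx0 hx1 hn
  have hlow : Tendsto (fun T : ℝ => ∫ u : ℝ in -T..T,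
      cauchyIntegrand x n (u + (-Real.pi : ℝ) * Complex.I)) atTop (𝓝 J) := by
    simp only [cauchyIntegrand_lower, intervalIntegral.integral_const_mul]
    exact (intervalIntegral_tendsto_integral hint tendsto_neg_atTop_atBot tendsto_id).const_mul _
  have hup : Tendsto (fun T : ℝ => ∫ u : ℝ in -T..T,
      cauchyIntegrand x n (u + Real.pi * Complex.I)) atTop (𝓝 (starRingEnd ℂ J)) := by
    have h1 : ∀ u : ℝ, cauchyIntegrand x n (u + Real.pi * Complex.I)
        = starRingEnd ℂ (cauchyIntegrand x n (u + (-Real.pi : ℝ) * Complex.I)) := by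
      intro u
      rw [← cauchyIntegrand_conj]
      simp
    have h2 : ∀ T : ℝ, ∫ u : ℝ in -T..T, cauchyIntegrand x n (u + Real.pi * Complex.I)
        = starRingEnd ℂ (∫ u : ℝ in -T..T,
          cauchyIntegrand x n (u + (-Real.pi : ℝ) * Complex.I)) := by
      intro T
      simp only [h1, intervalIntegral, map_sub]
      rw [integral_conj, integral_conj]
    simp only [h2]
    exact (Complex.continuous_conj.tendsto J).comp hlow
  have hv1 := tendsto_vertical_integral hx0 hx1 n (c := fun T => T) fun T => rfl
  have hv2 := tendsto_vertical_integral hx0 hx1 n (c := fun T => -T) fun T => abs_neg T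
  have hlim := ((hlow.sub hup).add (hv1.const_smul Complex.I)).sub (hv2.const_smul Complex.I)
  -- The rectangle integral does not depend on `T`, so it equals its limit `J - conj J = 2i Im J`.
  have hconst : Tendsto (fun _ : ℝ => 2 * Real.pi * Complex.I *
      ((genBernoulli n n (n * x) / n.factorial : ℝ) : ℂ)) atTop (𝓝 (J - starRingEnd ℂ J)) := by
    have h := hlim.congr' (f₂ := fun _ : ℝ => 2 * Real.pi * Complex.I *
      ((genBernoulli n n (n * x) / n.factorial : ℝ) : ℂ)) (by
        filter_upwards [eventually_gt_atTop (0 : ℝ)] with T hT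
        exact rectIntegral_cauchyIntegrand x n hT)
    simpa using h
  have heq := tendsto_nhds_unique hconst tendsto_const_nhds
  rw [Complex.sub_conj] at heq
  have h2 := congrArg Complex.im heq
  have hf : (n.factorial : ℝ) ≠ 0 := by exact_mod_cast n.factorial_ne_zero
  have hpi := Real.pi_ne_zero
  simp only [Complex.mul_im, Complex.mul_re, Complex.I_re, Complex.I_im, Complex.ofReal_re,
    Complex.ofReal_im, Complex.re_ofNat, Complex.im_ofNat] at h2
  have h3 : Real.pi * (genBernoulli n n (n * x) / n.factorial) = J.im := by linarith
  rw [← h3]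
  field_simp

/-! ### Gaussian moments and Watson's lemma -/

theorem integrable_pow_mul_exp_neg_mul_sq_half (j : ℕ) {n : ℝ} (hn : 0 < n) :
    Integrable fun w : ℝ => w ^ j * Real.exp (-(n * w ^ 2 / 2)) := by
  have := integrable_rpow_mul_exp_neg_mul_sq (b := n / 2) (by positivity) (s := j)
    (by have : (0 : ℝ) ≤ j := by positivity
        linarith)
  refine this.congr (ae_of_all _ fun w => ?_)
  simp only [Real.rpow_natCast]
  congr 2; ring

theorem Gamma_natCast_add_half (k : ℕ) : Real.Gamma (k + 1 / 2) = pochHalf k * √Real.pi := by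
  induction k with
  | zero => simp [pochHalf, -one_div, Real.Gamma_one_half_eq]
  | succ k ih =>
    have h : ((k + 1 : ℕ) : ℝ) + 1 / 2 = (k + 1 / 2) + 1 := by push_cast; ring
    rw [h, Real.Gamma_add_one (by positivity), ih]
    unfold pochHalf
    rw [ascPochhammer_succ_eval]
    ring

/-- Evenness and a Gamma integral reduce the moment to `Γ(k + 1/2)`. This is the origin of the
factors `2^k (1/2)_k / n^k` in the expansion. -/
theorem integral_even_moment (k : ℕ) {n : ℝ} (hn : 0 < n) :
    ∫ w : ℝ, w ^ (2 * k) * Real.exp (-(n * w ^ 2 / 2))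
      = √(2 * Real.pi / n) * (2 ^ k * pochHalf k / n ^ k) := by
  have h1 : ∀ w : ℝ, w ^ (2 * k) * Real.exp (-(n * w ^ 2 / 2))
      = (fun v : ℝ => v ^ (2 * k) * Real.exp (-(n * v ^ 2 / 2))) |w| := by
    intro w; simp only [sq_abs, pow_mul]
  have h2 : ∫ w in Set.Ioi (0 : ℝ), w ^ (2 * k) * Real.exp (-(n * w ^ 2 / 2))
      = ∫ w in Set.Ioi (0 : ℝ), w ^ ((2 * k : ℕ) : ℝ) * Real.exp (-(n / 2) * w ^ (2 : ℝ)) := by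
    refine setIntegral_congr_fun measurableSet_Ioi fun w _ => ?_
    simp only [Real.rpow_natCast, Real.rpow_ofNat]
    congr 2; ring
  have h4 : (((2 * k : ℕ) : ℝ) + 1) / 2 = k + 1 / 2 := by push_cast; ring
  have hs : √(2 * Real.pi / n) = √(n / 2)⁻¹ * √Real.pi := by
    rw [← Real.sqrt_mul (by positivity)]; congr 1; field_simp
  have hp : (n / 2) ^ (-(((2 * k : ℕ) : ℝ) + 1) / 2) = √(n / 2)⁻¹ * (2 ^ k / n ^ k) := by
    rw [neg_div, h4, Real.rpow_neg (by positivity), Real.rpow_add (by positivity),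
      Real.rpow_natCast, ← Real.sqrt_eq_rpow, Real.sqrt_inv, mul_inv, div_pow, inv_div]
    ring
  rw [integral_congr_ae (ae_of_all _ h1), integral_comp_abs (f := fun v : ℝ => v ^ (2 * k) * Real.exp (-(n * v ^ 2 / 2))), h2,
    integral_rpow_mul_exp_neg_mul_rpow (by norm_num)
      (by have : (0 : ℝ) ≤ ((2 * k : ℕ) : ℝ) := by positivity
          linarith) (by positivity), h4, Gamma_natCast_add_half, hp, hs]
  ring

theorem integral_odd_moment (k : ℕ) (n : ℝ) :
    ∫ w : ℝ, w ^ (2 * k + 1) * Real.exp (-(n * w ^ 2 / 2)) = 0 := by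
  have h := integral_neg_eq_self (fun w : ℝ => w ^ (2 * k + 1) * Real.exp (-(n * w ^ 2 / 2))) volume
  simp only [Odd.neg_pow ⟨k, rfl⟩, neg_sq, neg_mul] at h
  rw [integral_neg] at h
  linarith

/-- **Watson's lemma** for a Gaussian weight on a symmetric interval. -/
theorem norm_integral_gaussian_sub_le {f : ℝ → ℂ} {c : ℕ → ℂ} {K : ℕ} {a M : ℝ} (ha : 0 < a)
    (hM : 0 ≤ M) (hf : ContinuousOn f (Set.Icc (-a) a))
    (hb : ∀ w ∈ Set.Icc (-a) a, ‖f w - ∑ j ∈ Finset.range (2 * K), c j * (w : ℂ) ^ j‖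
      ≤ M * w ^ (2 * K)) :
    ∃ B : ℝ, ∀ n : ℝ, 0 < n →
      ‖(∫ w in -a..a, (Real.exp (-(n * w ^ 2 / 2)) : ℂ) * f w)
        - √(2 * Real.pi / n) * ∑ k ∈ Finset.range K, (2 ^ k * pochHalf k / n ^ k : ℝ) * c (2 * k)‖
      ≤ B * (√(2 * Real.pi / n) / n ^ K) := by
  set T : ℝ → ℂ := fun w => ∑ j ∈ Finset.range (2 * K), c j * (w : ℂ) ^ j with hT
  -- Extension by zero lets `f` be compared with its Taylor polynomial on all of `ℝ`, where the
  -- moments are exact; no separate Gaussian tail is needed.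
  set F : ℝ → ℂ := (Set.Icc (-a) a).indicator f with hF
  obtain ⟨M', hM', hbound⟩ : ∃ M' : ℝ, 0 ≤ M' ∧ ∀ w : ℝ, ‖F w - T w‖ ≤ M' * w ^ (2 * K) := by
    -- Outside `[-a,a]` the remainder is minus the polynomial, and `|w| ≥ a` gives `|w|^j ≤ (a^j /
    -- a^{2K}) |w|^{2K}` for `j ≤ 2K`. An enlarged constant thus works everywhere.
    refine ⟨M + ∑ j ∈ Finset.range (2 * K), ‖c j‖ * a ^ j / a ^ (2 * K), by positivity,
      fun w => ?_⟩
    have hw : 0 ≤ w ^ (2 * K) := by rw [pow_mul]; positivity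
    rw [add_mul]
    by_cases hmem : w ∈ Set.Icc (-a) a
    · rw [hF, Set.indicator_of_mem hmem]
      exact (hb w hmem).trans (le_add_of_nonneg_right (by positivity))
    · rw [hF, Set.indicator_of_notMem hmem, zero_sub, norm_neg]
      refine le_trans ?_ (le_add_of_nonneg_left (mul_nonneg hM hw))
      rw [hT, Finset.sum_mul]
      refine (norm_sum_le _ _).trans (Finset.sum_le_sum fun j hj => ?_)
      have hj' : j ≤ 2 * K := (Finset.mem_range.mp hj).le
      have haw : a ≤ |w| := by
        by_contra hcon
        exact hmem (abs_le.mp (not_le.mp hcon).le)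
      rw [norm_mul, norm_pow, Complex.norm_real, Real.norm_eq_abs, mul_div_assoc, mul_assoc]
      refine mul_le_mul_of_nonneg_left ?_ (norm_nonneg _)
      have e1 : w ^ (2 * K) = |w| ^ j * |w| ^ (2 * K - j) := by
        rw [← pow_add, Nat.add_sub_cancel' hj', pow_mul, pow_mul, sq_abs]
      have e2 : a ^ (2 * K) = a ^ j * a ^ (2 * K - j) := by
        rw [← pow_add, Nat.add_sub_cancel' hj']
      have e3 : a ^ (2 * K - j) ≤ |w| ^ (2 * K - j) := pow_le_pow_left₀ ha.le haw _
      have e4 : a ^ j / a ^ (2 * K) = (a ^ (2 * K - j))⁻¹ := by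
        rw [e2]; field_simp
      rw [e4, e1, inv_mul_eq_div, le_div_iff₀ (by positivity)]
      exact mul_le_mul_of_nonneg_left e3 (by positivity)
  -- The constant is that of the exact moment of order `2K`, against which the remainder is
  -- integrated.
  refine ⟨M' * (2 ^ K * pochHalf K), fun n hn => ?_⟩
  set E : ℝ → ℂ := fun w => (Real.exp (-(n * w ^ 2 / 2)) : ℂ) with hE
  have hEc : Continuous E := by
    rw [hE]; exact Complex.continuous_ofReal.comp (by fun_prop)
  have hterm : ∀ j : ℕ, Integrable fun w : ℝ => E w * (c j * (w : ℂ) ^ j) := by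
    intro j
    refine ((integrable_pow_mul_exp_neg_mul_sq_half j hn).ofReal (𝕜 := ℂ)).const_mul (c j)
      |>.congr (ae_of_all _ fun w => ?_)
    change c j * ((w ^ j * Real.exp (-(n * w ^ 2 / 2)) : ℝ) : ℂ)
      = (Real.exp (-(n * w ^ 2 / 2)) : ℂ) * (c j * (w : ℂ) ^ j)
    push_cast
    ring
  have hTint : Integrable fun w => E w * T w := by
    simp only [hT, Finset.mul_sum]
    exact integrable_finsetSum _ fun j _ => hterm j
  have hFint : Integrable fun w => E w * F w := by
    have : (fun w => E w * F w) = (Set.Icc (-a) a).indicator fun w => E w * f w := by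
      funext w
      by_cases hmem : w ∈ Set.Icc (-a) a
      · simp [hF, Set.indicator_of_mem hmem]
      · simp [hF, Set.indicator_of_notMem hmem]
    rw [this, integrable_indicator_iff measurableSet_Icc]
    exact (hEc.continuousOn.mul hf).integrableOn_compact isCompact_Icc
  have hI1 : ∫ w in -a..a, E w * f w = ∫ w, E w * F w := by
    rw [intervalIntegral.integral_of_le (by linarith), ← integral_Icc_eq_integral_Ioc,
      ← integral_indicator measurableSet_Icc]
    refine integral_congr_ae (ae_of_all _ fun w => ?_)
    by_cases hmem : w ∈ Set.Icc (-a) a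
    · simp [hF, Set.indicator_of_mem hmem]
    · simp [hF, Set.indicator_of_notMem hmem]
  have hmom : ∀ j : ℕ, ∫ w : ℝ, E w * (c j * (w : ℂ) ^ j)
      = c j * ((∫ w : ℝ, w ^ j * Real.exp (-(n * w ^ 2 / 2)) : ℝ) : ℂ) := by
    intro j
    rw [← integral_complex_ofReal, ← integral_const_mul]
    refine integral_congr_ae (ae_of_all _ fun w => ?_)
    simp only [hE]
    push_cast
    ring
  have hsum : ∀ K : ℕ, ∑ j ∈ Finset.range (2 * K), ∫ w : ℝ, E w * (c j * (w : ℂ) ^ j)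
      = √(2 * Real.pi / n) * ∑ k ∈ Finset.range K,
        (2 ^ k * pochHalf k / n ^ k : ℝ) * c (2 * k) := by
    intro K
    induction K with
    | zero => simp
    | succ K ih =>
      rw [show 2 * (K + 1) = 2 * K + 1 + 1 by ring, Finset.sum_range_succ, Finset.sum_range_succ,
        ih, Finset.sum_range_succ, hmom, hmom, integral_odd_moment, integral_even_moment _ hn]
      push_cast
      ring
  have hI2 : ∫ w, E w * T w = √(2 * Real.pi / n) * ∑ k ∈ Finset.range K,
        (2 ^ k * pochHalf k / n ^ k : ℝ) * c (2 * k) := by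
    rw [← hsum K, ← integral_finsetSum _ fun j _ => hterm j]
    simp only [hT, Finset.mul_sum]
  rw [hI1, ← hI2, ← integral_sub hFint hTint]
  refine (norm_integral_le_of_norm_le
    ((integrable_pow_mul_exp_neg_mul_sq_half (2 * K) hn).const_mul M')
    (ae_of_all _ fun w => ?_)).trans ?_
  · rw [← mul_sub, norm_mul, hE, Complex.norm_real, Real.norm_of_nonneg (Real.exp_pos _).le,
      mul_comm, ← mul_assoc]
    exact mul_le_mul_of_nonneg_right (hbound w) (Real.exp_pos _).le
  · rw [integral_const_mul, integral_even_moment _ hn]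
    apply le_of_eq; ring

/-! ### Saddle points and the local inversion -/

theorem analyticAt_dslope {f : ℂ → ℂ} {z : ℂ} (hf : AnalyticAt ℂ f z) :
    AnalyticAt ℂ (dslope f z) z := by
  obtain ⟨p, hp⟩ := hf
  exact ⟨_, hp.has_fpower_series_dslope_fslope⟩

/-- An analytic function with a nondegenerate double zero is locally half of a square. -/
theorem exists_analytic_sqrt_of_double_zero {f f' : ℂ → ℂ} {z d : ℂ} (hf : AnalyticAt ℂ f z)
    (hfz : f z = 0) (hf' : ∀ᶠ s in 𝓝 z, HasDerivAt f (f' s) s) (hf'z : f' z = 0)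
    (hf'' : HasDerivAt f' d z) (hd : d ∈ Complex.slitPlane) :
    ∃ W : ℂ → ℂ, AnalyticAt ℂ W z ∧ W z = 0 ∧ deriv W z = d ^ (1 / 2 : ℂ) ∧
      ∀ᶠ s in 𝓝 z, f s = W s ^ 2 / 2 := by
  -- Here `f = (s-z)² g` with `2 g(z) = d`. So `W = (s-z) √(2g)`, and the principal root is analytic
  -- near `z` because `d` lies in the slit plane.
  set g := dslope (dslope f z) z with hg
  have hga : AnalyticAt ℂ g z := analyticAt_dslope (analyticAt_dslope hf)
  have hfg : ∀ s, f s = (s - z) ^ 2 * g s := by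
    intro s
    have h1 := sub_smul_dslope f z s
    have h2 := sub_smul_dslope (dslope f z) z s
    have h3 : dslope f z z = 0 := by rw [dslope_same, hf'.self_of_nhds.deriv, hf'z]
    rw [hfz, sub_zero] at h1
    rw [h3, sub_zero] at h2
    rw [← h1, ← h2, smul_eq_mul, smul_eq_mul, hg]
    ring
  have hgz : 2 * g z = d := by
    have h1 : f' =ᶠ[𝓝 z] fun s => 2 * (s - z) * g s + (s - z) ^ 2 * deriv g s := by
      filter_upwards [hf', hga.eventually_analyticAt] with s hs hgs
      have h2 : HasDerivAt (fun s => (s - z) ^ 2 * g s)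
          (2 * (s - z) * g s + (s - z) ^ 2 * deriv g s) s := by
        have := (((hasDerivAt_id s).sub_const z).pow 2).mul hgs.differentiableAt.hasDerivAt
        refine this.congr_deriv ?_
        simp
      have h3 : f = fun s => (s - z) ^ 2 * g s := funext hfg
      rw [← h3] at h2
      exact hs.unique h2
    have h4 : HasDerivAt (fun s => 2 * (s - z) * g s + (s - z) ^ 2 * deriv g s) (2 * g z) z := by
      have e1 := ((((hasDerivAt_id z).sub_const z).const_mul 2).mul
        hga.differentiableAt.hasDerivAt).add ((((hasDerivAt_id z).sub_const z).pow 2).mul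
        hga.deriv.differentiableAt.hasDerivAt)
      refine e1.congr_deriv ?_
      simp
    exact (h4.congr_of_eventuallyEq h1).unique hf''
  have hr : AnalyticAt ℂ (fun s => (2 * g s) ^ (1 / 2 : ℂ)) z :=
    (analyticAt_const.mul hga).cpow analyticAt_const (by
      change 2 * g z ∈ _
      rwa [hgz])
  refine ⟨fun s => (s - z) * (2 * g s) ^ (1 / 2 : ℂ), by fun_prop, by simp, ?_, ?_⟩
  · have := ((hasDerivAt_id z).sub_const z).mul hr.differentiableAt.hasDerivAt
    have h2 := this.deriv
    simp only [id, sub_self, zero_mul, add_zero, one_mul, hgz] at h2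
    exact h2
  · refine Eventually.of_forall fun s => ?_
    rw [hfg s, mul_pow, ← Complex.cpow_nat_mul]
    norm_num
    ring

/-- By isolation of zeros, if neither alternative holds then `f ≠ g` and `f ≠ -g` on a punctured
neighbourhood, against `f² = g²`. -/
theorem analytic_eq_or_eq_neg {f g : ℂ → ℂ} {z : ℂ} (hf : AnalyticAt ℂ f z) (hg : AnalyticAt ℂ g z)
    (h : ∀ᶠ w in 𝓝 z, f w ^ 2 = g w ^ 2) : (∀ᶠ w in 𝓝 z, f w = g w) ∨ ∀ᶠ w in 𝓝 z, f w = -g w := by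
  rcases (hf.eventually_eq_or_eventually_ne hg) with h1 | h1
  · exact Or.inl h1
  rcases (hf.eventually_eq_or_eventually_ne hg.neg) with h2 | h2
  · exact Or.inr h2
  exfalso
  have h3 := (h1.and h2).and (h.filter_mono nhdsWithin_le_nhds)
  obtain ⟨w, ⟨hw1, hw2⟩, hw3⟩ := h3.exists
  rcases sq_eq_sq_iff_eq_or_eq_neg.mp hw3 with h | h
  · exact hw1 h
  · exact hw2 h

theorem analyticAt_conj_conj {f : ℂ → ℂ} (hf : AnalyticAt ℂ f 0) :
    AnalyticAt ℂ (fun w => starRingEnd ℂ (f (starRingEnd ℂ w))) 0 := by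
  rw [Complex.analyticAt_iff_eventually_differentiableAt] at hf ⊢
  have hc : Tendsto (starRingEnd ℂ) (𝓝 (0 : ℂ)) (𝓝 0) := by
    simpa using (Complex.continuous_conj.tendsto (0 : ℂ))
  filter_upwards [hc.eventually hf] with w hw
  have := hw.conj_conj
  simpa [Function.comp_def] using this

theorem saddleH_pos {x : ℝ} (hx0 : 0 < x) (hx1 : x < 1) : 0 < saddleH x :=
  div_pos hx0 (by linarith)

theorem exp_lowerSaddle {x : ℝ} (hx0 : 0 < x) (hx1 : x < 1) :
    Complex.exp (lowerSaddle x) = -(saddleH x : ℂ) := by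
  rw [lowerSaddle, Complex.exp_sub, Complex.exp_pi_mul_I, ← Complex.ofReal_exp,
    Real.exp_log (saddleH_pos hx0 hx1)]
  rw [div_neg, div_one]

theorem exp_upperSaddle {x : ℝ} (hx0 : 0 < x) (hx1 : x < 1) :
    Complex.exp (upperSaddle x) = -(saddleH x : ℂ) := by
  rw [upperSaddle, Complex.exp_add, Complex.exp_pi_mul_I, ← Complex.ofReal_exp,
    Real.exp_log (saddleH_pos hx0 hx1)]
  simp

theorem lowerSaddle_ne_zero (x : ℝ) : lowerSaddle x ≠ 0 := sub_pi_mul_I_ne_zero _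

/-- The derivative `e^s / (e^s - 1) - z` of `psiDiff z s₀`. -/
noncomputable def psiDeriv (z s : ℂ) : ℂ := Complex.exp s / (Complex.exp s - 1) - z

theorem hasDerivAt_psiDiff {z s₀ s : ℂ} (h0 : Complex.exp s₀ - 1 ≠ 0)
    (hs : (Complex.exp s - 1) / (Complex.exp s₀ - 1) ∈ Complex.slitPlane) :
    HasDerivAt (psiDiff z s₀) (psiDeriv z s) s := by
  have h1 : HasDerivAt (fun s => (Complex.exp s - 1) / (Complex.exp s₀ - 1))
      (Complex.exp s / (Complex.exp s₀ - 1)) s :=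
    ((Complex.hasDerivAt_exp s).sub_const 1).div_const _
  have h2 := (h1.clog hs).sub (((hasDerivAt_id s).sub_const s₀).mul_const z)
  refine h2.congr_deriv ?_
  have h3 : Complex.exp s - 1 ≠ 0 := by
    intro h; rw [h, zero_div] at hs; exact Complex.zero_notMem_slitPlane hs
  rw [psiDeriv, one_mul]
  congr 1
  field_simp

/-- With `q = e^s/(e^s-1)` one has `q' = q(1-q)`. Thus `ψ'` obeys an autonomous equation, the source
of both `ψ'' = x(1-x)` at the saddle and the coefficient recurrences. -/
theorem hasDerivAt_psiDeriv {z s : ℂ} (h0 : Complex.exp s - 1 ≠ 0) :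
    HasDerivAt (psiDeriv z) ((psiDeriv z s + z) * (1 - z - psiDeriv z s)) s := by
  have h1 := ((Complex.hasDerivAt_exp s).div ((Complex.hasDerivAt_exp s).sub_const 1) h0).sub_const z
  refine h1.congr_deriv ?_
  unfold psiDeriv
  field_simp
  ring

theorem one_add_saddleH {x : ℝ} (hx1 : x < 1) : 1 + saddleH x = (1 - x)⁻¹ := by
  unfold saddleH
  have : 1 - x ≠ 0 := by linarith
  field_simp
  ring

section saddle

variable {x : ℝ} {s₀ : ℂ} (hx0 : 0 < x) (hx1 : x < 1) (hs₀ : Complex.exp s₀ = -(saddleH x : ℂ))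

include hx0 hx1 hs₀

theorem exp_saddle_sub_one_ne_zero : Complex.exp s₀ - 1 ≠ 0 := by
  rw [hs₀, ← Complex.ofReal_neg, ← Complex.ofReal_one, ← Complex.ofReal_sub,
    Complex.ofReal_ne_zero]
  linarith [saddleH_pos hx0 hx1]

/-- The quotient becomes `h/(1+h) = x`. Only `e^{s₀} = -h` enters, so both saddles are covered. -/
theorem psiDeriv_saddle : psiDeriv x s₀ = 0 := by
  have h := saddleH_pos hx0 hx1
  have h1 : (1 + saddleH x : ℝ) ≠ 0 := by positivity
  have h2 : saddleH x / (1 + saddleH x) = x := by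
    rw [one_add_saddleH hx1, saddleH]
    have : 1 - x ≠ 0 := by linarith
    field_simp
  rw [psiDeriv, hs₀, show -(saddleH x : ℂ) - 1 = -(1 + saddleH x) by ring, neg_div_neg_eq]
  rw [sub_eq_zero]
  exact_mod_cast h2

theorem hasDerivAt_psiDiff_saddle : HasDerivAt (psiDiff x s₀) 0 s₀ := by
  have h0 := exp_saddle_sub_one_ne_zero hx0 hx1 hs₀
  have := hasDerivAt_psiDiff (z := x) h0 (s := s₀) (by rw [div_self h0]; simp)
  rwa [psiDeriv_saddle hx0 hx1 hs₀] at this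

theorem eventually_slitPlane_saddle :
    ∀ᶠ s in 𝓝 s₀, (Complex.exp s - 1) / (Complex.exp s₀ - 1) ∈ Complex.slitPlane := by
  have h0 := exp_saddle_sub_one_ne_zero hx0 hx1 hs₀
  have hc : ContinuousAt (fun s => (Complex.exp s - 1) / (Complex.exp s₀ - 1)) s₀ := by fun_prop
  refine hc.eventually_mem (Complex.isOpen_slitPlane.mem_nhds ?_)
  rw [div_self h0]; simp

theorem analyticAt_psiDiff : AnalyticAt ℂ (psiDiff x s₀) s₀ := by
  have h0 := exp_saddle_sub_one_ne_zero hx0 hx1 hs₀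
  rw [Complex.analyticAt_iff_eventually_differentiableAt]
  filter_upwards [eventually_slitPlane_saddle hx0 hx1 hs₀] with s hs
  exact (hasDerivAt_psiDiff h0 hs).differentiableAt

/-- The local inversion of `ψ(s) - ψ(s₀) = w² / 2` exists and is unique up to `w ↦ -w`. -/
theorem exists_saddleInversion :
    ∃ V : ℂ → ℂ, IsSaddleInversion x s₀ V ∧ deriv V 0 = ((√(x * (1 - x)))⁻¹ : ℝ) ∧
      ∀ s : ℂ → ℂ, IsSaddleInversion x s₀ s →
        (∀ᶠ w in 𝓝 0, s w = V w) ∨ ∀ᶠ w in 𝓝 0, s w = V (-w) := by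
  have h0 := exp_saddle_sub_one_ne_zero hx0 hx1 hs₀
  have hd0 := psiDeriv_saddle hx0 hx1 hs₀
  have hpos : 0 < x * (1 - x) := mul_pos hx0 (by linarith)
  have hslit := eventually_slitPlane_saddle hx0 hx1 hs₀
  have hsecond : HasDerivAt (psiDeriv x) ((x * (1 - x) : ℝ) : ℂ) s₀ := by
    refine (hasDerivAt_psiDeriv h0).congr_deriv ?_
    rw [hd0]; push_cast; ring
  obtain ⟨W, hWa, hW0, hW', hWeq⟩ := exists_analytic_sqrt_of_double_zero
    (analyticAt_psiDiff hx0 hx1 hs₀) (by simp [psiDiff, div_self h0])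
    (hslit.mono fun s hs => hasDerivAt_psiDiff h0 hs) hd0 hsecond
    (Complex.ofReal_mem_slitPlane.mpr hpos)
  have hW'' : deriv W s₀ = (√(x * (1 - x)) : ℝ) := by
    rw [hW', Real.sqrt_eq_rpow, Complex.ofReal_cpow hpos.le]
    norm_num
  have hne : deriv W s₀ ≠ 0 := by
    rw [hW'']; exact_mod_cast (Real.sqrt_pos.mpr hpos).ne'
  set V := hWa.hasStrictDerivAt.localInverse _ _ _ hne with hV
  have hVa : AnalyticAt ℂ V 0 := by
    have := hWa.analyticAt_localInverse hne
    rwa [hW0] at this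
  have hV0 : V 0 = s₀ := by
    have : V (W s₀) = s₀ := HasStrictFDerivAt.localInverse_apply_image ..
    rwa [hW0] at this
  have hVW : ∀ᶠ s in 𝓝 s₀, V (W s) = s := HasStrictDerivAt.eventually_left_inverse ..
  have hWV : ∀ᶠ w in 𝓝 0, W (V w) = w := by
    have : ∀ᶠ w in 𝓝 (W s₀), W (V w) = w := HasStrictDerivAt.eventually_right_inverse ..
    rwa [hW0] at this
  have hVd : deriv V 0 = ((√(x * (1 - x)))⁻¹ : ℝ) := by
    have : HasStrictDerivAt V (deriv W s₀)⁻¹ (W s₀) := HasStrictDerivAt.to_localInverse ..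
    rw [hW0, hW''] at this
    rw [this.hasDerivAt.deriv]
    push_cast; rfl
  have hVt : Tendsto V (𝓝 0) (𝓝 s₀) := by
    have := hVa.continuousAt.tendsto
    rwa [hV0] at this
  refine ⟨V, ⟨hVa, hV0, ?_, ?_⟩, hVd, fun s hs => ?_⟩
  · rw [hVd]; exact_mod_cast (inv_pos.mpr (Real.sqrt_pos.mpr hpos)).ne'
  · filter_upwards [hVt.eventually hWeq, hWV] with w h1 h2
    rw [h1, h2]
  · have hst : Tendsto s (𝓝 0) (𝓝 s₀) := by
      have := hs.analyticAt.continuousAt.tendsto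
      rwa [hs.map_zero] at this
    -- For any inversion `s` this forces `W ∘ s = ± id`; applying `V` gives `s(w) = V(±w)`.
    have hsq : ∀ᶠ w in 𝓝 (0 : ℂ), W (s w) ^ 2 = w ^ 2 := by
      filter_upwards [hst.eventually hWeq, hs.eventually_eq] with w h1 h2
      rw [h1] at h2
      linear_combination 2 * h2
    have hWs : AnalyticAt ℂ (fun w => W (s w)) 0 := by
      refine AnalyticAt.fun_comp ?_ hs.analyticAt
      rwa [hs.map_zero]
    refine (analytic_eq_or_eq_neg hWs analyticAt_id hsq).imp (fun h => ?_) (fun h => ?_)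
    · filter_upwards [h, hst.eventually hVW] with w h1 h2
      rw [← h2, h1]; rfl
    · filter_upwards [h, hst.eventually hVW] with w h1 h2
      rw [← h2, h1]; rfl

end saddle

/-- The map `t ↦ conj t - 2πi` is the reflection in the line `Im t = -π`; it conjugates `e^t` and
fixes the saddle. Off the cut the principal logarithm commutes with conjugation. -/
theorem psiDiff_conj_lowerSaddle {x : ℝ} (hx0 : 0 < x) (hx1 : x < 1) {t : ℂ}
    (ht : (Complex.exp t - 1) / (Complex.exp (lowerSaddle x) - 1) ∈ Complex.slitPlane) :
    psiDiff x (lowerSaddle x) (starRingEnd ℂ t - 2 * Real.pi * Complex.I)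
      = starRingEnd ℂ (psiDiff x (lowerSaddle x) t) := by
  have h1 : Complex.exp (starRingEnd ℂ t - 2 * Real.pi * Complex.I)
      = starRingEnd ℂ (Complex.exp t) := by
    rw [Complex.exp_sub, Complex.exp_two_pi_mul_I, div_one, Complex.exp_conj]
  have h2 : starRingEnd ℂ (Complex.exp (lowerSaddle x)) = Complex.exp (lowerSaddle x) := by
    rw [exp_lowerSaddle hx0 hx1]; simp
  have h3 : starRingEnd ℂ (lowerSaddle x) = lowerSaddle x + 2 * Real.pi * Complex.I := by
    simp [lowerSaddle]; ring
  unfold psiDiff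
  rw [h1, map_sub, ← Complex.log_conj _ (Complex.slitPlane_arg_ne_pi ht), map_mul, map_div₀,
    map_sub, map_sub, map_sub, h2, h3, map_one, Complex.conj_ofReal]
  ring

/-- A local inversion at the lower saddle with real derivative maps small real numbers to the line
`Im s = -π`. -/
theorem saddleInversion_conj {x : ℝ} (hx0 : 0 < x) (hx1 : x < 1) {V : ℂ → ℂ}
    (hV : IsSaddleInversion x (lowerSaddle x) V)
    (hreal : starRingEnd ℂ (deriv V 0) = deriv V 0)
    (huniq : ∀ s : ℂ → ℂ, IsSaddleInversion x (lowerSaddle x) s →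
        (∀ᶠ w in 𝓝 0, s w = V w) ∨ ∀ᶠ w in 𝓝 0, s w = V (-w)) :
    ∀ᶠ w in 𝓝 (0 : ℂ), starRingEnd ℂ (V (starRingEnd ℂ w)) = V w + 2 * Real.pi * Complex.I := by
  -- The reflection of `V` in the line is again an inversion, hence `V(w)` or `V(-w)`. As `V'(0)` is
  -- real, `σ'(0) = V'(0)`, which excludes `V(-w)`.
  set σ : ℂ → ℂ := fun w => starRingEnd ℂ (V (starRingEnd ℂ w)) - 2 * Real.pi * Complex.I with hσ
  have h3 : starRingEnd ℂ (lowerSaddle x) = lowerSaddle x + 2 * Real.pi * Complex.I := by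
    simp [lowerSaddle]; ring
  have hc : Tendsto (starRingEnd ℂ) (𝓝 (0 : ℂ)) (𝓝 0) := by
    simpa using (Complex.continuous_conj.tendsto (0 : ℂ))
  have hσd : deriv σ 0 = deriv V 0 := by
    have h1 : HasDerivAt V (deriv V 0) (starRingEnd ℂ 0) := by
      simpa using hV.analyticAt.differentiableAt.hasDerivAt
    have h2 := h1.conj_conj.sub_const (2 * Real.pi * Complex.I)
    rw [hreal] at h2
    simpa [Function.comp_def, hσ] using h2.deriv
  have hVt : Tendsto V (𝓝 0) (𝓝 (lowerSaddle x)) := by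
    have := hV.analyticAt.continuousAt.tendsto
    rwa [hV.map_zero] at this
  have hσinv : IsSaddleInversion x (lowerSaddle x) σ := by
    refine ⟨(analyticAt_conj_conj hV.analyticAt).sub analyticAt_const, ?_, ?_, ?_⟩
    · simp [hσ, hV.map_zero, h3]
    · rw [hσd]; exact hV.deriv_ne_zero
    · have hslit := eventually_slitPlane_saddle hx0 hx1 (exp_lowerSaddle hx0 hx1)
      filter_upwards [hc.eventually (hVt.eventually hslit), hc.eventually hV.eventually_eq]
        with w h1 h2
      rw [hσ, psiDiff_conj_lowerSaddle hx0 hx1 h1, h2, map_div₀, map_pow, Complex.conj_conj,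
        Complex.conj_ofNat]
  rcases huniq σ hσinv with h | h
  · filter_upwards [h] with w hw
    rw [← hw, hσ]; ring
  · exfalso
    have h1 : deriv σ 0 = deriv (fun w => V (-w)) 0 := Filter.EventuallyEq.deriv_eq h
    rw [deriv_comp_neg, neg_zero, hσd] at h1
    exact hV.deriv_ne_zero (self_eq_neg.mp h1)

/-! ### Laplace's method on the line -/

theorem hasDerivAt_lineKernel (x u : ℝ) :
    HasDerivAt (lineKernel x)
      (Real.exp (x * u) * (x - (1 - x) * Real.exp u) / (1 + Real.exp u) ^ 2) u := by
  have h0 : 1 + Real.exp u ≠ 0 := by positivity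
  have h1 : HasDerivAt (fun u : ℝ => Real.exp (x * u)) (Real.exp (x * u) * x) u := by
    simpa using ((hasDerivAt_id u).const_mul x).exp
  refine (h1.div ((Real.hasDerivAt_exp u).const_add 1) h0).congr_deriv ?_
  congr 1
  ring

/-- The derivative has the sign of `x - (1-x)e^u`, that is, of `log h - u`. The kernel therefore has
a single peak, and outside a central interval it is bounded by its values at the ends. -/
theorem antitoneOn_lineKernel {x : ℝ} (hx0 : 0 < x) (hx1 : x < 1) :
    AntitoneOn (lineKernel x) (Set.Ici (Real.log (saddleH x))) := by
  refine antitoneOn_of_deriv_nonpos (convex_Ici _) (continuous_lineKernel x).continuousOn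
    (fun u _ => (hasDerivAt_lineKernel x u).differentiableAt.differentiableWithinAt) fun u hu => ?_
  rw [interior_Ici, Set.mem_Ioi, Real.log_lt_iff_lt_exp (saddleH_pos hx0 hx1), saddleH,
    div_lt_iff₀ (by linarith)] at hu
  rw [(hasDerivAt_lineKernel x u).deriv]
  refine div_nonpos_of_nonpos_of_nonneg ?_ (by positivity)
  exact mul_nonpos_of_nonneg_of_nonpos (Real.exp_pos _).le (by linarith)

theorem monotoneOn_lineKernel {x : ℝ} (hx0 : 0 < x) (hx1 : x < 1) :
    MonotoneOn (lineKernel x) (Set.Iic (Real.log (saddleH x))) := by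
  refine monotoneOn_of_deriv_nonneg (convex_Iic _) (continuous_lineKernel x).continuousOn
    (fun u _ => (hasDerivAt_lineKernel x u).differentiableAt.differentiableWithinAt) fun u hu => ?_
  rw [interior_Iic, Set.mem_Iio, Real.lt_log_iff_exp_lt (saddleH_pos hx0 hx1), saddleH,
    lt_div_iff₀ (by linarith)] at hu
  rw [(hasDerivAt_lineKernel x u).deriv]
  exact div_nonneg (mul_nonneg (Real.exp_pos _).le (by linarith)) (by positivity)

/-- Of the `n + 1` kernel factors, `n` are bounded by `r` and one is kept to make the integral
converge. -/
theorem norm_setIntegral_lineIntegrand_le {x : ℝ} (hx0 : 0 < x) (hx1 : x < 1) {S : Set ℝ}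
    (hS : MeasurableSet S) {r : ℝ} (hr0 : 0 ≤ r)
    (hr : ∀ u ∈ S, lineKernel x u ≤ r) (n : ℕ) :
    ‖∫ u in S, lineIntegrand x (n + 1) u‖ ≤ r ^ n * ((∫ u, lineKernel x u) * Real.pi⁻¹) := by
  have hint := ((integrable_lineKernel hx0 hx1).mul_const Real.pi⁻¹)
  calc ‖∫ u in S, lineIntegrand x (n + 1) u‖
      ≤ ∫ u in S, r ^ n * (lineKernel x u * Real.pi⁻¹) := by
        refine norm_integral_le_of_norm_le (hint.const_mul _).integrableOn
          ((ae_restrict_iff' hS).mpr (ae_of_all _ fun u hu => ?_))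
        refine (norm_lineIntegrand_le x (n + 1) u).trans ?_
        rw [pow_succ, mul_assoc]
        exact mul_le_mul_of_nonneg_right (pow_le_pow_left₀ (lineKernel_pos x u).le (hr u hu) n)
          (mul_nonneg (lineKernel_pos x u).le (by positivity))
    _ ≤ ∫ u, r ^ n * (lineKernel x u * Real.pi⁻¹) := by
        refine setIntegral_le_integral (hint.const_mul _) (ae_of_all _ fun u => ?_)
        exact mul_nonneg (pow_nonneg hr0 n) (mul_nonneg (lineKernel_pos x u).le (by positivity))
    _ = _ := by rw [integral_const_mul, integral_mul_const]

/-- Exponentiating removes the logarithm: along the line `e^{-ψ}` is the kernel up to a constant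
phase. -/
theorem lineKernel_saddleInversion {x : ℝ} (hx0 : 0 < x) (hx1 : x < 1) {u w : ℝ}
    (hq : (Complex.exp (u - Real.pi * Complex.I) - 1) / (Complex.exp (lowerSaddle x) - 1) ≠ 0)
    (h : psiDiff x (lowerSaddle x) (u - Real.pi * Complex.I) = (w : ℂ) ^ 2 / 2) :
    lineKernel x u = lineKernel x (Real.log (saddleH x)) * Real.exp (-(w ^ 2 / 2)) := by
  set l := Real.log (saddleH x) with hl
  have e1 : Complex.exp (u - Real.pi * Complex.I) = -(Real.exp u : ℂ) := by
    rw [Complex.exp_sub, Complex.exp_pi_mul_I, div_neg, div_one, Complex.ofReal_exp]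
  have e2 : Complex.exp (lowerSaddle x) = -(Real.exp l : ℂ) := by
    rw [exp_lowerSaddle hx0 hx1, hl, Real.exp_log (saddleH_pos hx0 hx1)]
  have h1 := congrArg Complex.exp h
  unfold psiDiff at h1
  rw [Complex.exp_sub, Complex.exp_log hq, e1, e2, lowerSaddle] at h1
  have h2 : (1 + Real.exp u) / (1 + Real.exp l) / Real.exp ((u - l) * x) = Real.exp (w ^ 2 / 2) := by
    have h3 : (-(Real.exp u : ℂ) - 1) / (-(Real.exp l : ℂ) - 1)
        = (((1 + Real.exp u) / (1 + Real.exp l) : ℝ) : ℂ) := by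
      rw [show -(Real.exp u : ℂ) - 1 = -(1 + Real.exp u) by ring,
        show -(Real.exp l : ℂ) - 1 = -(1 + Real.exp l) by ring, neg_div_neg_eq]
      push_cast; rfl
    rw [h3, ← hl, show ((u - Real.pi * Complex.I - (l - Real.pi * Complex.I)) * x : ℂ)
      = (((u - l) * x : ℝ) : ℂ) by push_cast; ring] at h1
    exact_mod_cast h1
  unfold lineKernel
  rw [Real.exp_neg, ← h2, show (u - l) * x = x * u - x * l by ring, Real.exp_sub]
  have p1 := Real.exp_pos u
  have p2 := Real.exp_pos l
  field_simp

/-- The Laplace expansion of the line integral, in terms of the local inversion at the saddle. -/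
theorem integral_lineIntegrand_expansion {x : ℝ} (hx0 : 0 < x) (hx1 : x < 1) {V : ℂ → ℂ}
    (hV : IsSaddleInversion x (lowerSaddle x) V) (hpos : 0 < (deriv V 0).re)
    (hconj : ∀ᶠ w in 𝓝 (0 : ℂ), starRingEnd ℂ (V (starRingEnd ℂ w)) = V w + 2 * Real.pi * Complex.I)
    (K : ℕ) :
    ∃ B : ℝ, ∀ᶠ n : ℕ in atTop,
      ‖(∫ u, lineIntegrand x n u) - lineKernel x (Real.log (saddleH x)) ^ n *
        (√(2 * Real.pi / n) * ∑ k ∈ Finset.range K, (2 ^ k * pochHalf k / (n : ℝ) ^ k : ℝ) *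
          PowerSeries.coeff (2 * k) (taylorSeries fun w => deriv V w / V w))‖
      ≤ B * (lineKernel x (Real.log (saddleH x)) ^ n * (√(2 * Real.pi / n) / (n : ℝ) ^ K)) := by
  set l := Real.log (saddleH x) with hl
  set g₀ := lineKernel x l with hg₀
  have hg₀pos : 0 < g₀ := lineKernel_pos x l
  set f : ℂ → ℂ := fun w => deriv V w / V w with hf
  have hVt : Tendsto V (𝓝 0) (𝓝 (lowerSaddle x)) := by
    have := hV.analyticAt.continuousAt.tendsto
    rwa [hV.map_zero] at this
  have hfa : AnalyticAt ℂ f 0 :=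
    hV.analyticAt.deriv.div hV.analyticAt (by rw [hV.map_zero]; exact lowerSaddle_ne_zero x)
  obtain ⟨M, hM⟩ := (taylorSeries_isBigO hfa (2 * K)).bound
  have hslit := eventually_slitPlane_saddle hx0 hx1 (exp_lowerSaddle hx0 hx1)
  have hderiv : ∀ᶠ w in 𝓝 (0 : ℂ), 0 < (deriv V w).re :=
    (Complex.continuous_re.continuousAt.comp hV.analyticAt.deriv.continuousAt).eventually
      (lt_mem_nhds hpos)
  obtain ⟨r, hr, hball⟩ := Metric.eventually_nhds_iff_ball.mp
    ((((hM.and hV.analyticAt.eventually_analyticAt).and hfa.eventually_analyticAt).and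
      (hVt.eventually hslit)).and (hderiv.and (hconj.and hV.eventually_eq)))
  -- Halving keeps the closed interval `[-a,a]` inside the open ball.
  set a := r / 2 with ha_def
  have ha : 0 < a := by positivity
  have hmem : ∀ w ∈ Set.Icc (-a) a, (w : ℂ) ∈ Metric.ball (0 : ℂ) r := by
    intro w hw
    rw [mem_ball_zero_iff, Complex.norm_real, Real.norm_eq_abs]
    have := abs_le.mpr hw
    linarith
  set U : ℝ → ℝ := fun w => (V w).re with hU
  -- For real `w` the reflection identity says exactly that `Im V(w) = -π`.
  have hVU : ∀ w ∈ Set.Icc (-a) a, V w = U w - Real.pi * Complex.I := by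
    intro w hw
    have h1 := (hball w (hmem w hw)).2.2.1
    rw [Complex.conj_ofReal] at h1
    have h2 := congrArg Complex.im h1
    simp at h2
    apply Complex.ext
    · simp [hU]
    · simp; linarith
  have hVd : ∀ w ∈ Set.Icc (-a) a, HasDerivAt V (deriv V w) (w : ℂ) := fun w hw =>
    (hball w (hmem w hw)).1.1.1.2.differentiableAt.hasDerivAt
  have hUd : ∀ w ∈ Set.Icc (-a) a, HasDerivAt U (deriv V w).re w := fun w hw =>
    (hVd w hw).real_of_complex
  -- `V` and `U` differ by a constant, but only on the closed interval; derivatives within the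
  -- interval handle the endpoints.
  have hderiv_real : ∀ w ∈ Set.Icc (-a) a, deriv V w = ((deriv V w).re : ℂ) := by
    intro w hw
    have hsub : UniqueDiffWithinAt ℝ (Set.Icc (-a) a) w := uniqueDiffOn_Icc (by linarith) w hw
    have h1 : HasDerivWithinAt (fun w : ℝ => V w) (deriv V w) (Set.Icc (-a) a) w :=
      (hVd w hw).comp_ofReal.hasDerivWithinAt
    have h2 : HasDerivWithinAt (fun w : ℝ => (U w - Real.pi * Complex.I : ℂ))
        ((deriv V w).re : ℂ) (Set.Icc (-a) a) w :=
      ((hUd w hw).ofReal_comp.sub_const _).hasDerivWithinAt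
    exact hsub.eq_deriv _ h1 (h2.congr hVU (hVU w hw))
  have hU0 : U 0 = l := by
    simp [hU, hV.map_zero, lowerSaddle, hl]
  have hUc : ContinuousOn U (Set.Icc (-a) a) := fun w hw =>
    (hUd w hw).continuousAt.continuousWithinAt
  have hUmono : StrictMonoOn U (Set.Icc (-a) a) := by
    refine strictMonoOn_of_deriv_pos (convex_Icc _ _) hUc fun w hw => ?_
    have hw' := interior_subset hw
    rw [(hUd w hw').deriv]
    exact (hball w (hmem w hw')).2.1
  have hma : -a ∈ Set.Icc (-a) a := ⟨le_rfl, by linarith⟩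
  have hpa : a ∈ Set.Icc (-a) a := ⟨by linarith, le_rfl⟩
  have h0a : (0 : ℝ) ∈ Set.Icc (-a) a := ⟨by linarith, ha.le⟩
  have hUl : U (-a) ≤ l := by rw [← hU0]; exact hUmono.monotoneOn hma h0a (by linarith)
  have hUr : l ≤ U a := by rw [← hU0]; exact hUmono.monotoneOn h0a hpa ha.le
  have hker : ∀ w ∈ Set.Icc (-a) a, lineKernel x (U w) = g₀ * Real.exp (-(w ^ 2 / 2)) := by
    intro w hw
    have h1 := hball w (hmem w hw)
    refine lineKernel_saddleInversion hx0 hx1 ?_ ?_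
    · rw [← hVU w hw]; exact Complex.slitPlane_ne_zero h1.1.2
    · rw [← hVU w hw]; exact h1.2.2.2
  obtain ⟨B, hB⟩ := norm_integral_gaussian_sub_le (f := fun w : ℝ => f w)
    (c := fun j => PowerSeries.coeff j (taylorSeries f)) (K := K) (M := max M 0) ha
    (le_max_right _ _)
    (fun w hw => ((hball w (hmem w hw)).1.1.2.continuousAt.comp
      Complex.continuous_ofReal.continuousAt).continuousWithinAt)
    (by
      intro w hw
      refine ((hball w (hmem w hw)).1.1.1.1).trans ?_
      have e : ‖‖(w : ℂ)‖ ^ (2 * K)‖ = w ^ (2 * K) := by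
        rw [norm_pow, norm_norm, Complex.norm_real, Real.norm_eq_abs, pow_mul, sq_abs, pow_mul]
      rw [e]
      exact mul_le_mul_of_nonneg_right (le_max_left _ _) (by rw [pow_mul]; positivity))
  -- Substitute `u = U(w)`: the kernel becomes a Gaussian and `du/(u - πi)` becomes `(V'/V) dw`.
  have hcentral : ∀ n : ℕ, ∫ u in U (-a)..U a, lineIntegrand x n u
      = (g₀ : ℂ) ^ n * ∫ w in -a..a, (Real.exp (-(n * w ^ 2 / 2)) : ℂ) * f w := by
    intro n
    have huIcc : Set.uIcc (-a) a = Set.Icc (-a) a := Set.uIcc_of_le (by linarith)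
    have hdc : ContinuousOn (fun w : ℝ => (deriv V w).re) (Set.Icc (-a) a) := fun w hw =>
      (Complex.continuous_re.continuousAt.comp
        ((hball w (hmem w hw)).1.1.1.2.deriv.continuousAt.comp
          Complex.continuous_ofReal.continuousAt)).continuousWithinAt
    rw [← intervalIntegral.integral_deriv_smul_comp (f := U) (f' := fun w => (deriv V w).re)
      (fun w hw => hUd w (huIcc ▸ hw)) (by rwa [huIcc]) (continuous_lineIntegrand x n),
      ← intervalIntegral.integral_const_mul]
    refine intervalIntegral.integral_congr fun w hw => ?_
    rw [huIcc] at hw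
    simp only [Function.comp, lineIntegrand, hf]
    rw [hker w hw, ← hVU w hw, Complex.real_smul, ← hderiv_real w hw,
      show -(n * w ^ 2 / 2) = n * (-(w ^ 2 / 2)) by ring, Real.exp_nat_mul]
    push_cast
    ring
  set ρ := g₀ * Real.exp (-(a ^ 2 / 2)) with hρ
  set I₀ := (∫ u, lineKernel x u) * Real.pi⁻¹ with hI₀
  have hI₀nn : 0 ≤ I₀ := mul_nonneg (integral_nonneg fun u => (lineKernel_pos x u).le)
    (by positivity)
  have htailr : ∀ u ∈ Set.Ioi (U a), lineKernel x u ≤ ρ := by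
    intro u hu
    rw [hρ, ← hker a hpa]
    exact antitoneOn_lineKernel hx0 hx1 hUr (hUr.trans (le_of_lt hu)) (le_of_lt hu)
  have htaill : ∀ u ∈ Set.Iic (U (-a)), lineKernel x u ≤ ρ := by
    intro u hu
    have := hker (-a) hma
    rw [neg_sq] at this
    rw [hρ, ← this]
    exact monotoneOn_lineKernel hx0 hx1 (le_trans hu hUl) hUl hu
  -- Exponential decay beats every power. The exponent `K + 1` is used because `√(2π/n)` is bounded
  -- below simply by `1/n`.
  have hdecay : ∀ᶠ n : ℕ in atTop,
      Real.exp (-(a ^ 2 / 2)) ^ n ≤ √(2 * Real.pi / n) / (n : ℝ) ^ K := by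
    have h1 := (Real.tendsto_pow_mul_exp_neg_atTop_nhds_zero (K + 1)).comp
      (tendsto_natCast_atTop_atTop (R := ℝ) |>.const_mul_atTop (show 0 < a ^ 2 / 2 by positivity))
    have h2 : (0 : ℝ) < (a ^ 2 / 2) ^ (K + 1) := by positivity
    filter_upwards [h1.eventually (gt_mem_nhds h2), eventually_ge_atTop 1] with n hn hn1
    have hn0 : (0 : ℝ) < n := by exact_mod_cast hn1
    have hn1' : (1 : ℝ) ≤ n := by exact_mod_cast hn1
    simp only [Function.comp] at hn
    rw [mul_pow, mul_assoc] at hn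
    have h3 : (n : ℝ) ^ (K + 1) * Real.exp (-(a ^ 2 / 2 * n)) < 1 := by
      have := (mul_lt_iff_lt_one_right h2).mp hn
      exact this
    have h4 : 1 / (n : ℝ) ≤ √(2 * Real.pi / n) := by
      refine Real.le_sqrt_of_sq_le ?_
      rw [div_pow, one_pow, div_le_div_iff₀ (by positivity) hn0]
      nlinarith [Real.pi_gt_three]
    rw [← Real.exp_nat_mul, show (n : ℝ) * -(a ^ 2 / 2) = -(a ^ 2 / 2 * n) by ring]
    calc Real.exp (-(a ^ 2 / 2 * n)) ≤ 1 / (n : ℝ) / (n : ℝ) ^ K := by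
          rw [div_div, le_div_iff₀ (by positivity), mul_comm, ← pow_succ']
          exact h3.le
      _ ≤ _ := by gcongr
  -- `B` controls the centre, and each of the two tails contributes `ρ⁻¹ I₀`; the factor `ρ⁻¹` pays
  -- for the kernel factor spent on integrability.
  refine ⟨B + 2 * (ρ⁻¹ * I₀), ?_⟩
  filter_upwards [hdecay, eventually_ge_atTop 1] with n hn hn1
  have hn0 : (0 : ℝ) < n := by exact_mod_cast hn1
  have hρpos : 0 < ρ := by positivity
  have hint := integrable_lineIntegrand hx0 hx1 hn1
  have hsplit : ∫ u, lineIntegrand x n u = (∫ u in Set.Iic (U (-a)), lineIntegrand x n u)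
      + (∫ u in U (-a)..U a, lineIntegrand x n u) + ∫ u in Set.Ioi (U a), lineIntegrand x n u := by
    rw [← intervalIntegral.integral_Iic_add_Ioi hint.integrableOn hint.integrableOn (b := U a),
      ← intervalIntegral.integral_Iic_sub_Iic hint.integrableOn hint.integrableOn]
    ring
  obtain ⟨m, rfl⟩ : ∃ m, n = m + 1 := ⟨n - 1, by omega⟩
  have t1 := norm_setIntegral_lineIntegrand_le hx0 hx1 measurableSet_Iic hρpos.le htaill m
  have t2 := norm_setIntegral_lineIntegrand_le hx0 hx1 measurableSet_Ioi hρpos.le htailr m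
  rw [← hI₀] at t1 t2
  have hρm : ρ ^ m * I₀ ≤ ρ⁻¹ * I₀ * (g₀ ^ (m + 1) *
      (√(2 * Real.pi / (m + 1 : ℕ)) / ((m + 1 : ℕ) : ℝ) ^ K)) := by
    have e1 : ρ ^ m = ρ⁻¹ * (g₀ ^ (m + 1) * Real.exp (-(a ^ 2 / 2)) ^ (m + 1)) := by
      rw [← mul_pow, ← hρ, pow_succ]; field_simp
    rw [e1]
    calc ρ⁻¹ * (g₀ ^ (m + 1) * Real.exp (-(a ^ 2 / 2)) ^ (m + 1)) * I₀
        = ρ⁻¹ * I₀ * (g₀ ^ (m + 1) * Real.exp (-(a ^ 2 / 2)) ^ (m + 1)) := by ring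
      _ ≤ _ := by gcongr
  have t3 := hB ((m + 1 : ℕ) : ℝ) hn0
  rw [hsplit, hcentral]
  set X := ∫ w in -a..a, (Real.exp (-(((m + 1 : ℕ) : ℝ) * w ^ 2 / 2)) : ℂ) * f w with hX
  set Y : ℂ := √(2 * Real.pi / (m + 1 : ℕ)) * ∑ k ∈ Finset.range K,
    (2 ^ k * pochHalf k / ((m + 1 : ℕ) : ℝ) ^ k : ℝ) *
      PowerSeries.coeff (2 * k) (taylorSeries f) with hY
  set P := ∫ u in Set.Iic (U (-a)), lineIntegrand x (m + 1) u
  set Q := ∫ u in Set.Ioi (U a), lineIntegrand x (m + 1) u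
  have t4 : ‖(g₀ : ℂ) ^ (m + 1) * (X - Y)‖ ≤ g₀ ^ (m + 1) *
      (B * (√(2 * Real.pi / (m + 1 : ℕ)) / ((m + 1 : ℕ) : ℝ) ^ K)) := by
    rw [norm_mul, norm_pow, Complex.norm_real, Real.norm_of_nonneg hg₀pos.le]
    exact mul_le_mul_of_nonneg_left t3 (by positivity)
  calc ‖P + (g₀ : ℂ) ^ (m + 1) * X + Q - (g₀ : ℂ) ^ (m + 1) * Y‖
      = ‖P + Q + (g₀ : ℂ) ^ (m + 1) * (X - Y)‖ := by congr 1; ring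
    _ ≤ ‖P‖ + ‖Q‖ + ‖(g₀ : ℂ) ^ (m + 1) * (X - Y)‖ :=
        (norm_add_le _ _).trans (add_le_add_left (norm_add_le _ _) _)
    _ ≤ ρ ^ m * I₀ + ρ ^ m * I₀ + g₀ ^ (m + 1) *
      (B * (√(2 * Real.pi / (m + 1 : ℕ)) / ((m + 1 : ℕ) : ℝ) ^ K)) := by gcongr
    _ ≤ _ := by linarith

/-! ### The differential equation for the Taylor coefficients -/

theorem derivative_taylorSeries (f : ℂ → ℂ) :
    PowerSeries.derivative ℂ (taylorSeries f) = taylorSeries (deriv f) := by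
  ext k
  rw [PowerSeries.coeff_derivative, taylorSeries_deriv, mul_comm]

theorem saddleCoeff_eq (s : ℂ → ℂ) (k : ℕ) :
    saddleCoeff s k = PowerSeries.coeff (2 * k) (taylorSeries fun w => deriv s w / s w) /
      PowerSeries.coeff 0 (taylorSeries fun w => deriv s w / s w) := by
  rw [coeff_zero_taylorSeries, coeff_taylorSeries, saddleCoeff]

section saddle

variable {x : ℝ} {s₀ : ℂ} {V : ℂ → ℂ} (hx0 : 0 < x) (hx1 : x < 1)
  (hs₀ : Complex.exp s₀ = -(saddleH x : ℂ)) (hV : IsSaddleInversion x s₀ V)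

include hx0 hx1 hs₀ hV

theorem IsSaddleInversion.eventually_slitPlane :
    ∀ᶠ w in 𝓝 (0 : ℂ), (Complex.exp (V w) - 1) / (Complex.exp s₀ - 1) ∈ Complex.slitPlane := by
  have hVt : Tendsto V (𝓝 0) (𝓝 s₀) := by
    have := hV.analyticAt.continuousAt.tendsto
    rwa [hV.map_zero] at this
  exact hVt.eventually (eventually_slitPlane_saddle hx0 hx1 hs₀)

theorem IsSaddleInversion.analyticAt_psiDeriv : AnalyticAt ℂ (fun w => psiDeriv x (V w)) 0 := by
  have h0 := exp_saddle_sub_one_ne_zero hx0 hx1 hs₀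
  have hVa := hV.analyticAt
  unfold psiDeriv
  refine AnalyticAt.sub (AnalyticAt.div (by fun_prop) (by fun_prop) ?_) analyticAt_const
  rwa [hV.map_zero]

/-- Differentiate `ψ(V(w)) - ψ(s₀) = w²/2`. -/
theorem IsSaddleInversion.taylorSeries_psiDeriv_mul_deriv :
    taylorSeries (fun w => psiDeriv x (V w)) * taylorSeries (deriv V) = PowerSeries.X := by
  have h0 := exp_saddle_sub_one_ne_zero hx0 hx1 hs₀
  rw [← taylorSeries_mul (hV.analyticAt_psiDeriv hx0 hx1 hs₀) hV.analyticAt.deriv,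
    ← taylorSeries_id]
  refine taylorSeries_congr ?_
  filter_upwards [hV.eventually_slitPlane hx0 hx1 hs₀, hV.analyticAt.eventually_analyticAt,
    hV.eventually_eq.eventually_nhds] with w h1 h2 h3
  have e1 : HasDerivAt (fun w => psiDiff x s₀ (V w)) (psiDeriv x (V w) * deriv V w) w :=
    (hasDerivAt_psiDiff h0 h1).comp w h2.differentiableAt.hasDerivAt
  have e2 : HasDerivAt (fun w : ℂ => w ^ 2 / 2) w w := by
    have := (hasDerivAt_pow 2 w).div_const 2
    refine this.congr_deriv ?_
    simp
  exact (e1.congr_of_eventuallyEq (EventuallyEq.symm h3)).unique e2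

theorem IsSaddleInversion.derivative_taylorSeries_psiDeriv :
    PowerSeries.derivative ℂ (taylorSeries fun w => psiDeriv x (V w))
      = (taylorSeries (fun w => psiDeriv x (V w)) + PowerSeries.C (x : ℂ)) *
        (PowerSeries.C (1 - x : ℂ) - taylorSeries (fun w => psiDeriv x (V w))) *
        taylorSeries (deriv V) := by
  have hya := hV.analyticAt_psiDeriv hx0 hx1 hs₀
  have hsub : PowerSeries.C (1 - x : ℂ) - taylorSeries (fun w => psiDeriv x (V w))
      = taylorSeries (fun w => (1 - x : ℂ) + (-1) * psiDeriv x (V w)) := by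
    rw [taylorSeries_add analyticAt_const (analyticAt_const.fun_mul hya), taylorSeries_const,
      taylorSeries_const_mul]
    simp [sub_eq_add_neg]
  rw [derivative_taylorSeries, hsub, ← taylorSeries_const (x : ℂ),
    ← taylorSeries_add hya analyticAt_const,
    ← taylorSeries_mul (hya.fun_add analyticAt_const)
      (analyticAt_const.fun_add (analyticAt_const.fun_mul hya)),
    ← taylorSeries_mul ((hya.fun_add analyticAt_const).fun_mul
      (analyticAt_const.fun_add (analyticAt_const.fun_mul hya))) hV.analyticAt.deriv]
  refine taylorSeries_congr ?_
  filter_upwards [hV.eventually_slitPlane hx0 hx1 hs₀, hV.analyticAt.eventually_analyticAt]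
    with w h1 h2
  have h3 : Complex.exp (V w) - 1 ≠ 0 := by
    intro h; rw [h, zero_div] at h1; exact Complex.zero_notMem_slitPlane h1
  have := ((hasDerivAt_psiDeriv (z := x) h3).comp w h2.differentiableAt.hasDerivAt).deriv
  refine this.trans ?_
  ring

/-- Multiplying by `η = ψ'(V)` and using `η V' = w` eliminates `V'`, which leaves a closed equation
for `η`. -/
theorem IsSaddleInversion.taylorSeries_psiDeriv_mul_derivative :
    taylorSeries (fun w => psiDeriv x (V w)) *
      PowerSeries.derivative ℂ (taylorSeries fun w => psiDeriv x (V w))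
      = (taylorSeries (fun w => psiDeriv x (V w)) + PowerSeries.C (x : ℂ)) *
        (PowerSeries.C (1 - x : ℂ) - taylorSeries (fun w => psiDeriv x (V w))) *
        PowerSeries.X := by
  rw [hV.derivative_taylorSeries_psiDeriv hx0 hx1 hs₀,
    ← hV.taylorSeries_psiDeriv_mul_deriv hx0 hx1 hs₀]
  ring

theorem IsSaddleInversion.coeff_zero_taylorSeries_psiDeriv :
    PowerSeries.coeff 0 (taylorSeries fun w => psiDeriv x (V w)) = 0 := by
  rw [coeff_zero_taylorSeries, hV.map_zero, psiDeriv_saddle hx0 hx1 hs₀]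

theorem IsSaddleInversion.coeff_one_taylorSeries_psiDeriv :
    PowerSeries.coeff 1 (taylorSeries fun w => psiDeriv x (V w)) * deriv V 0 = 1 := by
  have h := congrArg (PowerSeries.coeff 1) (hV.taylorSeries_psiDeriv_mul_deriv hx0 hx1 hs₀)
  rw [PowerSeries.coeff_mul, PowerSeries.coeff_one_X] at h
  simpa [Finset.antidiagonal, hV.coeff_zero_taylorSeries_psiDeriv hx0 hx1 hs₀,
    Finset.Nat.antidiagonal_succ, coeff_zero_taylorSeries, coeff_taylorSeries, hV.map_zero,
    psiDeriv_saddle hx0 hx1 hs₀] using h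

/-- Compare coefficients of `w` in that equation. Only the square is determined, in accordance with
the freedom `w ↦ -w`. -/
theorem IsSaddleInversion.coeff_one_taylorSeries_psiDeriv_sq :
    PowerSeries.coeff 1 (taylorSeries fun w => psiDeriv x (V w)) ^ 2 = x * (1 - x) := by
  have h := congrArg (PowerSeries.coeff 1) (hV.taylorSeries_psiDeriv_mul_derivative hx0 hx1 hs₀)
  rw [PowerSeries.coeff_succ_mul_X, PowerSeries.coeff_mul, PowerSeries.coeff_mul] at h
  simp only [Finset.Nat.antidiagonal_succ, Finset.Nat.antidiagonal_zero,
    PowerSeries.coeff_derivative, Finset.sum_cons, Finset.map_singleton, Finset.sum_singleton,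
    hV.coeff_zero_taylorSeries_psiDeriv hx0 hx1 hs₀, map_add, map_sub,
    PowerSeries.coeff_zero_C] at h
  simp at h
  linear_combination h

end saddle

theorem IsSaddleInversion.taylorSeries_logDeriv_mul {z s₀ : ℂ} {V : ℂ → ℂ} (hV : IsSaddleInversion z s₀ V)
    (hs₀' : s₀ ≠ 0) :
    taylorSeries (fun w => deriv V w / V w) * taylorSeries V = taylorSeries (deriv V) := by
  have hne : V 0 ≠ 0 := by rwa [hV.map_zero]
  rw [← taylorSeries_mul (hV.analyticAt.deriv.fun_div hV.analyticAt hne) hV.analyticAt]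
  refine taylorSeries_congr ?_
  filter_upwards [hV.analyticAt.continuousAt.eventually_ne hne] with w hw
  exact div_mul_cancel₀ _ hw

/-! ### Explicit coefficients -/

/-- Taylor coefficients of `s' / s` up to order six, where `s' η = W` and
`η η' = W (1 + e η - p η²)`; `a`, `v`, `s`, `f` are the coefficients of `η`, `s'`, `s`, `s' / s`. -/
theorem logDeriv_coeffs {e p m l : ℂ} (hml : m * l = 1) {a v s f : ℕ → ℂ} (ha0 : a 0 = 0)
    (ha1 : a 1 = 1)
    (ha : ∀ k, ∑ i ∈ Finset.range (k + 2), a i * (((k + 1 - i : ℕ) + 1) * a (k + 1 - i + 1))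
      = (if k = 0 then 1 else 0) + e * a k - p * ∑ i ∈ Finset.range (k + 1), a i * a (k - i))
    (hv : ∀ k, ∑ i ∈ Finset.range (k + 2), v i * a (k + 1 - i) = if k = 0 then 1 else 0)
    (hs0 : s 0 = l) (hs : ∀ k, v k = (k + 1) * s (k + 1))
    (hf : ∀ k, ∑ i ∈ Finset.range (k + 1), f i * s (k - i) = v k) :
    f 0 = m ∧ f 2 = m ^ 3 + 1 / 4 * p * m + 1 / 2 * e * m ^ 2 + 1 / 12 * e ^ 2 * m ∧
    f 4 = m ^ 5 + 5 / 12 * p * m ^ 3 + 1 / 96 * p ^ 2 * m + 5 / 6 * e * m ^ 4 + 11 / 72 * e * p *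
      m ^ 2 + 5 / 18 * e ^ 2 * m ^ 3 + 1 / 144 * e ^ 2 * p * m + 1 / 24 * e ^ 3 * m ^ 2 + 1 /
      864 * e ^ 4 * m ∧
    f 6 = m ^ 7 + 7 / 12 * p * m ^ 5 + 91 / 1440 * p ^ 2 * m ^ 3 - 1 / 384 * p ^ 3 * m + 7 / 6 * e
      * m ^ 6 + 49 / 120 * e * p * m ^ 4 + 19 / 2880 * e * p ^ 2 * m ^ 2 + 7 / 12 * e ^ 2 * m
      ^ 5 + 7 / 72 * e ^ 2 * p * m ^ 3 - 41 / 9600 * e ^ 2 * p ^ 2 * m + 7 / 45 * e ^ 3 * m ^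
      4 + 17 / 4320 * e ^ 3 * p * m ^ 2 + 91 / 4320 * e ^ 4 * m ^ 3 - 139 / 86400 * e ^ 4 * p
      * m + 1 / 1728 * e ^ 5 * m ^ 2 - 139 / 777600 * e ^ 6 * m := by
  -- The system is triangular: for `k ≥ 1` the relation at `k` is linear in `a (k+1)`, which occurs
  -- at both ends of the sum with total factor `k + 2`. The `v` and `s` follow in the same way.
  have ha2 : a 2 = 1 / 3 * e := by
    have h := ha 1
    norm_num [Finset.sum_range_succ, ha0, ha1] at h
    linear_combination h / 3
  have ha3 : a 3 = -1 / 4 * p + 1 / 36 * e ^ 2 := by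
    have h := ha 2
    norm_num [Finset.sum_range_succ, ha0, ha1, ha2] at h
    linear_combination h / 4
  have ha4 : a 4 = -1 / 10 * e * p - 1 / 270 * e ^ 3 := by
    have h := ha 3
    norm_num [Finset.sum_range_succ, ha0, ha1, ha2, ha3] at h
    linear_combination h / 5
  have ha5 : a 5 = 5 / 96 * p ^ 2 - 1 / 240 * e ^ 2 * p + 1 / 4320 * e ^ 4 := by
    have h := ha 4
    norm_num [Finset.sum_range_succ, ha0, ha1, ha2, ha3, ha4] at h
    linear_combination h / 6
  have ha6 : a 6 = 11 / 630 * e * p ^ 2 + 1 / 945 * e ^ 3 * p + 1 / 17010 * e ^ 5 := by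
    have h := ha 5
    norm_num [Finset.sum_range_succ, ha0, ha1, ha2, ha3, ha4, ha5] at h
    linear_combination h / 7
  have ha7 : a 7 = -1 / 128 * p ^ 3 - 1 / 67200 * e ^ 2 * p ^ 2 - 53 / 201600 * e ^ 4 * p - 139 /
    5443200 * e ^ 6 := by
    have h := ha 6
    norm_num [Finset.sum_range_succ, ha0, ha1, ha2, ha3, ha4, ha5, ha6] at h
    linear_combination h / 8
  have hv0 : v 0 = 1 := by
    have h := hv 0
    norm_num [Finset.sum_range_succ, ha0, ha1] at h
    linear_combination h
  have hv1 : v 1 = -1 / 3 * e := by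
    have h := hv 1
    norm_num [Finset.sum_range_succ, ha0, ha1, ha2, hv0] at h
    linear_combination h
  have hv2 : v 2 = 1 / 4 * p + 1 / 12 * e ^ 2 := by
    have h := hv 2
    norm_num [Finset.sum_range_succ, ha0, ha1, ha2, ha3, hv0, hv1] at h
    linear_combination h
  have hv3 : v 3 = -1 / 15 * e * p - 2 / 135 * e ^ 3 := by
    have h := hv 3
    norm_num [Finset.sum_range_succ, ha0, ha1, ha2, ha3, ha4, hv0, hv1, hv2] at h
    linear_combination h
  have hv4 : v 4 = 1 / 96 * p ^ 2 + 1 / 144 * e ^ 2 * p + 1 / 864 * e ^ 4 := by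
    have h := hv 4
    norm_num [Finset.sum_range_succ, ha0, ha1, ha2, ha3, ha4, ha5, hv0, hv1, hv2, hv3] at h
    linear_combination h
  have hv5 : v 5 = 1 / 210 * e * p ^ 2 + 1 / 378 * e ^ 3 * p + 1 / 2835 * e ^ 5 := by
    have h := hv 5
    norm_num [Finset.sum_range_succ, ha0, ha1, ha2, ha3, ha4, ha5, ha6, hv0, hv1, hv2, hv3, hv4] at h
    linear_combination h
  have hv6 : v 6 = -1 / 384 * p ^ 3 - 41 / 9600 * e ^ 2 * p ^ 2 - 139 / 86400 * e ^ 4 * p - 139 /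
    777600 * e ^ 6 := by
    have h := hv 6
    norm_num [Finset.sum_range_succ, ha0, ha1, ha2, ha3, ha4, ha5, ha6, ha7, hv0, hv1, hv2, hv3, hv4, hv5] at h
    linear_combination h
  have hs1 : s 1 = 1 := by
    have h := hs 0
    norm_num [hv0] at h
    linear_combination -h / 1
  have hs2 : s 2 = -1 / 6 * e := by
    have h := hs 1
    norm_num [hv1] at h
    linear_combination -h / 2
  have hs3 : s 3 = 1 / 12 * p + 1 / 36 * e ^ 2 := by
    have h := hs 2
    norm_num [hv2] at h
    linear_combination -h / 3
  have hs4 : s 4 = -1 / 60 * e * p - 1 / 270 * e ^ 3 := by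
    have h := hs 3
    norm_num [hv3] at h
    linear_combination -h / 4
  have hs5 : s 5 = 1 / 480 * p ^ 2 + 1 / 720 * e ^ 2 * p + 1 / 4320 * e ^ 4 := by
    have h := hs 4
    norm_num [hv4] at h
    linear_combination -h / 5
  have hs6 : s 6 = 1 / 1260 * e * p ^ 2 + 1 / 2268 * e ^ 3 * p + 1 / 17010 * e ^ 5 := by
    have h := hs 5
    norm_num [hv5] at h
    linear_combination -h / 6
  -- Here the top unknown is multiplied by `s 0 = l`; multiplication by `m` and `hml` solve for it.
  have hf0 : f 0 = m := by
    have h := hf 0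
    norm_num [Finset.sum_range_succ, hs0, hv0] at h
    linear_combination m * h - f 0 * hml
  have hf1 : f 1 = -m ^ 2 - 1 / 3 * e * m := by
    have h := hf 1
    norm_num [Finset.sum_range_succ, hs0, hs1, hf0, hv1] at h
    linear_combination m * h - f 1 * hml
  have hf2 : f 2 = m ^ 3 + 1 / 4 * p * m + 1 / 2 * e * m ^ 2 + 1 / 12 * e ^ 2 * m := by
    have h := hf 2
    norm_num [Finset.sum_range_succ, hs0, hs1, hs2, hf0, hf1, hv2] at h
    linear_combination m * h - f 2 * hml
  have hf3 : f 3 = -m ^ 4 - 1 / 3 * p * m ^ 2 - 2 / 3 * e * m ^ 3 - 1 / 15 * e * p * m - 1 / 6 * e ^ 2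
    * m ^ 2 - 2 / 135 * e ^ 3 * m := by
    have h := hf 3
    norm_num [Finset.sum_range_succ, hs0, hs1, hs2, hs3, hf0, hf1, hf2, hv3] at h
    linear_combination m * h - f 3 * hml
  have hf4 : f 4 = m ^ 5 + 5 / 12 * p * m ^ 3 + 1 / 96 * p ^ 2 * m + 5 / 6 * e * m ^ 4 + 11 / 72 * e *
    p * m ^ 2 + 5 / 18 * e ^ 2 * m ^ 3 + 1 / 144 * e ^ 2 * p * m + 1 / 24 * e ^ 3 * m ^ 2 + 1
    / 864 * e ^ 4 * m := by
    have h := hf 4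
    norm_num [Finset.sum_range_succ, hs0, hs1, hs2, hs3, hs4, hf0, hf1, hf2, hf3, hv4] at h
    linear_combination m * h - f 4 * hml
  have hf5 : f 5 = -m ^ 6 - 1 / 2 * p * m ^ 4 - 1 / 30 * p ^ 2 * m ^ 2 - e * m ^ 5 - 4 / 15 * e * p * m
    ^ 3 + 1 / 210 * e * p ^ 2 * m - 5 / 12 * e ^ 2 * m ^ 4 - 7 / 180 * e ^ 2 * p * m ^ 2 - 47
    / 540 * e ^ 3 * m ^ 3 + 1 / 378 * e ^ 3 * p * m - 1 / 135 * e ^ 4 * m ^ 2 + 1 / 2835 * e ^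
    5 * m := by
    have h := hf 5
    norm_num [Finset.sum_range_succ, hs0, hs1, hs2, hs3, hs4, hs5, hf0, hf1, hf2, hf3, hf4, hv5] at h
    linear_combination m * h - f 5 * hml
  have hf6 : f 6 = m ^ 7 + 7 / 12 * p * m ^ 5 + 91 / 1440 * p ^ 2 * m ^ 3 - 1 / 384 * p ^ 3 * m + 7 / 6
    * e * m ^ 6 + 49 / 120 * e * p * m ^ 4 + 19 / 2880 * e * p ^ 2 * m ^ 2 + 7 / 12 * e ^ 2 *
    m ^ 5 + 7 / 72 * e ^ 2 * p * m ^ 3 - 41 / 9600 * e ^ 2 * p ^ 2 * m + 7 / 45 * e ^ 3 * m ^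
    4 + 17 / 4320 * e ^ 3 * p * m ^ 2 + 91 / 4320 * e ^ 4 * m ^ 3 - 139 / 86400 * e ^ 4 * p *
    m + 1 / 1728 * e ^ 5 * m ^ 2 - 139 / 777600 * e ^ 6 * m := by
    have h := hf 6
    norm_num [Finset.sum_range_succ, hs0, hs1, hs2, hs3, hs4, hs5, hs6, hf0, hf1, hf2, hf3, hf4, hf5, hv6] at h
    linear_combination m * h - f 6 * hml
  exact ⟨hf0, hf2, hf4, hf6⟩

/-- Taylor coefficients of `s' / s` up to order ten, where `s' η = W` and
`η η' = W (1 - η² / 4)`; `a`, `v`, `s`, `f` are the coefficients of `η`, `s'`, `s`, `s' / s`. -/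
theorem logDeriv_coeffs_symm {m l : ℂ} (hml : m * l = 1) {a v s f : ℕ → ℂ} (ha0 : a 0 = 0)
    (ha1 : a 1 = 1)
    (ha : ∀ k, ∑ i ∈ Finset.range (k + 2), a i * (((k + 1 - i : ℕ) + 1) * a (k + 1 - i + 1))
      = (if k = 0 then 1 else 0) - (1 / 4) * ∑ i ∈ Finset.range (k + 1), a i * a (k - i))
    (hv : ∀ k, ∑ i ∈ Finset.range (k + 2), v i * a (k + 1 - i) = if k = 0 then 1 else 0)
    (hs0 : s 0 = l) (hs : ∀ k, v k = (k + 1) * s (k + 1))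
    (hf : ∀ k, ∑ i ∈ Finset.range (k + 1), f i * s (k - i) = v k) :
    f 0 = m ∧ f 2 = 1 / 16 * m + m ^ 3 ∧
    f 4 = 1 / 1536 * m + 5 / 48 * m ^ 3 + m ^ 5 ∧
    f 6 = -1 / 24576 * m + 91 / 23040 * m ^ 3 + 7 / 48 * m ^ 5 + m ^ 7 ∧
    f 8 = -1 / 2621440 * m + 61 / 2580480 * m ^ 3 + 23 / 2560 * m ^ 5 + 3 / 16 * m ^ 7 + m ^ 9 ∧
    f 10 = 19 / 377487360 * m - 5753 / 2477260800 * m ^ 3 + 1969 / 7741440 * m ^ 5 + 121 / 7680 * m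
      ^ 7 + 11 / 48 * m ^ 9 + m ^ 11 := by
  -- This is the case `e = 0`, `p = 1/4`, solved the same way. The even `a` and the odd `v` vanish,
  -- so order ten stays manageable.
  have ha2 : a 2 = 0 := by
    have h := ha 1
    norm_num [Finset.sum_range_succ, ha0, ha1] at h
    linear_combination h / 3
  have ha3 : a 3 = -1 / 16 := by
    have h := ha 2
    norm_num [Finset.sum_range_succ, ha0, ha1, ha2] at h
    linear_combination h / 4
  have ha4 : a 4 = 0 := by
    have h := ha 3
    norm_num [Finset.sum_range_succ, ha0, ha1, ha2, ha3] at h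
    linear_combination h / 5
  have ha5 : a 5 = 5 / 1536 := by
    have h := ha 4
    norm_num [Finset.sum_range_succ, ha0, ha1, ha2, ha3, ha4] at h
    linear_combination h / 6
  have ha6 : a 6 = 0 := by
    have h := ha 5
    norm_num [Finset.sum_range_succ, ha0, ha1, ha2, ha3, ha4, ha5] at h
    linear_combination h / 7
  have ha7 : a 7 = -1 / 8192 := by
    have h := ha 6
    norm_num [Finset.sum_range_succ, ha0, ha1, ha2, ha3, ha4, ha5, ha6] at h
    linear_combination h / 8
  have ha8 : a 8 = 0 := by
    have h := ha 7
    norm_num [Finset.sum_range_succ, ha0, ha1, ha2, ha3, ha4, ha5, ha6, ha7] at h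
    linear_combination h / 9
  have ha9 : a 9 = 79 / 23592960 := by
    have h := ha 8
    norm_num [Finset.sum_range_succ, ha0, ha1, ha2, ha3, ha4, ha5, ha6, ha7, ha8] at h
    linear_combination h / 10
  have ha10 : a 10 = 0 := by
    have h := ha 9
    norm_num [Finset.sum_range_succ, ha0, ha1, ha2, ha3, ha4, ha5, ha6, ha7, ha8, ha9] at h
    linear_combination h / 11
  have ha11 : a 11 = -3 / 41943040 := by
    have h := ha 10
    norm_num [Finset.sum_range_succ, ha0, ha1, ha2, ha3, ha4, ha5, ha6, ha7, ha8, ha9, ha10] at h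
    linear_combination h / 12
  have hv0 : v 0 = 1 := by
    have h := hv 0
    norm_num [Finset.sum_range_succ, ha0, ha1] at h
    linear_combination h
  have hv1 : v 1 = 0 := by
    have h := hv 1
    norm_num [Finset.sum_range_succ, ha0, ha1, ha2, hv0] at h
    linear_combination h
  have hv2 : v 2 = 1 / 16 := by
    have h := hv 2
    norm_num [Finset.sum_range_succ, ha0, ha1, ha2, ha3, hv0, hv1] at h
    linear_combination h
  have hv3 : v 3 = 0 := by
    have h := hv 3
    norm_num [Finset.sum_range_succ, ha0, ha1, ha2, ha3, ha4, hv0, hv1, hv2] at h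
    linear_combination h
  have hv4 : v 4 = 1 / 1536 := by
    have h := hv 4
    norm_num [Finset.sum_range_succ, ha0, ha1, ha2, ha3, ha4, ha5, hv0, hv1, hv2, hv3] at h
    linear_combination h
  have hv5 : v 5 = 0 := by
    have h := hv 5
    norm_num [Finset.sum_range_succ, ha0, ha1, ha2, ha3, ha4, ha5, ha6, hv0, hv1, hv2, hv3, hv4] at h
    linear_combination h
  have hv6 : v 6 = -1 / 24576 := by
    have h := hv 6
    norm_num [Finset.sum_range_succ, ha0, ha1, ha2, ha3, ha4, ha5, ha6, ha7, hv0, hv1, hv2, hv3, hv4, hv5] at h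
    linear_combination h
  have hv7 : v 7 = 0 := by
    have h := hv 7
    norm_num [Finset.sum_range_succ, ha0, ha1, ha2, ha3, ha4, ha5, ha6, ha7, ha8, hv0, hv1, hv2, hv3, hv4, hv5, hv6] at h
    linear_combination h
  have hv8 : v 8 = -1 / 2621440 := by
    have h := hv 8
    norm_num [Finset.sum_range_succ, ha0, ha1, ha2, ha3, ha4, ha5, ha6, ha7, ha8, ha9, hv0, hv1, hv2, hv3, hv4, hv5, hv6, hv7] at h
    linear_combination h
  have hv9 : v 9 = 0 := by
    have h := hv 9
    norm_num [Finset.sum_range_succ, ha0, ha1, ha2, ha3, ha4, ha5, ha6, ha7, ha8, ha9, ha10, hv0, hv1, hv2, hv3, hv4, hv5, hv6, hv7, hv8] at h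
    linear_combination h
  have hv10 : v 10 = 19 / 377487360 := by
    have h := hv 10
    norm_num [Finset.sum_range_succ, ha0, ha1, ha2, ha3, ha4, ha5, ha6, ha7, ha8, ha9, ha10, ha11, hv0, hv1, hv2, hv3, hv4, hv5, hv6, hv7, hv8, hv9] at h
    linear_combination h
  have hs1 : s 1 = 1 := by
    have h := hs 0
    norm_num [hv0] at h
    linear_combination -h / 1
  have hs2 : s 2 = 0 := by
    have h := hs 1
    norm_num [hv1] at h
    linear_combination h
  have hs3 : s 3 = 1 / 48 := by
    have h := hs 2
    norm_num [hv2] at h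
    linear_combination -h / 3
  have hs4 : s 4 = 0 := by
    have h := hs 3
    norm_num [hv3] at h
    linear_combination h
  have hs5 : s 5 = 1 / 7680 := by
    have h := hs 4
    norm_num [hv4] at h
    linear_combination -h / 5
  have hs6 : s 6 = 0 := by
    have h := hs 5
    norm_num [hv5] at h
    linear_combination h
  have hs7 : s 7 = -1 / 172032 := by
    have h := hs 6
    norm_num [hv6] at h
    linear_combination -h / 7
  have hs8 : s 8 = 0 := by
    have h := hs 7
    norm_num [hv7] at h
    linear_combination h
  have hs9 : s 9 = -1 / 23592960 := by
    have h := hs 8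
    norm_num [hv8] at h
    linear_combination -h / 9
  have hs10 : s 10 = 0 := by
    have h := hs 9
    norm_num [hv9] at h
    linear_combination h
  have hf0 : f 0 = m := by
    have h := hf 0
    norm_num [Finset.sum_range_succ, hs0, hv0] at h
    linear_combination m * h - f 0 * hml
  have hf1 : f 1 = -m ^ 2 := by
    have h := hf 1
    norm_num [Finset.sum_range_succ, hs0, hs1, hf0, hv1] at h
    linear_combination m * h - f 1 * hml
  have hf2 : f 2 = 1 / 16 * m + m ^ 3 := by
    have h := hf 2
    norm_num [Finset.sum_range_succ, hs0, hs1, hs2, hf0, hf1, hv2] at h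
    linear_combination m * h - f 2 * hml
  have hf3 : f 3 = -1 / 12 * m ^ 2 - m ^ 4 := by
    have h := hf 3
    norm_num [Finset.sum_range_succ, hs0, hs1, hs2, hs3, hf0, hf1, hf2, hv3] at h
    linear_combination m * h - f 3 * hml
  have hf4 : f 4 = 1 / 1536 * m + 5 / 48 * m ^ 3 + m ^ 5 := by
    have h := hf 4
    norm_num [Finset.sum_range_succ, hs0, hs1, hs2, hs3, hs4, hf0, hf1, hf2, hf3, hv4] at h
    linear_combination m * h - f 4 * hml
  have hf5 : f 5 = -1 / 480 * m ^ 2 - 1 / 8 * m ^ 4 - m ^ 6 := by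
    have h := hf 5
    norm_num [Finset.sum_range_succ, hs0, hs1, hs2, hs3, hs4, hs5, hf0, hf1, hf2, hf3, hf4, hv5] at h
    linear_combination m * h - f 5 * hml
  have hf6 : f 6 = -1 / 24576 * m + 91 / 23040 * m ^ 3 + 7 / 48 * m ^ 5 + m ^ 7 := by
    have h := hf 6
    norm_num [Finset.sum_range_succ, hs0, hs1, hs2, hs3, hs4, hs5, hs6, hf0, hf1, hf2, hf3, hf4, hf5, hv6] at h
    linear_combination m * h - f 6 * hml
  have hf7 : f 7 = 1 / 40320 * m ^ 2 - 1 / 160 * m ^ 4 - 1 / 6 * m ^ 6 - m ^ 8 := by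
    have h := hf 7
    norm_num [Finset.sum_range_succ, hs0, hs1, hs2, hs3, hs4, hs5, hs6, hs7, hf0, hf1, hf2, hf3, hf4, hf5, hf6, hv7] at h
    linear_combination m * h - f 7 * hml
  have hf8 : f 8 = -1 / 2621440 * m + 61 / 2580480 * m ^ 3 + 23 / 2560 * m ^ 5 + 3 / 16 * m ^ 7 + m ^ 9 := by
    have h := hf 8
    norm_num [Finset.sum_range_succ, hs0, hs1, hs2, hs3, hs4, hs5, hs6, hs7, hs8, hf0, hf1, hf2, hf3, hf4, hf5, hf6, hf7, hv8] at h
    linear_combination m * h - f 8 * hml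
  have hf9 : f 9 = 1 / 645120 * m ^ 2 - 11 / 96768 * m ^ 4 - 7 / 576 * m ^ 6 - 5 / 24 * m ^ 8 - m ^ 10 := by
    have h := hf 9
    norm_num [Finset.sum_range_succ, hs0, hs1, hs2, hs3, hs4, hs5, hs6, hs7, hs8, hs9, hf0, hf1, hf2, hf3, hf4, hf5, hf6, hf7, hf8, hv9] at h
    linear_combination m * h - f 9 * hml
  have hf10 : f 10 = 19 / 377487360 * m - 5753 / 2477260800 * m ^ 3 + 1969 / 7741440 * m ^ 5 + 121 /
    7680 * m ^ 7 + 11 / 48 * m ^ 9 + m ^ 11 := by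
    have h := hf 10
    norm_num [Finset.sum_range_succ, hs0, hs1, hs2, hs3, hs4, hs5, hs6, hs7, hs8, hs9, hs10, hf0, hf1, hf2, hf3, hf4, hf5, hf6, hf7, hf8, hf9, hv10] at h
    linear_combination m * h - f 10 * hml
  exact ⟨hf0, hf2, hf4, hf6, hf8, hf10⟩

section saddle

variable {x : ℝ} {s₀ : ℂ} {V : ℂ → ℂ} (hx0 : 0 < x) (hx1 : x < 1)
  (hs₀ : Complex.exp s₀ = -(saddleH x : ℂ)) (hs₀' : s₀ ≠ 0) (hV : IsSaddleInversion x s₀ V)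

include hx0 hx1 hs₀ hs₀' hV

/-- After rescaling `w`, the Taylor coefficients satisfy recurrences with rational coefficients. -/
theorem IsSaddleInversion.exists_rescaled_coeffs :
    ∃ (b : ℂ) (a v s f : ℕ → ℂ), b ^ 2 = x * (1 - x) ∧ a 0 = 0 ∧ a 1 = 1 ∧
      (∀ k, ∑ i ∈ Finset.range (k + 2), a i * (((k + 1 - i : ℕ) + 1) * a (k + 1 - i + 1))
        = (if k = 0 then 1 else 0) + (1 - 2 * x) * a k
          - x * (1 - x) * ∑ i ∈ Finset.range (k + 1), a i * a (k - i)) ∧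
      (∀ k, ∑ i ∈ Finset.range (k + 2), v i * a (k + 1 - i) = if k = 0 then 1 else 0) ∧
      s 0 = s₀ ∧ (∀ k, v k = (k + 1) * s (k + 1)) ∧
      (∀ k, ∑ i ∈ Finset.range (k + 1), f i * s (k - i) = v k) ∧
      ∀ k, f k = b * (b ^ k *
        PowerSeries.coeff k (taylorSeries fun w => deriv V w / V w)) := by
  set Y := taylorSeries fun w => psiDeriv x (V w) with hY
  set D := taylorSeries (deriv V) with hD
  set S := taylorSeries V with hS
  set F := taylorSeries fun w => deriv V w / V w with hF
  set b := PowerSeries.coeff 1 Y with hb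
  have hb2 : b ^ 2 = x * (1 - x) := hV.coeff_one_taylorSeries_psiDeriv_sq hx0 hx1 hs₀
  have hb0 : b ≠ 0 := left_ne_zero_of_mul_eq_one
    (hV.coeff_one_taylorSeries_psiDeriv hx0 hx1 hs₀)
  have hpow : ∀ i k : ℕ, i ≤ k → b ^ i * b ^ (k - i) = b ^ k := fun i k hik => by
    rw [← pow_add, Nat.add_sub_cancel' hik]
  have hY0 : PowerSeries.coeff 0 Y = 0 := hV.coeff_zero_taylorSeries_psiDeriv hx0 hx1 hs₀
  -- With `w = bW` these are the coefficients of `b⁻² η(bW)`, `b V'(bW)`, `V(bW)` and `b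
  -- (V'/V)(bW)`; the factor `b⁻²` makes `a 1 = 1`.
  refine ⟨b, fun k => (b ^ 2)⁻¹ * (b ^ k * PowerSeries.coeff k Y),
    fun k => b * (b ^ k * PowerSeries.coeff k D), fun k => b ^ k * PowerSeries.coeff k S,
    fun k => b * (b ^ k * PowerSeries.coeff k F), hb2, by simp [hY0], ?_, fun k => ?_, fun k => ?_,
    ?_, fun k => ?_, fun k => ?_, fun k => rfl⟩
  · simp only [← hb]; field_simp
  · have h := congrArg (PowerSeries.coeff (k + 1))
      (hV.taylorSeries_psiDeriv_mul_derivative hx0 hx1 hs₀)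
    rw [← hY, PowerSeries.coeff_succ_mul_X, show (Y + PowerSeries.C (x : ℂ)) *
      (PowerSeries.C (1 - x : ℂ) - Y) = PowerSeries.C (x * (1 - x) : ℂ) +
      PowerSeries.C (1 - 2 * x : ℂ) * Y - Y * Y by
        simp only [map_sub, map_mul, map_one, map_ofNat]; ring, map_sub, map_add,
      PowerSeries.coeff_C_mul, PowerSeries.coeff_C, PowerSeries.coeff_mul, PowerSeries.coeff_mul,
      Finset.Nat.sum_antidiagonal_eq_sum_range_succ_mk,
      Finset.Nat.sum_antidiagonal_eq_sum_range_succ_mk, ← hb2] at h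
    simp only [PowerSeries.coeff_derivative] at h
    have h1 : ∑ i ∈ Finset.range (k + 2), (b ^ 2)⁻¹ * (b ^ i * PowerSeries.coeff i Y) *
        (((k + 1 - i : ℕ) + 1) *
          ((b ^ 2)⁻¹ * (b ^ (k + 1 - i + 1) * PowerSeries.coeff (k + 1 - i + 1) Y)))
        = (b ^ 2)⁻¹ * b ^ k * ∑ i ∈ Finset.range (k + 2), PowerSeries.coeff i Y *
          (PowerSeries.coeff (k + 1 - i + 1) Y * ((k + 1 - i : ℕ) + 1)) := by
      rw [Finset.mul_sum]
      refine Finset.sum_congr rfl fun i hi => ?_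
      have hi' : i ≤ k + 1 := Nat.lt_succ_iff.mp (Finset.mem_range.mp hi)
      have e : b ^ i * b ^ (k + 1 - i + 1) = b ^ k * b ^ 2 := by
        rw [pow_succ, ← mul_assoc, hpow i (k + 1) hi']; ring
      have e2 : (b ^ 2)⁻¹ * b ^ 2 = 1 := inv_mul_cancel₀ (pow_ne_zero 2 hb0)
      linear_combination (PowerSeries.coeff i Y * PowerSeries.coeff (k + 1 - i + 1) Y *
        ((k + 1 - i : ℕ) + 1) * (b ^ 2)⁻¹ * (b ^ 2)⁻¹) * e +
        (PowerSeries.coeff i Y * PowerSeries.coeff (k + 1 - i + 1) Y *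
        ((k + 1 - i : ℕ) + 1) * (b ^ 2)⁻¹ * b ^ k) * e2
    have h2 : ∑ i ∈ Finset.range (k + 1), (b ^ 2)⁻¹ * (b ^ i * PowerSeries.coeff i Y) *
          ((b ^ 2)⁻¹ * (b ^ (k - i) * PowerSeries.coeff (k - i) Y))
        = (b ^ 2)⁻¹ * (b ^ 2)⁻¹ * b ^ k * ∑ i ∈ Finset.range (k + 1), PowerSeries.coeff i Y *
          PowerSeries.coeff (k - i) Y := by
      rw [Finset.mul_sum]
      refine Finset.sum_congr rfl fun i hi => ?_
      have hi' : i ≤ k := Nat.lt_succ_iff.mp (Finset.mem_range.mp hi)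
      rw [← hpow i k hi']; ring
    rw [h1, h2, h, ← hb2]
    by_cases hk : k = 0
    · subst hk
      field_simp
      simp
    · simp only [hk, if_false]
      field_simp
      ring
  · have h := congrArg (PowerSeries.coeff (k + 1))
      (hV.taylorSeries_psiDeriv_mul_deriv hx0 hx1 hs₀)
    rw [← hY, ← hD, mul_comm, PowerSeries.coeff_mul,
      Finset.Nat.sum_antidiagonal_eq_sum_range_succ_mk, PowerSeries.coeff_X] at h
    have h1 : ∑ i ∈ Finset.range (k + 2), b * (b ^ i * PowerSeries.coeff i D) *
        ((b ^ 2)⁻¹ * (b ^ (k + 1 - i) * PowerSeries.coeff (k + 1 - i) Y))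
        = b ^ k * ∑ i ∈ Finset.range (k + 2), PowerSeries.coeff i D *
          PowerSeries.coeff (k + 1 - i) Y := by
      rw [Finset.mul_sum]
      refine Finset.sum_congr rfl fun i hi => ?_
      have hi' : i ≤ k + 1 := Nat.lt_succ_iff.mp (Finset.mem_range.mp hi)
      have e : b ^ i * b ^ (k + 1 - i) = b ^ k * b := by rw [hpow i (k + 1) hi', pow_succ]
      have e2 : (b ^ 2)⁻¹ * b ^ 2 = 1 := inv_mul_cancel₀ (pow_ne_zero 2 hb0)
      linear_combination (PowerSeries.coeff i D * PowerSeries.coeff (k + 1 - i) Y *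
        b * (b ^ 2)⁻¹) * e + (PowerSeries.coeff i D * PowerSeries.coeff (k + 1 - i) Y * b ^ k) * e2
    rw [h1, h]
    by_cases hk : k = 0
    · simp [hk]
    · simp [hk]
  · simp [hS, coeff_zero_taylorSeries, hV.map_zero]
  · simp only [hD, hS]
    rw [taylorSeries_deriv, pow_succ]
    ring
  · have h := congrArg (PowerSeries.coeff k) (hV.taylorSeries_logDeriv_mul hs₀')
    rw [← hF, ← hD, ← hS, PowerSeries.coeff_mul,
      Finset.Nat.sum_antidiagonal_eq_sum_range_succ_mk] at h
    beta_reduce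
    rw [← h, Finset.mul_sum, Finset.mul_sum]
    refine Finset.sum_congr rfl fun i hi => ?_
    rw [← hpow i k (Nat.lt_succ_iff.mp (Finset.mem_range.mp hi))]
    ring

theorem IsSaddleInversion.saddleCoeff_closed_forms :
    saddleCoeff V 1 = coeffA1 (-(saddleH x : ℂ)) s₀ ∧
    saddleCoeff V 2 = coeffA2 (-(saddleH x : ℂ)) s₀ ∧
    saddleCoeff V 3 = coeffA3 (-(saddleH x : ℂ)) s₀ := by
  obtain ⟨b, a, v, s, f, hb2, ha0, ha1, ha, hv, hs0, hs, hf, hfb⟩ :=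
    hV.exists_rescaled_coeffs hx0 hx1 hs₀ hs₀'
  obtain ⟨f0, f2, f4, f6⟩ := logDeriv_coeffs (inv_mul_cancel₀ hs₀') ha0 ha1 ha hv hs0 hs hf
  have hxc : (x : ℂ) ≠ 0 := by exact_mod_cast hx0.ne'
  have hxc' : (1 - x : ℂ) ≠ 0 := by
    have : (1 - x : ℝ) ≠ 0 := by linarith
    exact_mod_cast this
  have hb0 : b ≠ 0 := by
    intro h; rw [h] at hb2
    exact mul_ne_zero hxc hxc' (by rw [← hb2]; ring)
  -- Only even indices occur, so the scaling enters through `b² = x(1-x)` and the sign of `b` is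
  -- irrelevant.
  have key : ∀ k, saddleCoeff V k = f (2 * k) / ((x * (1 - x)) ^ k * s₀⁻¹) := by
    intro k
    rw [← f0, hfb, hfb, ← hb2, saddleCoeff_eq, ← pow_mul]
    field_simp
  have hh : (saddleH x : ℂ) = x / (1 - x) := by simp [saddleH]
  refine ⟨?_, ?_, ?_⟩
  · rw [key, f2, coeffA1, hh]
    field_simp
    ring
  · rw [key, f4, coeffA2, hh]
    field_simp
    ring
  · rw [key, f6, coeffA3, hh]
    field_simp
    ring

end saddle

theorem saddleCoeff_congr {s V : ℂ → ℂ} (h : ∀ᶠ w in 𝓝 0, s w = V w) (k : ℕ) :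
    saddleCoeff s k = saddleCoeff V k := by
  have hd : (fun w => deriv s w / s w) =ᶠ[𝓝 0] fun w => deriv V w / V w := by
    filter_upwards [h.eventually_nhds] with w hw
    rw [Filter.EventuallyEq.deriv_eq hw, hw.self_of_nhds]
  rw [saddleCoeff_eq, saddleCoeff_eq, taylorSeries_congr hd]

/-- The logarithmic derivative `g(w)` becomes `-g(-w)`; all its even coefficients change sign, so
their ratios do not. Hence the `A_k` do not depend on the inversion chosen. -/
theorem saddleCoeff_comp_neg (V : ℂ → ℂ) (k : ℕ) :
    saddleCoeff (fun w => V (-w)) k = saddleCoeff V k := by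
  have hd : (fun w => deriv (fun w => V (-w)) w / V (-w))
      = fun w => (-1) * (fun w => deriv V w / V w) (-w) := by
    funext w
    rw [deriv_comp_neg]
    ring
  rw [saddleCoeff_eq, saddleCoeff_eq, hd, taylorSeries_const_mul,
    taylorSeries_comp_neg fun w => deriv V w / V w, PowerSeries.coeff_C_mul,
    PowerSeries.coeff_C_mul, PowerSeries.coeff_rescale, PowerSeries.coeff_rescale, pow_mul]
  norm_num

/-! ### The symmetric case `x = 1/2` -/

theorem saddleH_half : saddleH (1 / 2) = 1 := by norm_num [saddleH]

theorem lowerSaddle_half : lowerSaddle (1 / 2) = -(Real.pi * Complex.I) := by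
  rw [lowerSaddle, saddleH_half]
  simp

section half

variable {V : ℂ → ℂ} (hV : IsSaddleInversion ((1 / 2 : ℝ) : ℂ) (lowerSaddle (1 / 2)) V)

include hV

/-- The square `Z = η²` satisfies `Z' = (1/2 - 2Z) w`, a two-step recurrence that kills its odd
coefficients. So `η(-w) = ± η(w)`, and `η'(0) ≠ 0` excludes the plus sign. -/
theorem taylorSeries_psiDeriv_half_odd :
    PowerSeries.rescale (-1) (taylorSeries fun w => psiDeriv ((1 / 2 : ℝ) : ℂ) (V w))
      = -taylorSeries fun w => psiDeriv ((1 / 2 : ℝ) : ℂ) (V w) := by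
  have h0 : (0 : ℝ) < 1 / 2 := by norm_num
  have h1 : (1 / 2 : ℝ) < 1 := by norm_num
  have hs₀ := exp_lowerSaddle h0 h1
  set Y := taylorSeries fun w => psiDeriv ((1 / 2 : ℝ) : ℂ) (V w) with hY
  have hode := hV.taylorSeries_psiDeriv_mul_derivative h0 h1 hs₀
  rw [← hY] at hode
  have hY0 : PowerSeries.coeff 0 Y = 0 := hV.coeff_zero_taylorSeries_psiDeriv h0 h1 hs₀
  have hY1 : PowerSeries.coeff 1 Y ≠ 0 :=
    left_ne_zero_of_mul_eq_one (hV.coeff_one_taylorSeries_psiDeriv h0 h1 hs₀)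
  set Z := Y * Y with hZ
  have hZode : PowerSeries.derivative ℂ Z
      = (PowerSeries.C (1 / 2 : ℂ) - PowerSeries.C 2 * Z) * PowerSeries.X := by
    have e1 : PowerSeries.C ((1 / 2 : ℝ) : ℂ) + PowerSeries.C ((1 / 2 : ℝ) : ℂ) = 1 := by
      rw [← map_add, ← map_one PowerSeries.C]; congr 1; push_cast; norm_num
    have e2 : PowerSeries.C ((1 / 2 : ℝ) : ℂ) * PowerSeries.C ((1 / 2 : ℝ) : ℂ) * 2
        = PowerSeries.C (1 / 2 : ℂ) := by
      rw [← map_ofNat PowerSeries.C 2, ← map_mul, ← map_mul]; congr 1; push_cast; norm_num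
    have e3 : PowerSeries.C (1 - ((1 / 2 : ℝ) : ℂ)) = PowerSeries.C ((1 / 2 : ℝ) : ℂ) := by
      congr 1; push_cast; norm_num
    rw [e3] at hode
    rw [hZ, Derivation.leibniz, smul_eq_mul, ← e2, map_ofNat]
    linear_combination 2 * hode
  have hrec : ∀ k : ℕ, (k + 2 : ℂ) * PowerSeries.coeff (k + 2) Z
      = (if k = 0 then 1 / 2 else 0) - 2 * PowerSeries.coeff k Z := by
    intro k
    have h := congrArg (PowerSeries.coeff (k + 1)) hZode
    rw [PowerSeries.coeff_derivative, PowerSeries.coeff_succ_mul_X, map_sub,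
      PowerSeries.coeff_C_mul, PowerSeries.coeff_C] at h
    rw [← h]; push_cast; ring
  have hodd : ∀ k, PowerSeries.coeff (2 * k + 1) Z = 0 := by
    intro k
    induction k with
    | zero =>
      have h := congrArg (PowerSeries.coeff 0) hZode
      rw [PowerSeries.coeff_derivative, PowerSeries.coeff_zero_mul_X] at h
      simpa using h
    | succ k ih =>
      have h := hrec (2 * k + 1)
      rw [ih] at h
      simp only [Nat.add_eq_zero_iff, one_ne_zero, and_false, if_false, mul_zero, sub_zero] at h
      refine (mul_eq_zero.mp h).resolve_left ?_
      exact_mod_cast (by omega : 2 * k + 1 + 2 ≠ 0)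
  have heven : PowerSeries.rescale (-1) Z = Z := by
    ext k
    rw [PowerSeries.coeff_rescale]
    rcases Nat.even_or_odd k with hk | hk
    · rw [hk.neg_one_pow, one_mul]
    · obtain ⟨m, rfl⟩ := hk
      rw [hodd, mul_zero]
  have hsq : PowerSeries.rescale (-1) Y * PowerSeries.rescale (-1) Y = Y * Y := by
    rw [← map_mul, ← hZ, heven]
  rcases mul_self_eq_mul_self_iff.mp hsq with h | h
  · exfalso
    have h2 := congrArg (PowerSeries.coeff 1) h
    rw [PowerSeries.coeff_rescale] at h2
    simp only [pow_one, neg_mul, one_mul] at h2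
    exact hY1 (neg_eq_self.mp h2)
  · exact h

/-- As `η` is odd, `V' = w/η` is even. Its coefficients are real by reflection, and `V(0) = -πi`, so
flipping `w` and conjugating coefficients sends `V` to `-V` and `V'/V` to its negative. The even
coefficients of `V'/V` are therefore imaginary and their ratios real. -/
theorem saddleCoeff_half_im
    (hconj : ∀ᶠ w in 𝓝 (0 : ℂ), starRingEnd ℂ (V (starRingEnd ℂ w)) = V w + 2 * Real.pi * Complex.I)
    (k : ℕ) : (saddleCoeff V k).im = 0 := by
  have h0 : (0 : ℝ) < 1 / 2 := by norm_num
  have h1 : (1 / 2 : ℝ) < 1 := by norm_num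
  have hs₀ := exp_lowerSaddle h0 h1
  set Y := taylorSeries fun w => psiDeriv ((1 / 2 : ℝ) : ℂ) (V w) with hY
  set D := taylorSeries (deriv V) with hD
  set S := taylorSeries V with hS
  set F := taylorSeries fun w => deriv V w / V w with hF
  have hYodd : PowerSeries.rescale (-1) Y = -Y := taylorSeries_psiDeriv_half_odd hV
  have hYD : Y * D = PowerSeries.X := hV.taylorSeries_psiDeriv_mul_deriv h0 h1 hs₀
  have hFS : F * S = D := hV.taylorSeries_logDeriv_mul (lowerSaddle_ne_zero _)
  have hY0 : Y ≠ 0 := left_ne_zero_of_mul (hYD ▸ PowerSeries.X_ne_zero)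
  have hDeven : PowerSeries.rescale (-1) D = D := by
    have h := congrArg (PowerSeries.rescale (-1)) hYD
    rw [map_mul, hYodd, PowerSeries.rescale_X] at h
    apply mul_left_cancel₀ hY0
    rw [hYD]
    have : PowerSeries.C (-1 : ℂ) = -1 := by simp
    rw [this] at h
    linear_combination -h
  have hSconj : ∀ j, starRingEnd ℂ (PowerSeries.coeff j S)
      = PowerSeries.coeff j S + if j = 0 then 2 * Real.pi * Complex.I else 0 := by
    intro j
    rw [hS, ← coeff_taylorSeries_conj_conj, taylorSeries_congr hconj,
      taylorSeries_add hV.analyticAt analyticAt_const, taylorSeries_const, map_add,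
      PowerSeries.coeff_C]
  have hDS : ∀ j : ℕ, PowerSeries.coeff j D = (j + 1) * PowerSeries.coeff (j + 1) S :=
    fun j => taylorSeries_deriv V j
  have hS0 : PowerSeries.coeff 0 S = -(Real.pi * Complex.I) := by
    rw [hS, coeff_zero_taylorSeries, hV.map_zero, lowerSaddle_half]
  have hDreal : PowerSeries.map (starRingEnd ℂ) D = D := by
    ext j
    rw [PowerSeries.coeff_map, hDS, map_mul, hSconj]
    simp
  have hSflip : PowerSeries.map (starRingEnd ℂ) (PowerSeries.rescale (-1) S) = -S := by
    ext j
    rw [PowerSeries.coeff_map, PowerSeries.coeff_rescale, map_mul, hSconj, map_neg]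
    cases j with
    | zero => rw [hS0]; simp; ring
    | succ j =>
      have h := congrArg (PowerSeries.coeff j) hDeven
      rw [PowerSeries.coeff_rescale, hDS] at h
      have hj : (j + 1 : ℂ) ≠ 0 := by exact_mod_cast j.succ_ne_zero
      have h2 : (-1) ^ j * PowerSeries.coeff (j + 1) S = PowerSeries.coeff (j + 1) S := by
        apply mul_left_cancel₀ hj
        linear_combination h
      simp only [Nat.add_eq_zero_iff, one_ne_zero, and_false, if_false, add_zero, map_pow, map_neg,
        map_one]
      rw [pow_succ]
      linear_combination -h2
  have hS' : S ≠ 0 := by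
    intro h
    rw [h] at hS0
    simp [Real.pi_ne_zero] at hS0
  have hFflip : PowerSeries.map (starRingEnd ℂ) (PowerSeries.rescale (-1) F) = -F := by
    have h := congrArg (fun P => PowerSeries.map (starRingEnd ℂ) (PowerSeries.rescale (-1) P)) hFS
    simp only [map_mul] at h
    rw [hSflip, hDeven, hDreal, ← hFS] at h
    apply mul_right_cancel₀ hS'
    linear_combination -h
  have hFim : ∀ j, starRingEnd ℂ (PowerSeries.coeff (2 * j) F) = -PowerSeries.coeff (2 * j) F := by
    intro j
    have h := congrArg (PowerSeries.coeff (2 * j)) hFflip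
    rw [PowerSeries.coeff_map, PowerSeries.coeff_rescale, pow_mul] at h
    simpa using h
  rw [← Complex.conj_eq_iff_im, saddleCoeff_eq, map_div₀, ← hF, hFim k, hFim 0, mul_zero,
    neg_div_neg_eq]

theorem saddleCoeff_half_closed_forms :
    saddleCoeff V 0 = 1 ∧
    saddleCoeff V 1 = ((-(1 / (4 * Real.pi ^ 2) * (16 - Real.pi ^ 2)) : ℝ) : ℂ) ∧
    saddleCoeff V 2 = ((1 / (96 * Real.pi ^ 4) * (1536 - 160 * Real.pi ^ 2 + Real.pi ^ 4) : ℝ) : ℂ) ∧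
    saddleCoeff V 3 = ((-(1 / (5760 * Real.pi ^ 6) *
      (368640 - 53760 * Real.pi ^ 2 + 1456 * Real.pi ^ 4 + 15 * Real.pi ^ 6)) : ℝ) : ℂ) ∧
    saddleCoeff V 4 = ((1 / (645120 * Real.pi ^ 8) *
      (165150720 - 30965760 * Real.pi ^ 2 + 1483776 * Real.pi ^ 4 - 3904 * Real.pi ^ 6
        - 63 * Real.pi ^ 8) : ℝ) : ℂ) ∧
    saddleCoeff V 5 = ((-(1 / (38707200 * Real.pi ^ 10) *
      (39636172800 - 9083289600 * Real.pi ^ 2 + 624476160 * Real.pi ^ 4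
        - 10081280 * Real.pi ^ 6 - 92048 * Real.pi ^ 8 - 1995 * Real.pi ^ 10)) : ℝ) : ℂ) := by
  have h0 : (0 : ℝ) < 1 / 2 := by norm_num
  have h1 : (1 / 2 : ℝ) < 1 := by norm_num
  have hs₀ := exp_lowerSaddle h0 h1
  have hs₀' := lowerSaddle_ne_zero (1 / 2)
  obtain ⟨b, a, v, s, f, hb2, ha0, ha1, ha, hv, hs0, hs, hf, hfb⟩ :=
    hV.exists_rescaled_coeffs h0 h1 hs₀ hs₀'
  have ha' : ∀ k, ∑ i ∈ Finset.range (k + 2), a i * (((k + 1 - i : ℕ) + 1) * a (k + 1 - i + 1))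
      = (if k = 0 then 1 else 0) - (1 / 4) * ∑ i ∈ Finset.range (k + 1), a i * a (k - i) := by
    intro k
    rw [ha k]
    push_cast
    ring
  obtain ⟨f0, f2, f4, f6, f8, f10⟩ :=
    logDeriv_coeffs_symm (inv_mul_cancel₀ hs₀') ha0 ha1 ha' hv hs0 hs hf
  have hb4 : b ^ 2 = 1 / 4 := by rw [hb2]; push_cast; norm_num
  have hb0 : b ≠ 0 := by
    intro h; rw [h] at hb4; norm_num at hb4
  set m := (lowerSaddle (1 / 2))⁻¹ with hm
  have hm0 : m ≠ 0 := inv_ne_zero hs₀'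
  have hpi : (Real.pi : ℂ) ≠ 0 := by exact_mod_cast Real.pi_ne_zero
  have hm2 : m ^ 2 = -(1 / (Real.pi : ℂ) ^ 2) := by
    rw [hm, lowerSaddle_half, inv_pow, neg_sq, mul_pow, Complex.I_sq]
    field_simp
  -- Dividing by `b^{2k} = 4^{-k}` and by `f 0 = m` leaves a polynomial in `m² = -1/π²`.
  have key : ∀ k (t : ℂ), f (2 * k) = m * t → saddleCoeff V k = 4 ^ k * t := by
    intro k t ht
    have e : saddleCoeff V k = f (2 * k) / ((b ^ 2) ^ k * f 0) := by
      rw [hfb, hfb, saddleCoeff_eq, ← pow_mul]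
      field_simp
    rw [e, ht, f0, hb4, div_pow, one_pow]
    field_simp
  refine ⟨?_, ?_, ?_, ?_, ?_, ?_⟩
  · rw [key 0 1 (by rw [f0, mul_one])]; simp
  · rw [key 1 (1 / 16 + m ^ 2)
      (by rw [f2]; ring), hm2]
    push_cast
    field_simp
    ring
  · rw [key 2 (1 / 1536 + 5 / 48 * m ^ 2 + (m ^ 2) ^ 2)
      (by rw [f4]; ring), hm2]
    push_cast
    field_simp
    ring
  · rw [key 3 (-1 / 24576 + 91 / 23040 * m ^ 2 + 7 / 48 * (m ^ 2) ^ 2 + (m ^ 2) ^ 3)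
      (by rw [f6]; ring), hm2]
    push_cast
    field_simp
    ring
  · rw [key 4 (-1 / 2621440 + 61 / 2580480 * m ^ 2 + 23 / 2560 * (m ^ 2) ^ 2 + 3 / 16 * (m ^ 2) ^ 3
      + (m ^ 2) ^ 4)
      (by rw [f8]; ring), hm2]
    push_cast
    field_simp
    ring
  · rw [key 5 (19 / 377487360 - 5753 / 2477260800 * m ^ 2 + 1969 / 7741440 * (m ^ 2) ^ 2
      + 121 / 7680 * (m ^ 2) ^ 3 + 11 / 48 * (m ^ 2) ^ 4 + (m ^ 2) ^ 5)
      (by rw [f10]; ring), hm2]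
    push_cast
    field_simp
    ring

end half

theorem rescale_neg_one_bernoulliPowerSeries :
    PowerSeries.rescale (-1) (bernoulliPowerSeries ℝ)
      = bernoulliPowerSeries ℝ * PowerSeries.exp ℝ := by
  have h := bernoulliPowerSeries_mul_exp_sub_one ℝ
  have hexp : PowerSeries.rescale (-1) (PowerSeries.exp ℝ) * PowerSeries.exp ℝ = 1 := by
    have := PowerSeries.exp_mul_exp_neg_eq_one (A := ℝ)
    rw [PowerSeries.evalNegHom] at this
    rw [mul_comm]; exact this
  have h2 := congrArg (PowerSeries.rescale (-1)) h
  rw [map_mul, map_sub, map_one, PowerSeries.rescale_X] at h2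
  have hC : PowerSeries.C (-1 : ℝ) = -1 := by simp
  rw [hC] at h2
  have hne : PowerSeries.exp ℝ - 1 ≠ 0 := right_ne_zero_of_mul (h ▸ PowerSeries.X_ne_zero)
  apply mul_right_cancel₀ hne
  linear_combination (-PowerSeries.exp ℝ) * h2 - PowerSeries.exp ℝ * h +
    PowerSeries.rescale (-1) (bernoulliPowerSeries ℝ) * hexp

/-- Under `t ↦ -t` the `n`-th power gains `e^{nt}`, which turns `e^{-nt/2}` back into `e^{nt/2}`:
the generating series is even. -/
theorem genBernoulli_half_odd {n : ℕ} (hn : Odd n) : genBernoulli n n (1 / 2 * n) = 0 := by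
  set P := bernoulliPowerSeries ℝ ^ n *
    PowerSeries.rescale ((1 / 2 * n : ℝ)) (PowerSeries.exp ℝ) with hP
  have hflip : PowerSeries.rescale (-1) P = P := by
    rw [hP, map_mul, map_pow, rescale_neg_one_bernoulliPowerSeries, mul_pow,
      PowerSeries.exp_pow_eq_rescale_exp, PowerSeries.rescale_rescale, mul_assoc,
      PowerSeries.exp_mul_exp_eq_exp_add]
    congr 3
    ring
  have h := congrArg (PowerSeries.coeff n) hflip
  rw [PowerSeries.coeff_rescale, hn.neg_one_pow] at h
  have h0 : PowerSeries.coeff n P = 0 := by linarith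
  rw [genBernoulli, ← hP, h0, mul_zero]

/-! ### Amplitude, phase and the real expansion -/

theorem norm_upperSaddle (x : ℝ) :
    ‖upperSaddle x‖ = √(Real.log (saddleH x) ^ 2 + Real.pi ^ 2) := by
  rw [upperSaddle, Complex.norm_add_mul_I]

theorem inv_lowerSaddle (x : ℝ) :
    (lowerSaddle x)⁻¹ = Complex.exp (Complex.arg (upperSaddle x) * Complex.I) /
      (√(Real.log (saddleH x) ^ 2 + Real.pi ^ 2) : ℝ) := by
  have h1 : lowerSaddle x = starRingEnd ℂ (upperSaddle x) := by
    simp [lowerSaddle, upperSaddle, sub_eq_add_neg]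
  have h2 := Complex.norm_mul_exp_arg_mul_I (upperSaddle x)
  rw [h1]
  nth_rw 1 [← h2]
  rw [map_mul, Complex.conj_ofReal, ← Complex.exp_conj, map_mul, Complex.conj_I,
    Complex.conj_ofReal, norm_upperSaddle, mul_neg, Complex.exp_neg, mul_inv, inv_inv]
  ring

theorem lineKernel_log_saddleH {x : ℝ} (hx0 : 0 < x) (hx1 : x < 1) :
    lineKernel x (Real.log (saddleH x)) = saddleH x ^ x * (1 - x) := by
  rw [lineKernel, Real.exp_log (saddleH_pos hx0 hx1), one_add_saddleH hx1, div_inv_eq_mul,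
    Real.rpow_def_of_pos (saddleH_pos hx0 hx1), mul_comm x]

/-- The key is `x(1-x) = h(1-x)²`, which turns `V'(0)` into `h^{-1/2}(1-x)^{-1}`; the power `h^x
(1-x)` is the peak of the kernel. -/
theorem oscPrefactor_eq {x : ℝ} (hx0 : 0 < x) (hx1 : x < 1) {n : ℕ} (hn : 1 ≤ n) :
    oscPrefactor x n = n.factorial / Real.pi * (-1) ^ n *
      (lineKernel x (Real.log (saddleH x)) ^ n * √(2 * Real.pi / n)) *
      ((√(x * (1 - x)))⁻¹ / √(Real.log (saddleH x) ^ 2 + Real.pi ^ 2)) := by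
  have hh := saddleH_pos hx0 hx1
  have hn0 : (0 : ℝ) < n := by exact_mod_cast hn
  have h1x : 0 < 1 - x := by linarith
  have hpi := Real.pi_pos
  have e1 : √(2 * Real.pi / n) / Real.pi = 2 / √(2 * Real.pi * n) := by
    rw [div_eq_div_iff (by positivity) (by positivity), ← Real.sqrt_mul (by positivity),
      show 2 * Real.pi / n * (2 * Real.pi * n) = (2 * Real.pi) ^ 2 by field_simp,
      Real.sqrt_sq (by positivity)]
  have e2 : (√(x * (1 - x)))⁻¹ = saddleH x ^ (-(1 / 2) : ℝ) * (1 - x)⁻¹ := by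
    have : x * (1 - x) = saddleH x * (1 - x) ^ 2 := by
      rw [saddleH]; field_simp
    rw [this, Real.sqrt_mul hh.le, Real.sqrt_sq h1x.le, mul_inv, Real.rpow_neg hh.le,
      Real.sqrt_eq_rpow]
  have e3 : saddleH x ^ ((n : ℝ) * x - 1 / 2) = (saddleH x ^ x) ^ n * saddleH x ^ (-(1 / 2) : ℝ) := by
    rw [sub_eq_add_neg, Real.rpow_add hh, mul_comm (n : ℝ), Real.rpow_mul hh.le, Real.rpow_natCast]
  have e4 : (1 - x) ^ ((n : ℤ) - 1) = (1 - x) ^ n * (1 - x)⁻¹ := by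
    rw [zpow_sub_one₀ h1x.ne', zpow_natCast]
  rw [oscPrefactor, e2, e3, e4, lineKernel_log_saddleH hx0 hx1, mul_pow]
  calc _ = (2 / √(2 * Real.pi * n)) * ((-1) ^ n * n.factorial * ((1 - x) ^ n * (1 - x)⁻¹ /
        √(Real.log (saddleH x) ^ 2 + Real.pi ^ 2)) *
        ((saddleH x ^ x) ^ n * saddleH x ^ (-(1 / 2) : ℝ))) := by ring
    _ = _ := by rw [← e1]; ring

/-- The phases of the line and of `1/λ` combine to `e^{i(π/2 - Θ)}`. Taking imaginary parts pairs
`cos Θ` with `Re A_k` and `sin Θ` with `Im A_k`. -/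
theorem exp_mul_exp_arg (x : ℝ) (n : ℕ) :
    Complex.exp (-(Real.pi * n * x : ℝ) * Complex.I) *
      Complex.exp (Complex.arg (upperSaddle x) * Complex.I)
      = Real.sin (phaseTheta x n) + Real.cos (phaseTheta x n) * Complex.I := by
  have h : Complex.exp (-(Real.pi * n * x : ℝ) * Complex.I) *
      Complex.exp (Complex.arg (upperSaddle x) * Complex.I)
      = Complex.exp (((Real.pi / 2 - phaseTheta x n : ℝ) : ℂ) * Complex.I) := by
    rw [← Complex.exp_add, phaseTheta]; congr 1; push_cast; ring
  rw [h, Complex.exp_mul_I, ← Complex.ofReal_cos, ← Complex.ofReal_sin, Real.cos_pi_div_two_sub,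
    Real.sin_pi_div_two_sub]

/-- The `k = 0` term drops out of the sine sum because `A_0` is real. -/
theorem im_sum_saddle {A : ℕ → ℂ} (hA : (A 0).im = 0) (r : ℕ → ℝ) (s c : ℝ) (K : ℕ) :
    ((s + c * Complex.I : ℂ) * ∑ k ∈ Finset.range K, (r k : ℂ) * A k).im
      = c * ∑ k ∈ Finset.range K, r k * (A k).re + s * ∑ k ∈ Finset.Ico 1 K, r k * (A k).im := by
  have h : ∑ k ∈ Finset.Ico 1 K, r k * (A k).im = ∑ k ∈ Finset.range K, r k * (A k).im := by
    refine Finset.sum_subset (fun k hk => ?_) fun k hk hk' => ?_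
    · exact Finset.mem_range.mpr (Finset.mem_Ico.mp hk).2
    · have : k = 0 := by
        by_contra hne
        exact hk' (Finset.mem_Ico.mpr ⟨Nat.one_le_iff_ne_zero.mpr hne, Finset.mem_range.mp hk⟩)
      rw [this, hA, mul_zero]
  rw [h, Complex.mul_im, Complex.re_sum, Complex.im_sum]
  simp
  ring

theorem genBernoulli_expansion {x : ℝ} (hx0 : 0 < x) (hx1 : x < 1) {V : ℂ → ℂ}
    (hV : IsSaddleInversion x (lowerSaddle x) V)
    (hVd : deriv V 0 = ((√(x * (1 - x)))⁻¹ : ℝ))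
    (hconj : ∀ᶠ w in 𝓝 (0 : ℂ), starRingEnd ℂ (V (starRingEnd ℂ w)) = V w + 2 * Real.pi * Complex.I)
    (K : ℕ) :
    (fun n : ℕ => genBernoulli n n (n * x) - oscPrefactor x n *
      (Real.cos (phaseTheta x n) *
          ∑ k ∈ Finset.range K, 2 ^ k * pochHalf k / (n : ℝ) ^ k * (saddleCoeff V k).re +
        Real.sin (phaseTheta x n) *
          ∑ k ∈ Finset.Ico 1 K, 2 ^ k * pochHalf k / (n : ℝ) ^ k * (saddleCoeff V k).im))
      =O[atTop] fun n : ℕ => oscPrefactor x n / (n : ℝ) ^ K := by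
  have hpos : 0 < x * (1 - x) := mul_pos hx0 (by linarith)
  set b' := (√(x * (1 - x)))⁻¹ with hb'
  have hb'pos : 0 < b' := inv_pos.mpr (Real.sqrt_pos.mpr hpos)
  set L := √(Real.log (saddleH x) ^ 2 + Real.pi ^ 2) with hL
  have hLpos : 0 < L := Real.sqrt_pos.mpr (by have := Real.pi_pos; positivity)
  set g₀ := lineKernel x (Real.log (saddleH x)) with hg₀
  have hg₀pos : 0 < g₀ := lineKernel_pos _ _
  obtain ⟨B, hB⟩ := integral_lineIntegrand_expansion hx0 hx1 hV
    (by rw [hVd, Complex.ofReal_re]; exact hb'pos) hconj K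
  have hF0 : PowerSeries.coeff 0 (taylorSeries fun w => deriv V w / V w)
      = b' * (lowerSaddle x)⁻¹ := by
    rw [coeff_zero_taylorSeries, hVd, hV.map_zero, div_eq_mul_inv]
  have hF0ne : PowerSeries.coeff 0 (taylorSeries fun w => deriv V w / V w) ≠ 0 := by
    rw [hF0]
    exact mul_ne_zero (by exact_mod_cast hb'pos.ne') (inv_ne_zero (lowerSaddle_ne_zero x))
  have hF : ∀ k, PowerSeries.coeff (2 * k) (taylorSeries fun w => deriv V w / V w)
      = b' * (lowerSaddle x)⁻¹ * saddleCoeff V k := by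
    intro k
    rw [saddleCoeff_eq, ← hF0, mul_div_cancel₀ _ hF0ne]
  have hA0 : (saddleCoeff V 0).im = 0 := by
    rw [saddleCoeff_eq, mul_zero, div_self hF0ne, Complex.one_im]
  -- The factor `L / b'` undoes the amplitude `b' / L` contained in the prefactor.
  refine IsBigO.of_bound (B * (L / b')) ?_
  filter_upwards [hB, eventually_ge_atTop 1] with n hn hn1
  have hn0 : (0 : ℝ) < n := by exact_mod_cast hn1
  set r : ℕ → ℝ := fun k => 2 ^ k * pochHalf k / (n : ℝ) ^ k with hr
  have hosc := oscPrefactor_eq hx0 hx1 hn1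
  rw [← hb', ← hL, ← hg₀] at hosc
  set Φ : ℂ := (-1) ^ n * Complex.exp (-(Real.pi * n * x : ℝ) * Complex.I) with hΦ
  have hΦnorm : ‖Φ‖ = 1 := by
    rw [hΦ, norm_mul, ← Complex.ofReal_neg, Complex.norm_exp_ofReal_mul_I]
    simp
  set I₁ := ∫ u, lineIntegrand x n u with hI₁
  set M : ℂ := (g₀ : ℂ) ^ n * (√(2 * Real.pi / n) * ∑ k ∈ Finset.range K, (r k : ℂ) *
          PowerSeries.coeff (2 * k) (taylorSeries fun w => deriv V w / V w)) with hM
  have hmain : oscPrefactor x n * (Real.cos (phaseTheta x n) *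
          ∑ k ∈ Finset.range K, r k * (saddleCoeff V k).re +
        Real.sin (phaseTheta x n) * ∑ k ∈ Finset.Ico 1 K, r k * (saddleCoeff V k).im)
      = n.factorial / Real.pi * (Φ * M).im := by
    rw [← im_sum_saddle hA0 r, ← exp_mul_exp_arg, ← Complex.im_ofReal_mul, ← Complex.im_ofReal_mul,
      hosc, hM, hΦ]
    congr 1
    simp only [hF]
    rw [inv_lowerSaddle, ← hL]
    simp only [mul_left_comm _ ((b' : ℂ) * _), ← Finset.mul_sum]
    push_cast
    ring
  rw [hmain, genBernoulli_eq_im_integral hx0 hx1 hn1, ← mul_sub, ← Complex.sub_im, ← mul_sub]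
  have hle : |(Φ * (I₁ - M)).im| ≤ B * (g₀ ^ n * (√(2 * Real.pi / n) / (n : ℝ) ^ K)) := by
    refine (Complex.abs_im_le_norm _).trans ?_
    rw [norm_mul, hΦnorm, one_mul]
    exact hn
  have hfac : (0 : ℝ) < n.factorial / Real.pi := by
    have := Real.pi_pos
    have : (0 : ℝ) < n.factorial := by exact_mod_cast n.factorial_pos
    positivity
  have hnorm : ‖oscPrefactor x n / (n : ℝ) ^ K‖
      = n.factorial / Real.pi * (g₀ ^ n * √(2 * Real.pi / n)) * (b' / L) / (n : ℝ) ^ K := by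
    rw [hosc, norm_div, norm_mul, norm_mul, norm_mul, norm_pow, norm_neg, norm_one, one_pow, mul_one,
      Real.norm_of_nonneg hfac.le, Real.norm_of_nonneg (by positivity : 0 ≤ b' / L),
      Real.norm_of_nonneg (by positivity : 0 ≤ g₀ ^ n * √(2 * Real.pi / n)),
      Real.norm_of_nonneg (by positivity : 0 ≤ (n : ℝ) ^ K)]
  rw [hnorm, norm_mul, Real.norm_of_nonneg hfac.le, Real.norm_eq_abs]
  calc n.factorial / Real.pi * |(Φ * (I₁ - M)).im|
      ≤ n.factorial / Real.pi * (B * (g₀ ^ n * (√(2 * Real.pi / n) / (n : ℝ) ^ K))) :=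
        mul_le_mul_of_nonneg_left hle hfac.le
    _ = _ := by field_simp

theorem phaseTheta_half (n : ℕ) : phaseTheta (1 / 2) n = 1 / 2 * Real.pi * n := by
  have h : upperSaddle (1 / 2) = Real.pi * Complex.I := by
    rw [upperSaddle, saddleH_half]; simp
  rw [phaseTheta, h, Complex.arg_real_mul _ Real.pi_pos, Complex.arg_I]
  ring

theorem oscPrefactor_half (n : ℕ) : oscPrefactor (1 / 2) n = (-1) ^ n * midPrefactor n := by
  have h1 : (1 / 2 : ℝ) ^ ((n : ℤ) - 1) * 2 = 2 ^ (2 - (n : ℤ)) := by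
    rw [one_div, inv_zpow, ← zpow_neg, ← zpow_add_one₀ two_ne_zero]
    congr 1
    ring
  rw [oscPrefactor, midPrefactor, saddleH_half, Real.log_one, Real.one_rpow, ← h1,
    show (1 - 1 / 2 : ℝ) = 1 / 2 by norm_num, zero_pow two_ne_zero, zero_add,
    Real.sqrt_sq Real.pi_pos.le]
  ring

/-- The cosine vanishes for odd `n`, so the sign `(-1)^n` of the prefactor can be dropped. -/
theorem neg_one_pow_mul_cos (n : ℕ) :
    (-1) ^ n * Real.cos (1 / 2 * Real.pi * n) = Real.cos (1 / 2 * Real.pi * n) := by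
  rcases Nat.even_or_odd n with h | h
  · rw [h.neg_one_pow, one_mul]
  · obtain ⟨m, rfl⟩ := h
    have : Real.cos (1 / 2 * Real.pi * (2 * m + 1 : ℕ)) = 0 := by
      rw [show 1 / 2 * Real.pi * (2 * m + 1 : ℕ) = m * Real.pi + Real.pi / 2 by push_cast; ring,
        Real.cos_add_pi_div_two, Real.sin_nat_mul_pi, neg_zero]
    rw [this, mul_zero]

/-! ### The main theorem -/

theorem theorem2 (x : ℝ) (hx0 : 0 < x) (hx1 : x < 1) :
    -- `log h ± π i` are saddle points of `ψ`
    HasDerivAt (psiDiff x (upperSaddle x)) 0 (upperSaddle x) ∧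
    HasDerivAt (psiDiff x (lowerSaddle x)) 0 (lowerSaddle x) ∧
    ∃ A : ℕ → ℂ,
      -- `A k` is the `k`-th coefficient at the lower saddle, and it is well defined
      (∃ s : ℂ → ℂ, IsSaddleInversion x (lowerSaddle x) s) ∧
      (∀ s : ℂ → ℂ, IsSaddleInversion x (lowerSaddle x) s → ∀ k, saddleCoeff s k = A k) ∧
      A 0 = 1 ∧
      A 1 = coeffA1 (-(saddleH x : ℂ)) (lowerSaddle x) ∧
      A 2 = coeffA2 (-(saddleH x : ℂ)) (lowerSaddle x) ∧
      A 3 = coeffA3 (-(saddleH x : ℂ)) (lowerSaddle x) ∧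
      -- the asymptotic expansion
      (∀ K : ℕ,
        (fun n : ℕ => genBernoulli n n (n * x) - oscPrefactor x n *
          (Real.cos (phaseTheta x n) *
              ∑ k ∈ Finset.range K, 2 ^ k * pochHalf k / (n : ℝ) ^ k * (A k).re +
            Real.sin (phaseTheta x n) *
              ∑ k ∈ Finset.Ico 1 K, 2 ^ k * pochHalf k / (n : ℝ) ^ k * (A k).im))
        =O[atTop] fun n : ℕ => oscPrefactor x n / (n : ℝ) ^ K) ∧
      -- the special case `x = 1/2`
      (x = 1 / 2 →
        (∀ k, (A k).im = 0) ∧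
        (∀ n : ℕ, Odd n → genBernoulli n n (1 / 2 * n) = 0) ∧
        ∃ C : ℕ → ℝ,
          (∀ k, C k = (-1) ^ k * (A k).re) ∧
          C 0 = 1 ∧
          C 1 = 1 / (4 * Real.pi ^ 2) * (16 - Real.pi ^ 2) ∧
          C 2 = 1 / (96 * Real.pi ^ 4) * (1536 - 160 * Real.pi ^ 2 + Real.pi ^ 4) ∧
          C 3 = 1 / (5760 * Real.pi ^ 6) *
            (368640 - 53760 * Real.pi ^ 2 + 1456 * Real.pi ^ 4 + 15 * Real.pi ^ 6) ∧
          C 4 = 1 / (645120 * Real.pi ^ 8) *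
            (165150720 - 30965760 * Real.pi ^ 2 + 1483776 * Real.pi ^ 4 - 3904 * Real.pi ^ 6
              - 63 * Real.pi ^ 8) ∧
          C 5 = 1 / (38707200 * Real.pi ^ 10) *
            (39636172800 - 9083289600 * Real.pi ^ 2 + 624476160 * Real.pi ^ 4
              - 10081280 * Real.pi ^ 6 - 92048 * Real.pi ^ 8 - 1995 * Real.pi ^ 10) ∧
          ∀ K : ℕ,
            (fun n : ℕ => genBernoulli n n (1 / 2 * n) -
              midPrefactor n * Real.cos (1 / 2 * Real.pi * n) *
                ∑ k ∈ Finset.range K, (-2) ^ k * pochHalf k / (n : ℝ) ^ k * C k)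
            =O[atTop] fun n : ℕ => midPrefactor n / (n : ℝ) ^ K) := by
  refine ⟨hasDerivAt_psiDiff_saddle hx0 hx1 (exp_upperSaddle hx0 hx1),
    hasDerivAt_psiDiff_saddle hx0 hx1 (exp_lowerSaddle hx0 hx1), ?_⟩
  have hs₀ := exp_lowerSaddle hx0 hx1
  have hs₀' := lowerSaddle_ne_zero x
  -- This branch has `V'(0) > 0`, so it runs along the line in the direction of integration.
  obtain ⟨V, hV, hVd, huniq⟩ := exists_saddleInversion hx0 hx1 hs₀
  have hconj := saddleInversion_conj hx0 hx1 hV (by rw [hVd, Complex.conj_ofReal]) huniq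
  have hasym := genBernoulli_expansion hx0 hx1 hV hVd hconj
  obtain ⟨hA1, hA2, hA3⟩ := hV.saddleCoeff_closed_forms hx0 hx1 hs₀ hs₀'
  refine ⟨saddleCoeff V, ⟨V, hV⟩, fun s hs k => ?_, ?_, hA1, hA2, hA3, hasym, fun hx => ?_⟩
  · rcases huniq s hs with h | h
    · exact saddleCoeff_congr h k
    · rw [saddleCoeff_congr h k, saddleCoeff_comp_neg]
  · rw [saddleCoeff_eq, mul_zero, div_self]
    rw [coeff_zero_taylorSeries, hV.map_zero]
    exact div_ne_zero hV.deriv_ne_zero hs₀'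
  · subst hx
    have him := saddleCoeff_half_im hV hconj
    obtain ⟨h0, h1, h2, h3, h4, h5⟩ := saddleCoeff_half_closed_forms hV
    refine ⟨him, fun n hn => genBernoulli_half_odd hn, fun k => (-1) ^ k * (saddleCoeff V k).re,
      fun k => rfl, ?_, ?_, ?_, ?_, ?_, ?_, fun K => ?_⟩
    · beta_reduce
      rw [h0]; simp
    · beta_reduce
      rw [h1, Complex.ofReal_re]; ring
    · beta_reduce
      rw [h2, Complex.ofReal_re]; ring
    · beta_reduce
      rw [h3, Complex.ofReal_re]; ring
    · beta_reduce
      rw [h4, Complex.ofReal_re]; ring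
    · beta_reduce
      rw [h5, Complex.ofReal_re]; ring
    -- The two error scales differ only by the sign `(-1)^n`, hence the constant 1.
    · refine ((hasym K).congr_left fun n => ?_).trans
        (IsBigO.of_bound 1 (Eventually.of_forall fun n => ?_))
      · have hsum : ∑ k ∈ Finset.range K, (-2) ^ k * pochHalf k / (n : ℝ) ^ k *
            ((-1) ^ k * (saddleCoeff V k).re)
            = ∑ k ∈ Finset.range K, 2 ^ k * pochHalf k / (n : ℝ) ^ k * (saddleCoeff V k).re := by
          refine Finset.sum_congr rfl fun k _ => ?_
          have : (-2 : ℝ) ^ k * (-1) ^ k = 2 ^ k := by rw [← mul_pow]; norm_num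
          rw [← this]; ring
        simp only [him, mul_zero, Finset.sum_const_zero, add_zero]
        rw [hsum, phaseTheta_half, oscPrefactor_half, mul_comm (n : ℝ)]
        linear_combination (-midPrefactor n *
          ∑ k ∈ Finset.range K, 2 ^ k * pochHalf k / (n : ℝ) ^ k * (saddleCoeff V k).re) *
          neg_one_pow_mul_cos n
      · rw [oscPrefactor_half, one_mul, norm_div, norm_div, norm_mul, norm_pow, norm_neg, norm_one,
          one_pow, one_mul]
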